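/- Let $k$ be a field with $2\neq 0$ in $k$. Algebraic groups are smooth group schemes of finite type over $k$; varieties are separated $k$-schemes of finite type. Let $(D,G,G^*)$ be a group triple: $D$ is an algebraic group, $G,G^*\subset D$ are closed algebraic subgroups, the Lie algebra $\mathfrak d$ of $D$ carries a nondegenerate $D$-invariant symmetric pairing $\langle\cdot,\cdot\rangle$, and the Lie algebras $\mathfrak g$ of $G$ and $\mathfrak g^*$ of $G^*$ are complementary Lagrangian subspaces of $\mathfrak d$. Let $\{x_i\}$ be a basis of $\mathfrak g$, $\{x^i\}$ the dual basis of $\mathfrak g^*$, and $r=\sum_i x^i\otimes x_i$. The group $G$ carries the Poisson–Lie structure for which $G\subset D$ is a Poisson map, where $D$ carries the bivector $r^R-r^L$ ($R$ and $L$ denote right- and left-invariant extension). Let $D/G$ be the homogeneous space with its left $D$-action. Let $X$ be a Poisson $G$-variety: a variety with a Poisson bracket $\pi_X$ and a $G$-action such that $G\times X\to X$ is a Poisson map. Infinitesimal actions are normalized by $(a(\xi)f)(x)=\frac{d}{dt}\big|_{t=0}f(\exp(t\xi)x)$, and $\pi^\sharp(df)=\{f,-\}$. If a Lagrangian complement $\mathfrak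 h$ of $\mathfrak g$ in $\mathfrak d$ (not necessarily a subalgebra) has the basis $x^j-\sum_i t^{ij}x_i$ with $t^{ij}=-t^{ji}$, put $t=\sum_{i,j}t^{ij}x_i\otimes x_j$ and $\pi_X^{\mathfrak h}=\pi_X-a(t)$, so that $\pi_X^{\mathfrak g^*}=\pi_X$. The complement $\mathfrak h$ is admissible at $s\in D/G$ if the infinitesimal action identifies $\mathfrak h$ (after extension of scalars to the residue field of $s$) with the tangent space of $D/G$ at $s$. If $\mathfrak h$ is admissible on an open set $U\subset D/G$, then for $\xi\in\mathfrak g$ let $\langle\theta^{\mathfrak h},\xi\rangle$ be the one-form on $U$ whose value on the vector field generated by $\eta\in\mathfrak h$ is the constant $\langle\eta,\xi\rangle$. Let $\mu\colon X\to D/G$ be a $G$-equivariant morphism. It satisfies the Alekseev–Kosmann-Schwarzbach (AKS) moment map condition if $$a(\xi)=(\pi_X^{\mathfrak h})^\sharp\big(\mu^*\langle\theta^{\mathfrak h},\xi\rangle\big)\quad\text{on }\mu^{-1}(U)$$ for every Lagrangian complement $\mathfrak h$ of $\mathfrak g$, every open $U\subset D/G$ on which $\mathfrak h$ is admissible, and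 every $\xi\in\mathfrak g$. Let $f\colon G^*\to D\to D/G$ be the composite, and let $\mu^{-1}(G^*)=X\times_{D/G}G^*$. Then there are unique infinitesimal actions of $\mathfrak g$ on $G^*$ and on $\mu^{-1}(G^*)$ such that $f$ and the projection $\mu^{-1}(G^*)\to X$ are $\mathfrak g$-equivariant, and there is a unique Poisson structure on $\mu^{-1}(G^*)$ such that the projection to $X$ is a Poisson map. Let $\theta$ be the $\mathfrak g^*$-valued right-invariant Maurer–Cartan form on $G^*$, that is, $\theta=f^*\theta^{\mathfrak g^*}$. A map $\nu\colon Y\to G^*$ from a Poisson scheme $(Y,\pi_Y)$ with an infinitesimal action $a_Y$ of $\mathfrak g$ is a Lu moment map if it is $\mathfrak g$-equivariant and $a_Y(\xi)=\pi_Y^\sharp(\nu^*\langle\theta,\xi\rangle)$ for all $\xi\in\mathfrak g$. Then: 1. If $\mu$ satisfies the AKS moment map condition, then $\mu^{-1}(G^*)\to G^*$ is a Lu moment map. 2. If $D/G$ is irreducible and $\mu^{-1}(G^*)\to G^*$ is a Lu moment map, then $\mu$ satisfies the AKS moment map condition. -/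

import Mathlib

universe u

open CategoryTheory AlgebraicGeometry

noncomputable section

namespace MomentMap

open MonoidalCategory CartesianMonoidalCategory Limits
open scoped TensorProduct KaehlerDifferential

attribute [local instance] Hom.monoid Hom.group

/-- Schemes over the field `k`. -/
abbrev Sch (k : Type u) [Field k] := Over (Spec (CommRingCat.of k))

section Points
variable {k : Type u} [Field k]

variable (k) in
/-- `Spec R` as a `k`-scheme; morphisms `specO k R ⟶ X` are the `R`-points of `X`. -/
def specO (R : Type u) [CommRing R] [Algebra k R] : Sch k :=
  Over.mk (Spec.map (CommRingCat.ofHom (algebraMap k R)))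

/-- The morphism `Spec R' ⟶ Spec R` of a homomorphism of `k`-algebras. -/
def specMap {R R' : Type u} [CommRing R] [Algebra k R] [CommRing R'] [Algebra k R']
    (φ : R →ₐ[k] R') : specO k R' ⟶ specO k R :=
  Over.homMk (Spec.map (CommRingCat.ofHom φ.toRingHom)) (by
    simp only [specO, Over.mk_left, Over.mk_hom]
    rw [← Spec.map_comp, ← CommRingCat.ofHom_comp]
    congr 2
    exact φ.comp_algebraMap)

/-- The local ring of `X` at the point `x`. -/
abbrev Stk (X : Sch k) (x : X.left) : Type u := X.left.presheaf.stalk x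

/-- The structure of a `k`-algebra on the local rings of a `k`-scheme. -/
instance stkAlgebra (X : Sch k) (x : X.left) : Algebra k (Stk X x) :=
  (Spec.preimage (X.left.fromSpecStalk x ≫ X.hom)).hom.toAlgebra

theorem map_algebraMap_stk (X : Sch k) (x : X.left) :
    Spec.map (CommRingCat.ofHom (algebraMap k (Stk X x))) = X.left.fromSpecStalk x ≫ X.hom :=
  Spec.map_preimage _

/-- The tautological point `Spec 𝒪_{X,x} ⟶ X`. -/
def pt (X : Sch k) (x : X.left) : specO k (Stk X x) ⟶ X :=
  Over.homMk (X.left.fromSpecStalk x) (map_algebraMap_stk X x).symm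

/-- The homomorphism of local rings `𝒪_{Y,φ(x)} → 𝒪_{X,x}`. -/
def stkMap {X Y : Sch k} (φ : X ⟶ Y) (x : X.left) :
    Stk Y (φ.left x) →ₐ[k] Stk X x :=
  { (φ.left.stalkMap x).hom with
    commutes' := by
      intro r
      have h : CommRingCat.ofHom (algebraMap k (Stk Y (φ.left x))) ≫ φ.left.stalkMap x
          = CommRingCat.ofHom (algebraMap k (Stk X x)) := by
        apply Spec.map_injective
        rw [Spec.map_comp, map_algebraMap_stk, map_algebraMap_stk, 
          Scheme.SpecMap_stalkMap_fromSpecStalk_assoc, Over.w]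
      exact congr($(h).hom r) }

theorem specMap_comp {R R' R'' : Type u} [CommRing R] [Algebra k R] [CommRing R'] [Algebra k R']
    [CommRing R''] [Algebra k R''] (φ : R →ₐ[k] R') (ψ : R' →ₐ[k] R'') :
    specMap ψ ≫ specMap φ = specMap (ψ.comp φ) := by
  apply Over.OverMorphism.ext
  exact (Spec.map_comp _ _).symm

/-- For `m : Spec 𝒪_{X,x} × N ⟶ X`, the `B`-point `m(p, g)` of `X`. -/
def orbitPt {N X : Sch k} {x : X.left} (m : specO k (Stk X x) ⊗ N ⟶ X)
    {B : Type u} [CommRing B] [Algebra k B] (p : Stk X x →ₐ[k] B) (g : specO k B ⟶ N) :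
    specO k B ⟶ X :=
  lift (specMap p) g ≫ m

theorem comp_orbitPt {N X : Sch k} {x : X.left} (m : specO k (Stk X x) ⊗ N ⟶ X)
    {B C : Type u} [CommRing B] [Algebra k B] [CommRing C] [Algebra k C]
    (p : Stk X x →ₐ[k] B) (g : specO k B ⟶ N) (θ : B →ₐ[k] C) :
    specMap θ ≫ orbitPt m p g = orbitPt m (θ.comp p) (specMap θ ≫ g) := by
  simp only [orbitPt]
  rw [← Category.assoc, comp_lift, specMap_comp]

variable (G : Sch k) [GrpObj G]

/-- The unit of a group scheme, as a point of the underlying space. -/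
def unitPt : G.left := (1 : specO k k ⟶ G).left (IsLocalRing.closedPoint k)

/-- Evaluation at the unit, `f ↦ f(e)`. -/
def evUnit : Stk G (unitPt G) →+* k :=
  (Scheme.stalkClosedPointTo (R := CommRingCat.of k) (1 : specO k k ⟶ G).left).hom

theorem map_ev : Spec.map (CommRingCat.ofHom (evUnit G)) ≫ G.left.fromSpecStalk (unitPt G) =
    (1 : specO k k ⟶ G).left := 
  Scheme.Spec_stalkClosedPointTo_fromSpecStalk (R := CommRingCat.of k) _

theorem ev_algebraMap (r : k) : evUnit G (algebraMap k _ r) = r := by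
  have h : CommRingCat.ofHom (algebraMap k (Stk G (unitPt G))) ≫ CommRingCat.ofHom (evUnit G) = 𝟙 _ := by
    apply Spec.map_injective
    rw [Spec.map_comp, map_algebraMap_stk, ← Category.assoc, map_ev]
    simp
    erw [Over.w]
    simp [specO, Algebra.algebraMap_self]
  exact congr($(h).hom r)

/-- The Lie algebra of a group scheme as a vector space: the tangent space at the unit, that is,
the point derivations `ξ(f h) = f(e) ξ(h) + h(e) ξ(f)` of the local ring at the unit. -/
def Lie : Submodule k (Stk G (unitPt G) →ₗ[k] k) where
  carrier := {ξ | ∀ f h, ξ (f * h) = evUnit G f * ξ h + evUnit G h * ξ f}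
  add_mem' := by
    intro a b ha hb f h
    simp only [LinearMap.add_apply, ha f h, hb f h]; ring
  zero_mem' := by intro f h; simp
  smul_mem' := by
    intro c a ha f h
    simp only [LinearMap.smul_apply, ha f h, smul_eq_mul]; ring

section Exp
variable {G} {R : Type u} [CommRing R] [Algebra k R]

/-- `u(f)` for `u ∈ R ⊗ Lie G`, that is, `(r ⊗ ξ)(f) = r ξ(f)`. -/
def contract (u : R ⊗[k] Lie G) (f : Stk G (unitPt G)) : R :=
  LinearMap.liftBaseChange R
    ((Algebra.linearMap k R).comp ((LinearMap.applyₗ f).comp (Lie G).subtype)) u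

theorem contract_tmul (r : R) (ξ : Lie G) (f : Stk G (unitPt G)) :
    contract (r ⊗ₜ[k] ξ) f = r * algebraMap k R (ξ.1 f) := by
  simp [contract]

theorem contract_add_left (u v : R ⊗[k] Lie G) (f : Stk G (unitPt G)) :
    contract (u + v) f = contract u f + contract v f := by
  simp [contract]

theorem contract_zero_left (f : Stk G (unitPt G)) : contract (0 : R ⊗[k] Lie G) f = 0 := by
  simp [contract]

theorem contract_add (u : R ⊗[k] Lie G) (f h : Stk G (unitPt G)) :
    contract u (f + h) = contract u f + contract u h := by
  induction u with
  | zero => simp [contract_zero_left]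
  | tmul r ξ => simp [contract_tmul, mul_add]
  | add u v hu hv => simp only [contract_add_left, hu, hv]; ring

theorem contract_mul (u : R ⊗[k] Lie G) (f h : Stk G (unitPt G)) :
    contract u (f * h) = algebraMap k R (evUnit G f) * contract u h
      + algebraMap k R (evUnit G h) * contract u f := by
  induction u with
  | zero => simp [contract_zero_left]
  | tmul r ξ => simp only [contract_tmul, ξ.2 f h, map_add, map_mul]; ring
  | add u v hu hv => simp only [contract_add_left, hu, hv]; ring

theorem lie_algebraMap (ξ : Lie G) (r : k) : ξ.1 (algebraMap k _ r) = 0 := by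
  have h1 : ξ.1 1 = 0 := by
    have := ξ.2 1 1
    simp only [mul_one, map_one, one_mul] at this
    exact left_eq_add.mp this
  rw [Algebra.algebraMap_eq_smul_one, map_smul, h1, smul_zero]

theorem contract_algebraMap (u : R ⊗[k] Lie G) (r : k) :
    contract u (algebraMap k _ r) = 0 := by
  induction u with
  | zero => simp [contract_zero_left]
  | tmul s ξ => simp [contract_tmul, lie_algebraMap]
  | add u v hu hv => simp [contract_add_left, hu, hv]

/-- The homomorphism `f ↦ f(e) + ε u(f)`. -/
def expHom (u : R ⊗[k] Lie G) : Stk G (unitPt G) →ₐ[k] DualNumber R where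
  toFun f := TrivSqZeroExt.inl (algebraMap k R (evUnit G f)) + TrivSqZeroExt.inr (contract u f)
  map_one' := by
    have : contract u (1 : Stk G (unitPt G)) = 0 := by simpa using contract_algebraMap u 1
    ext <;> simp [this]
  map_mul' f h := by
    ext
    · simp
    · simp [contract_mul, mul_comm]
  map_zero' := by
    have : contract u (0 : Stk G (unitPt G)) = 0 := by simpa using contract_algebraMap u 0
    ext <;> simp [this]
  map_add' f h := by
    ext
    · simp
    · simp [contract_add]
  commutes' r := by
    ext
    · simp [ev_algebraMap, TrivSqZeroExt.algebraMap_eq_inl']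
    · simp [contract_algebraMap, TrivSqZeroExt.algebraMap_eq_inl']

/-- The `R[ε]`-point `exp(ε u)` of `G`, for `u ∈ R ⊗ Lie G`. -/
def expPt (u : R ⊗[k] Lie G) : specO k (DualNumber R) ⟶ G :=
  specMap (expHom u) ≫ pt G (unitPt G)

end Exp

section Differential
variable {G} {H : Sch k} [GrpObj H] (i : G ⟶ H) [IsMonHom i]

theorem one_comp_hom : (1 : specO k k ⟶ G) ≫ i = 1 := map_one (IsMonHom.monoidHom i (specO k k))

theorem map_unitPt : i.left (unitPt G) = unitPt H := by
  have := one_comp_hom i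
  simp only [unitPt, ← this]
  rfl

/-- The homomorphism of local rings at the units, for a homomorphism of group schemes. -/
def stkHom : Stk H (unitPt H) →+* Stk G (unitPt G) :=
  (H.left.presheaf.stalkSpecializes (specializes_of_eq (map_unitPt i)) ≫ i.left.stalkMap (unitPt G)).hom

theorem map_stkHom : Spec.map (CommRingCat.ofHom (stkHom i)) ≫ H.left.fromSpecStalk (unitPt H) =
    G.left.fromSpecStalk (unitPt G) ≫ i.left := by
  simp only [stkHom, CommRingCat.ofHom_hom, Spec.map_comp, Category.assoc,
    Scheme.SpecMap_stalkSpecializes_fromSpecStalk, Scheme.SpecMap_stalkMap_fromSpecStalk]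

theorem stkHom_algebraMap (r : k) : stkHom i (algebraMap k _ r) = algebraMap k _ r := by
  have h : CommRingCat.ofHom (algebraMap k (Stk H (unitPt H))) ≫ CommRingCat.ofHom (stkHom i)
      = CommRingCat.ofHom (algebraMap k (Stk G (unitPt G))) := by
    apply Spec.map_injective
    rw [Spec.map_comp, map_algebraMap_stk, map_algebraMap_stk, ← Category.assoc, map_stkHom,
      Category.assoc, Over.w]
  exact congr($(h).hom r)

theorem ev_stkHom (f : Stk H (unitPt H)) : evUnit G (stkHom i f) = evUnit H f := by
  have h : CommRingCat.ofHom (stkHom i) ≫ CommRingCat.ofHom (evUnit G) = CommRingCat.ofHom (evUnit H) := by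
    apply Spec.map_injective
    rw [← cancel_mono (H.left.fromSpecStalk (unitPt H)), Spec.map_comp, Category.assoc, map_stkHom,
      ← Category.assoc, map_ev, map_ev, ← one_comp_hom i]
    rfl
  exact congr($(h).hom f)

/-- The homomorphism of Lie algebras induced by a homomorphism of group schemes. -/
def dLie : Lie G →ₗ[k] Lie H where
  toFun ξ := ⟨{ toFun := fun f => ξ.1 (stkHom i f)
                map_add' := by intro f h; simp
                map_smul' := by
                  intro r f
                  simp only [Algebra.smul_def, map_mul, stkHom_algebraMap, RingHom.id_apply]
                  rw [← Algebra.smul_def, map_smul, smul_eq_mul]; rfl },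
    fun f h => by
      change ξ.1 (stkHom i (f * h)) = _
      rw [map_mul, ξ.2, ev_stkHom, ev_stkHom]; rfl⟩
  map_add' _ _ := rfl
  map_smul' _ _ := rfl

end Differential

section VectorFields

/-- Reduction `ε ↦ 0`. -/
def fstHom (R : Type u) [CommRing R] [Algebra k R] : DualNumber R →ₐ[k] R :=
  TrivSqZeroExt.fstHom k R R

/-- The inclusion of `R` into `R[ε]`. -/
def inlHom (R : Type u) [CommRing R] [Algebra k R] : R →ₐ[k] DualNumber R :=
  TrivSqZeroExt.inlAlgHom k R R

/-- The homomorphism `f ↦ f + ε v(f)` of a derivation `v`. -/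
def expDer {A : Type u} [CommRing A] [Algebra k A] (v : Derivation k A A) :
    A →ₐ[k] DualNumber A where
  toFun f := TrivSqZeroExt.inl f + TrivSqZeroExt.inr (v f)
  map_one' := by ext <;> simp
  map_mul' f h := by
    ext
    · simp
    · simp [mul_comm]
  map_zero' := by ext <;> simp
  map_add' f h := by ext <;> simp
  commutes' r := by ext <;> simp [TrivSqZeroExt.algebraMap_eq_inl']

theorem specMap_id (R : Type u) [CommRing R] [Algebra k R] :
    specMap (AlgHom.id k R) = 𝟙 (specO k R) := by
  apply Over.OverMorphism.ext
  exact Spec.map_id _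

theorem specMap_pt_injective (X : Sch k) (x : X.left) {B : Type u} [CommRing B] [Algebra k B]
    {φ ψ : Stk X x →ₐ[k] B} (h : specMap φ ≫ pt X x = specMap ψ ≫ pt X x) : φ = ψ := by
  have h' : Spec.map (CommRingCat.ofHom φ.toRingHom) ≫ X.left.fromSpecStalk x
      = Spec.map (CommRingCat.ofHom ψ.toRingHom) ≫ X.left.fromSpecStalk x :=
    congrArg CommaMorphism.left h
  rw [cancel_mono] at h'
  have h2 := Spec.map_injective h'
  ext f
  exact congr($(h2).hom f)

theorem exists_lift (X : Sch k) (x : X.left) {B : Type u} [CommRing B] [Algebra k B]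
    (π : B →ₐ[k] Stk X x) (hloc : IsLocalHom π.toRingHom) (y : specO k B ⟶ X)
    (hy : specMap π ≫ y = pt X x) :
    ∃ φ : Stk X x →ₐ[k] B, specMap φ ≫ pt X x = y ∧ π.comp φ = AlgHom.id k _ := by
  have : IsLocalRing B := RingHom.domain_isLocalRing π.toRingHom
  have hy' : Spec.map (CommRingCat.ofHom π.toRingHom) ≫ y.left
      = X.left.fromSpecStalk x := congrArg CommaMorphism.left hy
  have hx : y.left (IsLocalRing.closedPoint B) = x := by
    have h1 : Spec.map (CommRingCat.ofHom π.toRingHom)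
        (IsLocalRing.closedPoint (Stk X x)) = IsLocalRing.closedPoint B :=
      IsLocalRing.comap_closedPoint _
    have h2 : (X.left.fromSpecStalk x) (IsLocalRing.closedPoint (Stk X x)) = x :=
      Scheme.fromSpecStalk_closedPoint
    rw [← hy'] at h2
    rw [← h1]
    exact h2
  let φ : X.left.presheaf.stalk x ⟶ CommRingCat.of B :=
    X.left.presheaf.stalkSpecializes (specializes_of_eq hx) ≫
      Scheme.stalkClosedPointTo (R := CommRingCat.of B) y.left
  have hφ : Spec.map φ ≫ X.left.fromSpecStalk x = y.left := by
    simp only [φ, Spec.map_comp, Category.assoc, Scheme.SpecMap_stalkSpecializes_fromSpecStalk]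
    exact Scheme.Spec_stalkClosedPointTo_fromSpecStalk (R := CommRingCat.of B) y.left
  have halg : CommRingCat.ofHom (algebraMap k (Stk X x)) ≫ φ =
      CommRingCat.ofHom (algebraMap k B) := by
    apply Spec.map_injective
    rw [Spec.map_comp, map_algebraMap_stk, ← Category.assoc, hφ]
    exact Over.w y
  let ψ : Stk X x →ₐ[k] B := { φ.hom with commutes' := fun r => congr($(halg).hom r) }
  have hψ : specMap ψ ≫ pt X x = y := Over.OverMorphism.ext hφ
  refine ⟨ψ, hψ, specMap_pt_injective X x ?_⟩
  rw [← specMap_comp, Category.assoc, hψ, hy, specMap_id, Category.id_comp]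

theorem isLocalHom_fst (A M : Type u) [CommRing A] [AddCommGroup M] [Module A M]
    [Module Aᵐᵒᵖ M] [IsCentralScalar A M] [Algebra k A] [Module k M] [IsScalarTower k A M]
    [IsScalarTower k Aᵐᵒᵖ M] :
    IsLocalHom (TrivSqZeroExt.fstHom k A M).toRingHom :=
  ⟨fun _ ha => TrivSqZeroExt.isUnit_iff_isUnit_fst.mpr ha⟩

theorem exists_der (X : Sch k) (x : X.left) (y : specO k (DualNumber (Stk X x)) ⟶ X)
    (hy : specMap (fstHom (Stk X x)) ≫ y = pt X x) :
    ∃! v : Derivation k (Stk X x) (Stk X x), specMap (expDer v) ≫ pt X x = y := by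
  obtain ⟨φ, hφ, hfst⟩ := exists_lift X x (fstHom (Stk X x)) (isLocalHom_fst _ _) y hy
  have hfst' : ∀ f, (φ f).fst = f := fun f => congr($(hfst) f)
  let L : Stk X x →ₗ[k] Stk X x :=
    { toFun := fun f => (φ f).snd
      map_add' := fun f h => by rw [map_add]; rfl
      map_smul' := fun r f => by rw [map_smul]; rfl }
  let v : Derivation k (Stk X x) (Stk X x) := Derivation.mk' L (fun f h => by
    change (φ (f * h)).snd = _
    rw [map_mul, TrivSqZeroExt.snd_mul, hfst', hfst']
    simp [L, mul_comm])
  have hv : expDer v = φ := by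
    ext f
    · exact (show f + 0 = _ by rw [hfst', add_zero])
    · exact zero_add _
  refine ⟨v, (by rw [hv, hφ] : specMap (expDer v) ≫ pt X x = y), ?_⟩
  intro w hw
  have hw' := specMap_pt_injective X x (hw.trans hφ.symm)
  ext f
  have h4 : (expDer w f).snd = w f := zero_add _
  rw [← h4, hw']
  rfl

theorem fst_exp {R : Type u} [CommRing R] [Algebra k R] (u : R ⊗[k] Lie G) :
    specMap (fstHom R) ≫ expPt u = 1 := by
  have h0 : specMap (⟨evUnit G, ev_algebraMap G⟩ : Stk G (unitPt G) →ₐ[k] k) ≫ pt G (unitPt G) = 1 :=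
    Over.OverMorphism.ext (map_ev G)
  have h : (fstHom R).comp (expHom u) =
      (Algebra.ofId k R).comp (⟨evUnit G, ev_algebraMap G⟩ : Stk G (unitPt G) →ₐ[k] k) := by
    ext f
    exact add_zero _
  rw [expPt, ← Category.assoc, specMap_comp, h, ← specMap_comp, Category.assoc, h0,
    MonObj.comp_one]

section Velocity
variable {G} {X : Sch k} {x : X.left} (m : specO k (Stk X x) ⊗ G ⟶ X)

theorem fst_orbitPt (hm : lift (𝟙 _) 1 ≫ m = pt X x) (ξ : Lie G) :
    specMap (fstHom (Stk X x)) ≫ orbitPt m (inlHom (Stk X x)) (expPt (1 ⊗ₜ[k] ξ)) = pt X x := by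
  rw [comp_orbitPt, fst_exp, orbitPt]
  have : (fstHom (Stk X x)).comp (inlHom (k := k) (Stk X x)) = AlgHom.id k _ := by
    ext f; rfl
  rw [this, specMap_id, hm]

/-- The derivation `v` of `𝒪_{X,x}` with `f + ε v(f) = f(m(x, exp(ε ξ)))`; see `velocityFun_spec`. -/
def velocityFun (hm : lift (𝟙 _) 1 ≫ m = pt X x) (ξ : Lie G) : Derivation k (Stk X x) (Stk X x) :=
  (exists_der X x _ (fst_orbitPt m hm ξ)).choose

theorem velocityFun_spec (hm : lift (𝟙 _) 1 ≫ m = pt X x) (ξ : Lie G) : specMap (expDer (velocityFun m hm ξ)) ≫ pt X x =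
    orbitPt m (inlHom (Stk X x)) (expPt (1 ⊗ₜ[k] ξ)) :=
  (exists_der X x _ (fst_orbitPt m hm ξ)).choose_spec.1

/-- `A[ε₁, ε₂] / (ε₁, ε₂)²`. -/
abbrev Dual2 (A : Type u) [CommRing A] := TrivSqZeroExt A (A × A)

/-- The homomorphism `f ↦ f(e) + ε₁ ξ(f) + ε₂ χ(f)`. -/
def expHom2 (A : Type u) [CommRing A] [Algebra k A] (ξ χ : Lie G) :
    Stk G (unitPt G) →ₐ[k] Dual2 A where
  toFun f := TrivSqZeroExt.inl (algebraMap k A (evUnit G f))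
    + TrivSqZeroExt.inr (algebraMap k A (ξ.1 f), algebraMap k A (χ.1 f))
  map_one' := by
    have h1 := lie_algebraMap ξ 1
    have h2 := lie_algebraMap χ 1
    rw [map_one] at h1 h2
    ext <;> simp [h1, h2]
  map_mul' f h := by
    ext
    · simp
    · simp [ξ.2 f h, Algebra.smul_def]; ring
    · simp [χ.2 f h, Algebra.smul_def]; ring
  map_zero' := by ext <;> simp
  map_add' f h := by ext <;> simp
  commutes' r := by
    ext <;> simp [ev_algebraMap, TrivSqZeroExt.algebraMap_eq_inl', lie_algebraMap]

/-- The homomorphism `ε₁ ↦ a ε`, `ε₂ ↦ b ε`. -/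
def combine (A : Type u) [CommRing A] [Algebra k A] (a b : k) : Dual2 A →ₐ[k] DualNumber A :=
  (TrivSqZeroExt.map (algebraMap k A a • LinearMap.fst A A A
    + algebraMap k A b • LinearMap.snd A A A)).restrictScalars k

theorem combine_exp (A : Type u) [CommRing A] [Algebra k A] (ξ χ : Lie G) (a b : k) :
    specMap (combine A a b) ≫ (specMap (expHom2 A ξ χ) ≫ pt G (unitPt G)) =
      expPt (1 ⊗ₜ[k] (a • ξ + b • χ)) := by
  rw [expPt, ← Category.assoc, specMap_comp]
  congr 2
  ext f
  · simp [combine, expHom2, expHom]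
  · simp [combine, expHom2, expHom, contract_tmul, Algebra.smul_def]

theorem velocityFun_combine (hm : lift (𝟙 _) 1 ≫ m = pt X x) (ξ χ : Lie G) (a b : k) :
    velocityFun m hm (a • ξ + b • χ) = a • velocityFun m hm ξ + b • velocityFun m hm χ := by
  let A := Stk X x
  let g : specO k (Dual2 A) ⟶ G := specMap (expHom2 A ξ χ) ≫ pt G (unitPt G)
  let p : A →ₐ[k] Dual2 A := TrivSqZeroExt.inlAlgHom k A (A × A)
  let π : Dual2 A →ₐ[k] A := TrivSqZeroExt.fstHom k A (A × A)
  have hp : ∀ c d : k, (combine A c d).comp p = inlHom A := by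
    intro c d
    ext f <;> simp [combine, p, inlHom]
  have hg : ∀ c d : k, specMap (combine A c d) ≫ orbitPt m p g =
      orbitPt m (inlHom A) (expPt (1 ⊗ₜ[k] (c • ξ + d • χ))) := by
    intro c d
    rw [comp_orbitPt, hp, combine_exp]
  have hπ : specMap π ≫ orbitPt m p g = pt X x := by
    have h1 : π = (fstHom A).comp (combine A 0 0) := by
      ext f <;> simp [π, fstHom, combine]
    rw [h1, ← specMap_comp, Category.assoc, hg, fst_orbitPt m hm]
  obtain ⟨φ, hφ, -⟩ := exists_lift X x π (isLocalHom_fst _ _) _ hπ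
  have key : ∀ c d : k, (combine A c d).comp φ = expDer (velocityFun m hm (c • ξ + d • χ)) := by
    intro c d
    apply specMap_pt_injective X x
    rw [velocityFun_spec, ← hg, ← hφ, ← Category.assoc, specMap_comp]
  have key' : ∀ (c d : k) (f : A),
      c • (φ f).snd.1 + d • (φ f).snd.2 = velocityFun m hm (c • ξ + d • χ) f := by
    intro c d f
    have := congr(($(key c d) f).snd)
    simpa [combine, expDer] using this
  ext f
  have h1 := key' 1 0 f
  have h2 := key' 0 1 f
  simp only [one_smul, zero_smul, add_zero, zero_add] at h1 h2
  rw [← key' a b f, h1, h2]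
  rfl

/-- For a family `g ↦ m(x, g)` of points of `X` parametrized by `g ∈ G`, with `m(x, e) = x`: the linear
map that takes `ξ` to the velocity vector field `f ↦ d/dt f(m(x, exp(t ξ)))` at `t = 0` (on germs at `x`). -/
def velocity (hm : lift (𝟙 _) 1 ≫ m = pt X x) : Lie G →ₗ[k] Derivation k (Stk X x) (Stk X x) where
  toFun := velocityFun m hm
  map_add' ξ χ := by simpa using velocityFun_combine m hm ξ χ 1 1
  map_smul' c ξ := by simpa using velocityFun_combine m hm ξ 0 c 0

end Velocity

section Fields
variable {G}

/-- The infinitesimal action of the Lie algebra on germs of functions at `x`: the vector field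
`(a(ξ) f)(x) = d/dt f(exp(t ξ) x)` at `t = 0`. -/
def infAct {X : Sch k} [ModObj G X] (x : X.left) :
    Lie G →ₗ[k] Derivation k (Stk X x) (Stk X x) :=
  velocity ((snd _ _ : specO k (Stk X x) ⊗ G ⟶ G) • (fst _ _ ≫ pt X x)) (by
    rw [ModObj.comp_smul, lift_snd, ← Category.assoc, lift_fst, Category.id_comp, one_smul])

/-- The right-invariant vector field `(ξᴿ f)(g) = d/dt f(exp(t ξ) g)` at `t = 0`. -/
def rightInv (g : G.left) : Lie G →ₗ[k] Derivation k (Stk G g) (Stk G g) :=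
  velocity ((snd _ _ : specO k (Stk G g) ⊗ G ⟶ G) * (fst _ _ ≫ pt G g)) (by
    rw [MonObj.comp_mul, lift_snd, ← Category.assoc, lift_fst, Category.id_comp, one_mul])

/-- The left-invariant vector field `(ξᴸ f)(g) = d/dt f(g exp(t ξ))` at `t = 0`. -/
def leftInv (g : G.left) : Lie G →ₗ[k] Derivation k (Stk G g) (Stk G g) :=
  velocity ((fst _ _ ≫ pt G g : specO k (Stk G g) ⊗ G ⟶ G) * snd _ _) (by
    rw [MonObj.comp_mul, lift_snd, ← Category.assoc, lift_fst, Category.id_comp, mul_one])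

end Fields

end VectorFields

end Points

section Brackets
variable {k : Type u} [Field k]

/-- A vector field, given by its action on germs of functions. -/
abbrev GermField (X : Sch k) := ∀ x : X.left, Derivation k (Stk X x) (Stk X x)

/-- Biderivations `(f, h) ↦ {f, h} = β f h` of an algebra `A`. The map `β.liftKaehlerDifferential`
from `Ω[A⁄k]` to derivations is the map `β♯`, `d f ↦ {f, -}`. -/
abbrev BiDer (k A : Type u) [Field k] [CommRing A] [Algebra k A] :=
  Derivation k A (Derivation k A A)

/-- A field of biderivations, given by its action on germs of functions. -/
abbrev GermBracket (X : Sch k) := ∀ x : X.left, BiDer k (Stk X x)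

/-- The biderivation `(f, h) ↦ v(f) w(h)`. -/
def tensorDer {A : Type u} [CommRing A] [Algebra k A] (v w : Derivation k A A) : BiDer k A :=
  (LinearMap.toSpanSingleton A (Derivation k A A) w).compDer v

theorem tensorDer_apply {A : Type u} [CommRing A] [Algebra k A] (v w : Derivation k A A)
    (f h : A) : tensorDer v w f h = v f * w h := rfl

/-- The biderivation `(a ⊗ b)(t)`, that is, `(f, h) ↦ ∑ a(ξ)(f) b(χ)(h)` for `t = ∑ ξ ⊗ χ`. -/
def biTensor {V W A : Type u} [AddCommMonoid V] [Module k V] [AddCommMonoid W] [Module k W]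
    [CommRing A] [Algebra k A] (a : V →ₗ[k] Derivation k A A) (b : W →ₗ[k] Derivation k A A) :
    V ⊗[k] W →ₗ[k] BiDer k A :=
  TensorProduct.lift (LinearMap.mk₂ k (fun v w => tensorDer (a v) (b w))
    (fun v v' w => by ext f h; simp [tensorDer_apply, add_mul])
    (fun c v w => by ext f h; simp [tensorDer_apply])
    (fun v w w' => by ext f h; simp [tensorDer_apply, mul_add])
    (fun c v w => by ext f h; simp [tensorDer_apply]))

/-- Vector fields `v` on `Y` and `w` on `X` are related by `φ : Y ⟶ X`: `v(φ^* f) = φ^* w(f)`. -/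
def FieldRelated {Y X : Sch k} (φ : Y ⟶ X) (v : GermField Y) (w : GermField X) : Prop :=
  ∀ (y : Y.left) (f : Stk X (φ.left y)), v y (stkMap φ y f) = stkMap φ y (w (φ.left y) f)

/-- Brackets on `Y` and `X` are related by `φ : Y ⟶ X`: `{φ^* f, φ^* h} = φ^* {f, h}`. -/
def BracketRelated {Y X : Sch k} (φ : Y ⟶ X) (β : GermBracket Y) (γ : GermBracket X) : Prop :=
  ∀ (y : Y.left) (f h : Stk X (φ.left y)),
    β y (stkMap φ y f) (stkMap φ y h) = stkMap φ y (γ (φ.left y) f h)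

/-- `β` is the product bracket of `γ` and `γ'` on `Y × X`. -/
def IsProductBracket {Y X : Sch k} (β : GermBracket (Y ⊗ X)) (γ : GermBracket Y)
    (γ' : GermBracket X) : Prop :=
  BracketRelated (fst Y X) β γ ∧ BracketRelated (snd Y X) β γ' ∧
    ∀ (z : (Y ⊗ X).left) (f : Stk Y ((fst Y X).left z)) (h : Stk X ((snd Y X).left z)),
      β z (stkMap (fst Y X) z f) (stkMap (snd Y X) z h) = 0 ∧
        β z (stkMap (snd Y X) z h) (stkMap (fst Y X) z f) = 0

/-- A Poisson bracket on the sheaf of functions of `X`: an alternating biderivation of the local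
rings with the Jacobi identity that takes sections over open sets to sections. -/
structure PoissonStructure (X : Sch k) where
  bracket : GermBracket X
  alternating : ∀ (x : X.left) (f : Stk X x), bracket x f f = 0
  jacobi : ∀ (x : X.left) (f g h : Stk X x),
    bracket x f (bracket x g h) + bracket x g (bracket x h f) + bracket x h (bracket x f g) = 0
  regular : ∀ (U : X.left.Opens) (f h : Γ(X.left, U)) (x : X.left), x ∈ U →
    ∃ (V : X.left.Opens) (_ : x ∈ V) (hVU : V ≤ U) (g : Γ(X.left, V)),
      ∀ (y : X.left) (hy : y ∈ V),
        bracket y (X.left.presheaf.germ U y (hVU hy) f) (X.left.presheaf.germ U y (hVU hy) h) =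
          X.left.presheaf.germ V y hy g

/-- The pullback of differential forms along a homomorphism of algebras. -/
def pullForm {A B : Type u} [CommRing A] [Algebra k A] [CommRing B] [Algebra k B]
    (φ : B →ₐ[k] A) : Ω[B⁄k] →+ Ω[A⁄k] :=
  letI := φ.toRingHom.toAlgebra
  haveI : IsScalarTower k B A := IsScalarTower.of_algebraMap_eq' φ.comp_algebraMap.symm
  (KaehlerDifferential.map k k B A).toAddMonoidHom

theorem pullForm_apply {A B : Type u} [CommRing A] [Algebra k A] [CommRing B] [Algebra k B]
    (φ : B →ₐ[k] A) (f h : B) :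
    pullForm φ (f • KaehlerDifferential.D k B h) = φ f • KaehlerDifferential.D k A (φ h) := by
  let _ : Algebra B A := φ.toRingHom.toAlgebra
  have _ : IsScalarTower k B A := IsScalarTower.of_algebraMap_eq' φ.comp_algebraMap.symm
  have h1 : KaehlerDifferential.map k k B A (f • KaehlerDifferential.D k B h) =
      φ f • KaehlerDifferential.D k A (φ h) := by
    rw [map_smul, KaehlerDifferential.map_D]
    rfl
  exact h1

end Brackets

section Triples
variable {k : Type u} [Field k]

/-- Algebraic groups over `k`: smooth group schemes of finite type. -/
class IsAlgebraicGroup (G : Sch k) [GrpObj G] : Prop where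
  smooth : Smooth G.hom
  quasiCompact : QuasiCompact G.hom

/-- Invariance of a bilinear form on the Lie algebra of `D` under the adjoint action: for all
`R`-points `d` of `D` and `u, v ∈ R ⊗ Lie D`, with `Ad_d u = u'` and `Ad_d v = v'` defined by
`d exp(ε u) d⁻¹ = exp(ε u')` and likewise for `v`, one has `B(u', v') = B(u, v)`. -/
def AdInvariant {D : Sch k} [GrpObj D] (B : LinearMap.BilinForm k (Lie D)) : Prop :=
  ∀ (R : Type u) [CommRing R] [Algebra k R] (d : specO k R ⟶ D) (u u' v v' : R ⊗[k] Lie D),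
    (specMap (inlHom R) ≫ d) * expPt u * (specMap (inlHom R) ≫ d)⁻¹ = expPt u' →
    (specMap (inlHom R) ≫ d) * expPt v * (specMap (inlHom R) ≫ d)⁻¹ = expPt v' →
    B.baseChange R u' v' = B.baseChange R u v

variable (k) in
/-- A group triple `(D, G, G^*)`: algebraic groups with closed subgroups `G, G^* ⊆ D` and a
nondegenerate invariant symmetric pairing on the Lie algebra of `D`, such that the Lie algebras of
`G` and `G^*` are complementary Lagrangian subspaces. -/
structure GroupTriple where
  D : Sch k
  G : Sch k
  Gs : Sch k
  [grpD : GrpObj D]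
  [grpG : GrpObj G]
  [grpGs : GrpObj Gs]
  [algD : IsAlgebraicGroup D]
  [algG : IsAlgebraicGroup G]
  [algGs : IsAlgebraicGroup Gs]
  i : G ⟶ D
  j : Gs ⟶ D
  [homI : IsMonHom i]
  [homJ : IsMonHom j]
  [closedI : IsClosedImmersion i.left]
  [closedJ : IsClosedImmersion j.left]
  form : LinearMap.BilinForm k (Lie D)
  symm : form.IsSymm
  nondegenerate : form.Nondegenerate
  invariant : AdInvariant form
  lagrangian_G : form.orthogonal (LinearMap.range (dLie i)) = LinearMap.range (dLie i)
  lagrangian_Gs : form.orthogonal (LinearMap.range (dLie j)) = LinearMap.range (dLie j)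
  isCompl : IsCompl (LinearMap.range (dLie i)) (LinearMap.range (dLie j))

attribute [instance] GroupTriple.grpD GroupTriple.grpG GroupTriple.grpGs GroupTriple.algD
  GroupTriple.algG GroupTriple.algGs GroupTriple.homI GroupTriple.homJ GroupTriple.closedI
  GroupTriple.closedJ

namespace GroupTriple
variable (T : GroupTriple k)

/-- The Lie algebra `𝔤` as a subspace of `𝔡`. -/
def lieG : Submodule k (Lie T.D) := LinearMap.range (dLie T.i)

/-- The Lie algebra `𝔤^*` of `G^*` as a subspace of `𝔡`. -/
def lieGs : Submodule k (Lie T.D) := LinearMap.range (dLie T.j)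

/-- Lagrangian complements `𝔥` of `𝔤` in `𝔡`, not necessarily subalgebras. -/
structure IsLagrangianComplement (𝔥 : Submodule k (Lie T.D)) : Prop where
  lagrangian : T.form.orthogonal 𝔥 = 𝔥
  isCompl : IsCompl T.lieG 𝔥

/-- `r ∈ 𝔡 ⊗ 𝔡` is the canonical element of `𝔤^* ⊗ 𝔤`, that is, `r = ∑ x^i ⊗ x_i` for dual bases
`x_i` of `𝔤` and `x^i` of `𝔤^*`: the contraction of its second factor with `η` is `0` for `η` in
`𝔤` and is `η` for `η` in `𝔤^*`. -/
def IsCanonicalElement (r : Lie T.D ⊗[k] Lie T.D) : Prop :=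
  (∀ η ∈ T.lieG, TensorProduct.rid k _ (LinearMap.lTensor _ (T.form η) r) = 0) ∧
    ∀ η ∈ T.lieGs, TensorProduct.rid k _ (LinearMap.lTensor _ (T.form η) r) = η

/-- `β` is the Poisson–Lie structure of `G`: the bracket such that `G ⊆ D` is a Poisson map for the
bivector `rᴿ - rᴸ` on `D`, where `r` is the canonical element of `𝔤^* ⊗ 𝔤`. -/
def IsPoissonLie (β : GermBracket T.G) : Prop :=
  ∃ r, T.IsCanonicalElement r ∧ BracketRelated T.i β
    (fun d => biTensor (rightInv d) (rightInv d) r - biTensor (leftInv d) (leftInv d) r)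

/-- The `𝔤`-component of the contraction of the second factor of `t ∈ 𝔤 ⊗ 𝔤` with `η ∈ 𝔡`. -/
def contractTwist (t : Lie T.G ⊗[k] Lie T.G) (η : Lie T.D) : Lie T.G :=
  TensorProduct.rid k _ (LinearMap.lTensor _ ((T.form η).comp (dLie T.i)) t)

/-- The complement `𝔥` differs from `𝔤^*` by the twist `t = ½ ∑ t^{ij} x_i ∧ x_j`: it consists of
the elements `η - t(η)` for `η ∈ 𝔤^*`, that is, it has the basis `x^j - ∑ t^{ij} x_i`. -/
def IsTwist (𝔥 : Submodule k (Lie T.D)) (t : Lie T.G ⊗[k] Lie T.G) : Prop :=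
  ∀ η ∈ T.lieGs, η - dLie T.i (T.contractTwist t η) ∈ 𝔥

/-- The homogeneous space `D/G`: a smooth `D`-scheme with a `D`-equivariant smooth surjection
`q : D ⟶ D/G` such that two points of `D` have the same image exactly if they differ by right
multiplication by a point of `G`. -/
structure Quotient where
  Q : Sch k
  [act : ModObj T.D Q]
  [smooth : Smooth Q.hom]
  q : T.D ⟶ Q
  [smooth_q : Smooth q.left]
  [surjective_q : Surjective q.left]
  map_mul : ∀ (Z : Sch k) (d d' : Z ⟶ T.D), (d * d') ≫ q = d • (d' ≫ q)
  eq_iff : ∀ (Z : Sch k) (d d' : Z ⟶ T.D),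
    d ≫ q = d' ≫ q ↔ ∃ g : Z ⟶ T.G, d' = d * (g ≫ T.i)

attribute [instance] Quotient.act Quotient.smooth Quotient.smooth_q Quotient.surjective_q

/-- Poisson `G`-varieties: separated `k`-schemes of finite type with an action of `G` and a Poisson
structure such that the action map `G × X ⟶ X` is a Poisson map. -/
structure PoissonVariety where
  X : Sch k
  [act : ModObj T.G X]
  [separated : IsSeparated X.hom]
  [locallyOfFiniteType : LocallyOfFiniteType X.hom]
  [quasiCompact : QuasiCompact X.hom]
  poisson : PoissonStructure X
  action_poisson : ∃ (β : GermBracket T.G) (β' : GermBracket (T.G ⊗ X)),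
    T.IsPoissonLie β ∧ IsProductBracket β' β poisson.bracket ∧
      BracketRelated (fst T.G X • snd T.G X) β' poisson.bracket

attribute [instance] PoissonVariety.act PoissonVariety.separated
  PoissonVariety.locallyOfFiniteType PoissonVariety.quasiCompact

variable {T}
variable (H : T.Quotient) (P : T.PoissonVariety)

/-- The bivector `π^𝔥 = π - a(t)` of a Poisson `G`-variety, where the complement `𝔥` differs from
`𝔤^*` by the twist `t`. -/
def PoissonVariety.twistedBracket (t : Lie T.G ⊗[k] Lie T.G) : GermBracket P.X :=
  fun x => P.poisson.bracket x - biTensor (infAct x) (infAct x) t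

/-- `G`-equivariant morphisms `X ⟶ D/G`. -/
def IsEquivariant (μ : P.X ⟶ H.Q) : Prop :=
  ∀ (Z : Sch k) (g : Z ⟶ T.G) (x : Z ⟶ P.X), (g • x) ≫ μ = (g ≫ T.i) • (x ≫ μ)

/-- The infinitesimal action of `𝔥` at `s ∈ D/G` with values in the fibre
`Der_k(𝒪_{D/G,s}, κ(s))` at `s` of the tangent bundle. -/
def Quotient.tangentAction (𝔥 : Submodule k (Lie T.D)) (s : H.Q.left) :
    𝔥 →ₗ[k] Derivation k (Stk H.Q s) (IsLocalRing.ResidueField (Stk H.Q s)) :=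
  ((Algebra.linearMap (Stk H.Q s) (IsLocalRing.ResidueField (Stk H.Q s))).compDer.restrictScalars
    k).comp ((infAct s).comp 𝔥.subtype)

/-- The complement `𝔥` is admissible at `s ∈ D/G`: the infinitesimal action induces an isomorphism
from `𝔥` (with scalars extended to the residue field) to the tangent space at `s`. -/
def Quotient.IsAdmissible (𝔥 : Submodule k (Lie T.D)) (s : H.Q.left) : Prop :=
  Function.Bijective (LinearMap.liftBaseChange (IsLocalRing.ResidueField (Stk H.Q s))
    (H.tangentAction 𝔥 s))

/-- `ω` is the germ at `s` of the one-form `⟨θ^𝔥, ξ⟩` on `D/G`, where `θ^𝔥` is inverse to the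
infinitesimal action of `𝔥`: it takes the value `⟨η, ξ⟩` on the vector field of each `η ∈ 𝔥`. -/
def Quotient.IsComplementForm (𝔥 : Submodule k (Lie T.D)) (s : H.Q.left) (ξ : Lie T.G)
    (ω : Ω[(Stk H.Q s)⁄k]) : Prop :=
  ∀ η ∈ 𝔥, (infAct s η).liftKaehlerDifferential ω = algebraMap k _ (T.form η (dLie T.i ξ))

/-- The moment map condition of Alekseev and Kosmann-Schwarzbach for `μ : X ⟶ D/G`: for every
Lagrangian complement `𝔥` of `𝔤` and every open `U ⊆ D/G` on which `𝔥` is admissible,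
`a(ξ) = (π^𝔥)♯(μ^* ⟨θ^𝔥, ξ⟩)` over `U` for all `ξ ∈ 𝔤`. -/
def IsAKSMomentMap (μ : P.X ⟶ H.Q) : Prop :=
  ∀ (𝔥 : Submodule k (Lie T.D)), T.IsLagrangianComplement 𝔥 →
    ∀ t : Lie T.G ⊗[k] Lie T.G, T.IsTwist 𝔥 t →
    ∀ U : H.Q.left.Opens, (∀ s ∈ U, H.IsAdmissible 𝔥 s) →
    ∀ x : P.X.left, μ.left x ∈ U → ∀ ξ : Lie T.G, ∀ ω : Ω[(Stk H.Q (μ.left x))⁄k],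
      H.IsComplementForm 𝔥 (μ.left x) ξ ω →
      infAct x ξ = (P.twistedBracket t x).liftKaehlerDifferential (pullForm (stkMap μ x) ω)

/-- The composite `f : G^* ⟶ D ⟶ D/G`. -/
def Quotient.f : T.Gs ⟶ H.Q := T.j ≫ H.q

/-- `δ` is the infinitesimal (dressing) action of `𝔤` on `G^*`, the one for which
`f : G^* ⟶ D/G` is `𝔤`-equivariant. -/
def Quotient.IsDressingAction (δ : Lie T.G → GermField T.Gs) : Prop :=
  ∀ ξ, FieldRelated H.f (δ ξ) (fun s => infAct s (dLie T.i ξ))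

/-- `ω` is the germ at `u` of the one-form `⟨θ, ξ⟩` on `G^*`, where `θ = du u⁻¹` is the
`𝔤^*`-valued Maurer–Cartan form with `θ(ηᴿ) = η` for all right-invariant vector fields `ηᴿ`. -/
def IsMaurerCartanForm (u : T.Gs.left) (ξ : Lie T.G) (ω : Ω[(Stk T.Gs u)⁄k]) : Prop :=
  ∀ η : Lie T.Gs, (rightInv u η).liftKaehlerDifferential ω =
    algebraMap k _ (T.form (dLie T.j η) (dLie T.i ξ))

/-- Moment maps in the sense of Lu, for `ν : Y ⟶ G^*`, a Poisson structure `π` and an infinitesimal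
action `a` of `𝔤` on `Y`, and the infinitesimal action `δ` of `𝔤` on `G^*`: `ν` is
`𝔤`-equivariant, and `a(ξ) = π♯(ν^* ⟨θ, ξ⟩)` for all `ξ ∈ 𝔤`. -/
def IsLuMomentMap (δ : Lie T.G → GermField T.Gs) {Y : Sch k} (a : Lie T.G → GermField Y)
    (π : PoissonStructure Y) (ν : Y ⟶ T.Gs) : Prop :=
  (∀ ξ, FieldRelated ν (a ξ) (δ ξ)) ∧
    ∀ (y : Y.left) (ξ : Lie T.G) (ω : Ω[(Stk T.Gs (ν.left y))⁄k]),
      IsMaurerCartanForm (ν.left y) ξ ω →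
      a ξ y = (π.bracket y).liftKaehlerDifferential (pullForm (stkMap ν y) ω)

/-- The preimage `μ⁻¹(G^*)`, that is, the fibre product of `X` and `G^*` over `D/G`. -/
def preimage (μ : P.X ⟶ H.Q) : Sch k :=
  Over.mk (pullback.fst μ.left H.f.left ≫ P.X.hom)

/-- The projection of `μ⁻¹(G^*)` to `X`. -/
def preimageFst (μ : P.X ⟶ H.Q) : preimage H P μ ⟶ P.X :=
  Over.homMk (pullback.fst μ.left H.f.left)

/-- The restriction `μ⁻¹(G^*) ⟶ G^*` of `μ`. -/
def preimageSnd (μ : P.X ⟶ H.Q) : preimage H P μ ⟶ T.Gs :=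
  Over.homMk (pullback.snd μ.left H.f.left) (by
    change _ = pullback.fst μ.left H.f.left ≫ P.X.hom
    rw [← Over.w μ, ← Over.w H.f, pullback.condition_assoc]
    rfl)

/-- The infinitesimal action of `𝔤` on `μ⁻¹(G^*)`: the one that lifts the action on `X`. -/
def IsRestrictedAction (μ : P.X ⟶ H.Q) (a : Lie T.G → GermField (preimage H P μ)) : Prop :=
  ∀ ξ, FieldRelated (preimageFst H P μ) (a ξ) (fun x => infAct x ξ)

/-- The Poisson structure of `μ⁻¹(G^*)`: the one for which the projection to `X` is Poisson. -/
def IsRestrictedPoisson (μ : P.X ⟶ H.Q) (π : PoissonStructure (preimage H P μ)) : Prop :=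
  BracketRelated (preimageFst H P μ) π.bracket P.poisson.bracket

end GroupTriple

end Triples
end MomentMap

end

open MomentMap

/-!
Choose dual bases `xᵃ` of `𝔤^*` and `x_a` of `𝔤`; they exist because the canonical element `r`
forces the Lie algebras to be finite-dimensional (`GroupTriple.exists_dualBases`). Both moment map
conditions are expressed by one formula for the bracket of `X` at a point `x`,

  `{μ^* f, h} = ∑ μ^*(xᵃ f) x_a(h)`  for germs `f` on `D/G` and `h` on `X`  (`BracketFormula`),

where `xᵃ` acts on `D/G` and `x_a` on `X`.

The first ingredient is that `f : G^* ⟶ D/G` is étale (`Quotient.etale_f`). Tangent vectors are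
points over square-zero extensions. As `𝔤^*` is a complement of `𝔤` in `𝔡`, infinitesimal
deformations of points lift uniquely along `f`. So derivations extend uniquely along `f`, and as
`G^*` is smooth, this shows that `f` is étale. Hence `μ⁻¹(G^*) ⟶ X` is étale too, and vector fields
and Poisson brackets lift uniquely along both maps (`existsUnique_fieldRelated_family`,
`existsUnique_poissonStructure`).

Right-invariant vector fields of a basis of `𝔤^*` form a frame of `G^*` (`isFrame_rightInv`), and
they are related by `f` to the action of `𝔤^*` on `D/G`, which therefore gives a frame over the open
image of `f`. In terms of these frames, Lu's condition for `μ⁻¹(G^*)` is equivalent to the bracket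
formula at all points of `X` over `f(G^*)` (`isLuMomentMap_iff_bracketFormula`). The moment map
condition for the complement `𝔤^*` implies the bracket formula there
(`IsAKSMomentMap.bracketFormula`), and this is the first claim. Conversely, the bracket formula at
any point `x` implies the moment map condition at `x` for every complement
(`BracketFormula.eq_twisted`).

For the second claim, the bracket formula has to be propagated from the points over `f(G^*)` to all
points. It holds at `x` if it holds at `g x`, because the action `G × X ⟶ X` is a Poisson map
(`BracketFormula.of_act`). The brackets of functions on `D × D/G` with functions on `X`, all pulled
back to `G × X`, are derivations of the first argument. They are known on functions of `d`, by the
product bracket, and on functions of `d s`, by the bracket formula at `g x`; since `(d, s)` is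
determined by `d` and `d s`, they are known on functions of `s`. Finally, if `D/G` is irreducible,
every `G`-orbit in `X` meets `μ⁻¹(G^*)` (`exists_act_mem_range`).
-/

noncomputable section
namespace MomentMap
open MonoidalCategory CartesianMonoidalCategory Limits
open scoped TensorProduct KaehlerDifferential
attribute [local instance] Hom.monoid Hom.group

/-! ### Tangent vectors as points with values in square-zero extensions -/

section DerAlong
variable {k : Type u} [Field k]
variable {A R : Type u} [CommRing A] [Algebra k A] [CommRing R] [Algebra k R]
variable {M : Type u} [AddCommGroup M] [Module R M] [Module k M]

/-- The map `v : A → M` is a derivation along the homomorphism `ρ : A → R`, where `M` is an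
`R`-module. -/
def IsDerAlong (ρ : A →ₐ[k] R) (v : A →ₗ[k] M) : Prop :=
  ∀ f h, v (f * h) = ρ f • v h + ρ h • v f

theorem IsDerAlong.map_one {ρ : A →ₐ[k] R} {v : A →ₗ[k] M} (hv : IsDerAlong ρ v) : v 1 = 0 := by
  have := hv 1 1
  simpa using this

theorem IsDerAlong.map {M' : Type u} [AddCommGroup M'] [Module R M'] [Module k M']
    [IsScalarTower k R M] [IsScalarTower k R M'] {ρ : A →ₐ[k] R} {v : A →ₗ[k] M}
    (hv : IsDerAlong ρ v) (θ : M →ₗ[R] M') :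
    IsDerAlong ρ ((θ.restrictScalars k).comp v) := by
  intro f h
  simp [hv f h]

theorem IsDerAlong.comp {A' : Type u} [CommRing A'] [Algebra k A'] {ρ : A →ₐ[k] R} {v : A →ₗ[k] M}
    (hv : IsDerAlong ρ v) (φ : A' →ₐ[k] A) :
    IsDerAlong (ρ.comp φ) (v.comp φ.toLinearMap) := by
  intro f h
  simpa using hv (φ f) (φ h)

end DerAlong

section SquareZero
variable {k : Type u} [Field k]
variable {A R : Type u} [CommRing A] [Algebra k A] [CommRing R] [Algebra k R]
variable {M : Type u} [AddCommGroup M] [Module R M] [Module Rᵐᵒᵖ M] [IsCentralScalar R M]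
  [Module k M] [IsScalarTower k R M] [IsScalarTower k Rᵐᵒᵖ M]
variable {M' : Type u} [AddCommGroup M'] [Module R M'] [Module Rᵐᵒᵖ M'] [IsCentralScalar R M']
  [Module k M'] [IsScalarTower k R M'] [IsScalarTower k Rᵐᵒᵖ M']

/-- The homomorphism `f ↦ ρ(f) + v(f)` to the square-zero extension `R ⊕ M`. -/
def tszHom (ρ : A →ₐ[k] R) (v : A →ₗ[k] M) (hv : IsDerAlong ρ v) : A →ₐ[k] TrivSqZeroExt R M where
  toFun f := TrivSqZeroExt.inl (ρ f) + TrivSqZeroExt.inr (v f)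
  map_one' := by ext <;> simp [hv.map_one]
  map_mul' f h := by
    ext
    · simp
    · simp [hv f h]
  map_zero' := by ext <;> simp
  map_add' f h := by ext <;> simp
  commutes' r := by
    ext
    · simp [TrivSqZeroExt.algebraMap_eq_inl']
    · simp [Algebra.algebraMap_eq_smul_one, hv.map_one]

@[simp]
theorem fst_tszHom (ρ : A →ₐ[k] R) (v : A →ₗ[k] M) (hv : IsDerAlong ρ v) (f : A) :
    (tszHom ρ v hv f).fst = ρ f := by
  simp [tszHom]

@[simp]
theorem snd_tszHom (ρ : A →ₐ[k] R) (v : A →ₗ[k] M) (hv : IsDerAlong ρ v) (f : A) :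
    (tszHom ρ v hv f).snd = v f := by
  simp [tszHom]

variable (k R M) in
/-- Reduction `R ⊕ M → R`. -/
def tszFst : TrivSqZeroExt R M →ₐ[k] R := TrivSqZeroExt.fstHom k R M

variable (k R M) in
/-- The inclusion `R → R ⊕ M`. -/
def tszInl : R →ₐ[k] TrivSqZeroExt R M := TrivSqZeroExt.inlAlgHom k R M

/-- The homomorphism `R ⊕ M → R ⊕ M'` of a linear map `M → M'`. -/
def tszMap (θ : M →ₗ[R] M') : TrivSqZeroExt R M →ₐ[k] TrivSqZeroExt R M' :=
  (TrivSqZeroExt.map θ).restrictScalars k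

@[simp]
theorem tszFst_apply (x : TrivSqZeroExt R M) : tszFst k R M x = x.fst := rfl

@[simp]
theorem fst_tszInl (x : R) : (tszInl k R M x).fst = x := rfl

@[simp]
theorem snd_tszInl (x : R) : (tszInl k R M x).snd = 0 := rfl

@[simp]
theorem fst_tszMap (θ : M →ₗ[R] M') (x : TrivSqZeroExt R M) :
    (tszMap (k := k) θ x).fst = x.fst := by
  simp [tszMap]

@[simp]
theorem snd_tszMap (θ : M →ₗ[R] M') (x : TrivSqZeroExt R M) :
    (tszMap (k := k) θ x).snd = θ x.snd := by
  simp [tszMap]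

theorem tszFst_comp_tszHom (ρ : A →ₐ[k] R) (v : A →ₗ[k] M) (hv : IsDerAlong ρ v) :
    (tszFst k R M).comp (tszHom ρ v hv) = ρ := by
  ext f; simp

theorem tszFst_comp_tszInl : (tszFst k R M).comp (tszInl k R M) = AlgHom.id k R := by
  ext f; simp

theorem tszMap_comp_tszInl (θ : M →ₗ[R] M') :
    (tszMap θ).comp (tszInl k R M) = tszInl k R M' := by
  apply AlgHom.ext; intro f; apply TrivSqZeroExt.ext <;> simp

theorem tszMap_comp_tszHom {ρ : A →ₐ[k] R} {v : A →ₗ[k] M}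
    (hv : IsDerAlong ρ v) (θ : M →ₗ[R] M') :
    (tszMap θ).comp (tszHom ρ v hv) = tszHom ρ _ (hv.map θ) := by
  apply AlgHom.ext; intro f; apply TrivSqZeroExt.ext <;> simp

theorem tszHom_comp {A' : Type u} [CommRing A'] [Algebra k A'] {ρ : A →ₐ[k] R} {v : A →ₗ[k] M}
    (hv : IsDerAlong ρ v) (φ : A' →ₐ[k] A) :
    (tszHom ρ v hv).comp φ = tszHom _ _ (hv.comp φ) := by
  apply AlgHom.ext; intro f; apply TrivSqZeroExt.ext <;> simp

theorem tszHom_injective {ρ : A →ₐ[k] R} {v w : A →ₗ[k] M}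
    {hv : IsDerAlong ρ v} {hw : IsDerAlong ρ w} (h : tszHom ρ v hv = tszHom ρ w hw) : v = w := by
  ext f
  have := congr(($h f).snd)
  simpa using this

/-- The homomorphisms to `R ⊕ M` that reduce to `ρ` are given by the derivations along `ρ`. -/
theorem exists_eq_tszHom {ρ : A →ₐ[k] R} (φ : A →ₐ[k] TrivSqZeroExt R M)
    (hφ : (tszFst k R M).comp φ = ρ) : ∃ v hv, φ = tszHom ρ v hv := by
  have h : ∀ f, (φ f).fst = ρ f := fun f => congr($hφ f)
  let v : A →ₗ[k] M :=
    { toFun := fun f => (φ f).snd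
      map_add' := fun f g => by simp
      map_smul' := fun r f => by simp }
  have hv : IsDerAlong ρ v := fun f g => by
    change (φ (f * g)).snd = ρ f • (φ g).snd + ρ g • (φ f).snd
    simp [h]
  refine ⟨v, hv, AlgHom.ext fun f => TrivSqZeroExt.ext ?_ ?_⟩
  · rw [fst_tszHom, h]
  · rw [snd_tszHom]
    rfl

theorem stkMap_pt {X Y : Sch k} (φ : X ⟶ Y) (x : X.left) :
    specMap (stkMap φ x) ≫ pt Y (φ.left x) = pt X x ≫ φ :=
  Over.OverMorphism.ext (Scheme.SpecMap_stalkMap_fromSpecStalk _)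

/-- A point of `X` over a local ring, with closed point `x`, factors through the local ring
of `X` at `x`. -/
theorem exists_eq_specMap_pt {X : Sch k} {x : X.left} [IsLocalRing R] (y : specO k R ⟶ X)
    (hx : y.left (IsLocalRing.closedPoint R) = x) :
    ∃ φ : Stk X x →ₐ[k] R, IsLocalHom φ.toRingHom ∧ specMap φ ≫ pt X x = y := by
  subst hx
  let φ : X.left.presheaf.stalk _ ⟶ CommRingCat.of R :=
      Scheme.stalkClosedPointTo (R := CommRingCat.of R) y.left
  have hφ : Spec.map φ ≫ X.left.fromSpecStalk _ = y.left := by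
    exact Scheme.Spec_stalkClosedPointTo_fromSpecStalk (R := CommRingCat.of R) y.left
  have halg : CommRingCat.ofHom (algebraMap k (Stk X _)) ≫ φ =
      CommRingCat.ofHom (algebraMap k R) := by
    apply Spec.map_injective
    rw [Spec.map_comp, map_algebraMap_stk, ← Category.assoc, hφ]
    exact Over.w y
  let ψ : Stk X _ →ₐ[k] R := { φ.hom with commutes' := fun r => congr($(halg).hom r) }
  refine ⟨ψ, ?_, Over.OverMorphism.ext hφ⟩
  exact Scheme.isLocalHom_stalkClosedPointTo (R := CommRingCat.of R) y.left

/-- A point of `X` with values in `R ⊕ M` that reduces to the `R`-point given by a local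
homomorphism `ρ` of the local ring at `x` is given by a derivation along `ρ`. -/
theorem exists_eq_tszHom_pt {X : Sch k} {x : X.left} [IsLocalRing R] (ρ : Stk X x →ₐ[k] R)
    [hρ : IsLocalHom ρ.toRingHom] (y : specO k (TrivSqZeroExt R M) ⟶ X)
    (hy : specMap (tszFst k R M) ≫ y = specMap ρ ≫ pt X x) :
    ∃ v hv, y = specMap (tszHom ρ v hv) ≫ pt X x := by
  have hloc : IsLocalHom (tszFst k R M).toRingHom := isLocalHom_fst R M
  have : IsLocalRing (TrivSqZeroExt R M) := RingHom.domain_isLocalRing (tszFst k R M).toRingHom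
  have hx : y.left (IsLocalRing.closedPoint _) = x := by
    have h1 : Spec.map (CommRingCat.ofHom (tszFst k R M).toRingHom)
        (IsLocalRing.closedPoint R) = IsLocalRing.closedPoint (TrivSqZeroExt R M) :=
      IsLocalRing.comap_closedPoint _
    have h2 : (X.left.fromSpecStalk x) (IsLocalRing.closedPoint (Stk X x)) = x :=
      Scheme.fromSpecStalk_closedPoint
    have h3 : Spec.map (CommRingCat.ofHom ρ.toRingHom)
        (IsLocalRing.closedPoint R) = IsLocalRing.closedPoint (Stk X x) :=
      IsLocalRing.comap_closedPoint _
    have h4 : Spec.map (CommRingCat.ofHom (tszFst k R M).toRingHom) ≫ y.left =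
      Spec.map (CommRingCat.ofHom ρ.toRingHom) ≫ X.left.fromSpecStalk x :=
        congrArg CommaMorphism.left hy
    rw [← h3] at h2
    rw [← h1]
    exact (congr($h4 (IsLocalRing.closedPoint R))).trans h2
  obtain ⟨φ, -, hφ⟩ := exists_eq_specMap_pt y hx
  have h5 : (tszFst k R M).comp φ = ρ := by
    apply specMap_pt_injective X x
    rw [← specMap_comp, Category.assoc, hφ, hy]
  obtain ⟨v, hv, rfl⟩ := exists_eq_tszHom φ h5
  exact ⟨v, hv, hφ.symm⟩

end SquareZero

/-! ### Infinitesimal points of a group -/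

section Evaluation
variable {k : Type u} [Field k]
variable {G : Sch k} [GrpObj G] {H : Sch k} [GrpObj H]
variable {R : Type u} [CommRing R] [Algebra k R]
variable {M : Type u} [AddCommGroup M] [Module R M] [Module k M]

theorem isDerAlong_zero {A : Type u} [CommRing A] [Algebra k A] (ρ : A →ₐ[k] R) :
    IsDerAlong ρ (0 : A →ₗ[k] M) := by
  intro f h
  simp

theorem IsDerAlong.add {A : Type u} [CommRing A] [Algebra k A] {ρ : A →ₐ[k] R} {v w : A →ₗ[k] M}
    (hv : IsDerAlong ρ v) (hw : IsDerAlong ρ w) : IsDerAlong ρ (v + w) := by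
  intro f h
  simp only [LinearMap.add_apply, hv f h, hw f h, smul_add]
  abel

theorem IsDerAlong.sub {A : Type u} [CommRing A] [Algebra k A] {ρ : A →ₐ[k] R} {v w : A →ₗ[k] M}
    (hv : IsDerAlong ρ v) (hw : IsDerAlong ρ w) : IsDerAlong ρ (v - w) := by
  intro f h
  rw [LinearMap.sub_apply, LinearMap.sub_apply, LinearMap.sub_apply, hv, hw, smul_sub, smul_sub]
  abel

variable (G) in
/-- Evaluation at the unit, as a homomorphism of `k`-algebras. -/
def evHom : Stk G (unitPt G) →ₐ[k] k := ⟨evUnit G, ev_algebraMap G⟩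

variable (G R) in
/-- Evaluation at the unit, with values in a `k`-algebra. -/
def evAlg : Stk G (unitPt G) →ₐ[k] R := (Algebra.ofId k R).comp (evHom G)

theorem evAlg_apply (f : Stk G (unitPt G)) : evAlg G R f = algebraMap k R (evUnit G f) := rfl

theorem specMap_evAlg : specMap (evAlg G R) ≫ pt G (unitPt G) = 1 := by
  have h0 : specMap (evHom G) ≫ pt G (unitPt G) = 1 := Over.OverMorphism.ext (map_ev G)
  rw [evAlg, ← specMap_comp, Category.assoc, h0, MonObj.comp_one]

instance isLocalHom_evAlg [Nontrivial R] : IsLocalHom (evAlg G R).toRingHom := by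
  have h1 : IsLocalHom (evUnit G) :=
    Scheme.isLocalHom_stalkClosedPointTo (R := CommRingCat.of k) (1 : specO k k ⟶ G).left
  have h2 : (evAlg G R).toRingHom = (algebraMap k R).comp (evUnit G) := rfl
  rw [h2]
  infer_instance

variable (i : G ⟶ H) [IsMonHom i]

/-- The homomorphism of local rings at the units, as a homomorphism of `k`-algebras. -/
def stkHomAlg : Stk H (unitPt H) →ₐ[k] Stk G (unitPt G) := ⟨stkHom i, stkHom_algebraMap i⟩

theorem specMap_stkHomAlg :
    specMap (stkHomAlg i) ≫ pt H (unitPt H) = pt G (unitPt G) ≫ i :=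
  Over.OverMorphism.ext (map_stkHom i)

theorem evAlg_comp_stkHomAlg : (evAlg G R).comp (stkHomAlg i) = evAlg H R := by
  apply AlgHom.ext
  intro f
  exact congrArg (algebraMap k R) (ev_stkHom i f)

theorem IsDerAlong.comp_stkHom {w : Stk G (unitPt G) →ₗ[k] M} (hw : IsDerAlong (evAlg G R) w) :
    IsDerAlong (evAlg H R) (w.comp (stkHomAlg i).toLinearMap) := by
  have := hw.comp (stkHomAlg i)
  rwa [evAlg_comp_stkHomAlg] at this

end Evaluation

section Exp
variable {k : Type u} [Field k]
variable {G : Sch k} [GrpObj G] {H : Sch k} [GrpObj H]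
variable {R : Type u} [CommRing R] [Algebra k R]
variable {M : Type u} [AddCommGroup M] [Module R M] [Module Rᵐᵒᵖ M] [IsCentralScalar R M]
  [Module k M] [IsScalarTower k R M] [IsScalarTower k Rᵐᵒᵖ M]
variable {M' : Type u} [AddCommGroup M'] [Module R M'] [Module Rᵐᵒᵖ M'] [IsCentralScalar R M']
  [Module k M'] [IsScalarTower k R M'] [IsScalarTower k Rᵐᵒᵖ M']

/-- The point of `G` over `R ⊕ M` given by a derivation at the unit, that is, by a tangent vector
at the unit with coefficients in `M`. -/
def expM (w : Stk G (unitPt G) →ₗ[k] M) (hw : IsDerAlong (evAlg G R) w) :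
    specO k (TrivSqZeroExt R M) ⟶ G :=
  specMap (tszHom _ w hw) ≫ pt G (unitPt G)

theorem tszFst_expM (w : Stk G (unitPt G) →ₗ[k] M) (hw : IsDerAlong (evAlg G R) w) :
    specMap (tszFst k R M) ≫ expM w hw = 1 := by
  rw [expM, ← Category.assoc, specMap_comp, tszFst_comp_tszHom, specMap_evAlg]

theorem tszMap_expM (θ : M →ₗ[R] M') (w : Stk G (unitPt G) →ₗ[k] M)
    (hw : IsDerAlong (evAlg G R) w) :
    specMap (tszMap θ) ≫ expM w hw = expM _ (hw.map θ) := by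
  rw [expM, ← Category.assoc, specMap_comp, tszMap_comp_tszHom, expM]

theorem expM_injective {w w' : Stk G (unitPt G) →ₗ[k] M} {hw : IsDerAlong (evAlg G R) w}
    {hw' : IsDerAlong (evAlg G R) w'} (h : expM w hw = expM w' hw') : w = w' :=
  tszHom_injective (specMap_pt_injective _ _ h)

/-- Points over `R ⊕ M` that reduce to the unit are given by tangent vectors at the unit. -/
theorem exists_eq_expM [IsLocalRing R] (y : specO k (TrivSqZeroExt R M) ⟶ G)
    (hy : specMap (tszFst k R M) ≫ y = 1) : ∃ w hw, y = expM (R := R) w hw :=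
  exists_eq_tszHom_pt (evAlg G R) y (by rw [hy, specMap_evAlg])

theorem expM_zero (h : IsDerAlong (evAlg G R) (0 : Stk G (unitPt G) →ₗ[k] M)) :
    expM 0 h = 1 := by
  have : tszHom (evAlg G R) (0 : Stk G (unitPt G) →ₗ[k] M) h = evAlg G (TrivSqZeroExt R M) := by
    apply AlgHom.ext
    intro f
    apply TrivSqZeroExt.ext
    · simp [evAlg_apply, TrivSqZeroExt.algebraMap_eq_inl']
    · simp [evAlg_apply, TrivSqZeroExt.algebraMap_eq_inl']
  rw [expM, this, specMap_evAlg]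

theorem expM_congr {w w' : Stk G (unitPt G) →ₗ[k] M} {hw : IsDerAlong (evAlg G R) w}
    {hw' : IsDerAlong (evAlg G R) w'} (h : w = w') : expM w hw = expM w' hw' := by
  subst h
  rfl

/-- The product of two infinitesimal points is given by the sum of the tangent vectors. -/
theorem expM_mul [IsLocalRing R] (w w' : Stk G (unitPt G) →ₗ[k] M)
    (hw : IsDerAlong (evAlg G R) w) (hw' : IsDerAlong (evAlg G R) w') :
    expM w hw * expM w' hw' = expM (w + w') (hw.add hw') := by
  -- Over `R ⊕ (M × M)` the product of `(w, 0)` and `(0, w')` is seen to be `(w, w')`.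
  let y : specO k (TrivSqZeroExt R (M × M)) ⟶ G :=
    expM _ (hw.map (LinearMap.inl R M M)) * expM _ (hw'.map (LinearMap.inr R M M))
  obtain ⟨v, hv, hy⟩ := exists_eq_expM y (by
    simp only [y, MonObj.comp_mul, tszFst_expM, mul_one])
  have key : ∀ θ : M × M →ₗ[R] M, expM _ (hv.map θ) =
      expM _ ((hw.map (LinearMap.inl R M M)).map θ) *
        expM _ ((hw'.map (LinearMap.inr R M M)).map θ) := by
    intro θ
    rw [← tszMap_expM θ v hv, ← hy, MonObj.comp_mul, tszMap_expM, tszMap_expM]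
  have h1 : ∀ f, (v f).1 = w f := by
    have : expM _ (hv.map (LinearMap.fst R M M)) = expM w hw := by
      rw [key]
      refine (congrArg₂ (· * ·) (expM_congr (LinearMap.ext fun f => ?_))
        ((expM_congr (LinearMap.ext fun f => ?_)).trans
          (expM_zero (isDerAlong_zero _)))).trans (mul_one _) <;> simp
    exact fun f => congr($(expM_injective this) f)
  have h2 : ∀ f, (v f).2 = w' f := by
    have : expM _ (hv.map (LinearMap.snd R M M)) = expM w' hw' := by
      rw [key]
      refine (congrArg₂ (· * ·) ((expM_congr (LinearMap.ext fun f => ?_)).trans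
          (expM_zero (isDerAlong_zero _)))
        (expM_congr (LinearMap.ext fun f => ?_))).trans (one_mul _) <;> simp
    exact fun f => congr($(expM_injective this) f)
  have h3 := key (LinearMap.coprod LinearMap.id LinearMap.id)
  refine ((congrArg₂ (· * ·) (expM_congr (LinearMap.ext fun f => ?_))
    (expM_congr (LinearMap.ext fun f => ?_))).trans h3.symm).trans
    (expM_congr (LinearMap.ext fun f => ?_)) <;> simp [h1, h2]

section
variable (i : G ⟶ H) [IsMonHom i]

theorem expM_comp (w : Stk G (unitPt G) →ₗ[k] M) (hw : IsDerAlong (evAlg G R) w) :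
    expM w hw ≫ i = expM _ (hw.comp_stkHom i) := by
  rw [expM, expM, Category.assoc, ← specMap_stkHomAlg, ← Category.assoc, specMap_comp, tszHom_comp]
  congr 2
  apply AlgHom.ext
  intro f
  apply TrivSqZeroExt.ext
  · simp only [fst_tszHom, evAlg_comp_stkHomAlg]
  · simp only [snd_tszHom]

end

end Exp

/-! ### Decomposition of tangent vectors in a group triple -/

section Cotangent
variable {k : Type u} [Field k]
variable {G : Sch k} [GrpObj G] {H : Sch k} [GrpObj H]
variable {R : Type u} [CommRing R] [Algebra k R]
variable {M : Type u} [AddCommGroup M] [Module R M] [Module k M] [IsScalarTower k R M]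

variable (G) in
/-- The span of the elements `f h - f(e) h - h(e) f` of the local ring at the unit. -/
def leibnizSpan : Submodule k (Stk G (unitPt G)) :=
  Submodule.span k {x | ∃ f h, x = f * h - evUnit G f • h - evUnit G h • f}

variable (G) in
/-- The cotangent space of `G` at the unit, as the universal target of point derivations. -/
abbrev Cotangent := Stk G (unitPt G) ⧸ leibnizSpan G

theorem isDerAlong_evAlg_iff (w : Stk G (unitPt G) →ₗ[k] M) :
    IsDerAlong (evAlg G R) w ↔ leibnizSpan G ≤ LinearMap.ker w := by
  rw [leibnizSpan, Submodule.span_le]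
  have key : ∀ f h, w (f * h - evUnit G f • h - evUnit G h • f) =
      w (f * h) - (evAlg G R f • w h + evAlg G R h • w f) := by
    intro f h
    simp only [map_sub, map_smul, evAlg_apply, algebraMap_smul]
    abel
  constructor
  · rintro hw _ ⟨f, h, rfl⟩
    simp [key, hw f h]
  · intro hw f h
    have : w _ = 0 := hw ⟨f, h, rfl⟩
    rwa [key, sub_eq_zero] at this

variable (R) in
theorem isDerAlong_comp_mkQ (φ : Cotangent G →ₗ[k] M) :
    IsDerAlong (evAlg G R) (φ.comp (leibnizSpan G).mkQ) := by
  rw [isDerAlong_evAlg_iff]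
  intro x hx
  simp [(Submodule.Quotient.mk_eq_zero _).mpr hx]

variable (G) in
/-- The Lie algebra is the dual of the cotangent space at the unit. -/
def dualCotangent : Module.Dual k (Cotangent G) →ₗ[k] Lie G where
  toFun φ := ⟨φ.comp (leibnizSpan G).mkQ, isDerAlong_comp_mkQ k φ⟩
  map_add' _ _ := rfl
  map_smul' _ _ := rfl

theorem dualCotangent_bijective : Function.Bijective (dualCotangent G) := by
  constructor
  · intro φ ψ h
    apply Submodule.linearMap_qext
    exact congrArg Subtype.val h
  · intro ξ
    exact ⟨(leibnizSpan G).liftQ ξ.1 ((isDerAlong_evAlg_iff (R := k) ξ.1).mp ξ.2), rfl⟩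

variable (i : G ⟶ H) [IsMonHom i]

/-- The map of cotangent spaces at the units induced by a homomorphism of groups. -/
def cotangentMap : Cotangent H →ₗ[k] Cotangent G :=
  (leibnizSpan H).mapQ (leibnizSpan G) (stkHomAlg i).toLinearMap (by
    rw [leibnizSpan, Submodule.span_le]
    rintro _ ⟨f, h, rfl⟩
    refine Submodule.subset_span ⟨stkHomAlg i f, stkHomAlg i h, ?_⟩
    have h1 : ∀ f, evUnit G (stkHomAlg i f) = evUnit H f := ev_stkHom i
    simp [h1])

theorem dualCotangent_comp (φ : Module.Dual k (Cotangent G)) :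
    dualCotangent H (φ.comp (cotangentMap i)) = dLie i (dualCotangent G φ) := rfl

theorem stkHom_surjective [IsClosedImmersion i.left] : Function.Surjective (stkHom i) := by
  have h1 : Function.Surjective (i.left.stalkMap (unitPt G)) := i.left.stalkMap_surjective _
  have h2 : Function.Surjective
      (H.left.presheaf.stalkSpecializes (specializes_of_eq (map_unitPt i))) := by
    have : ∀ {x y : H.left} (h : x = y),
        Function.Surjective (H.left.presheaf.stalkSpecializes (specializes_of_eq h)) := by
      rintro x _ rfl f
      exact ⟨f, by simp⟩
    exact this (map_unitPt i)
  exact h1.comp h2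

theorem dLie_injective [IsClosedImmersion i.left] : Function.Injective (dLie i) := by
  intro ξ η h
  apply Subtype.ext
  apply LinearMap.ext
  intro f
  obtain ⟨g, rfl⟩ := stkHom_surjective i f
  exact congr(($h).1 g)

end Cotangent

namespace GroupTriple
variable {k : Type u} [Field k] (T : GroupTriple k)
variable {R : Type u} [CommRing R] [Algebra k R]
variable {M : Type u} [AddCommGroup M] [Module R M] [Module k M] [IsScalarTower k R M]

/-- The cotangent space of `D` is the direct sum of those of `G` and `G^*`: the dual map is
the isomorphism `𝔤 ⊕ 𝔤^* → 𝔡`. Cotangent spaces are used, rather than Lie algebras, because tangent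
vectors with coefficients in an arbitrary module are linear maps on the cotangent space. -/
theorem cotangentMap_prod_bijective :
    Function.Bijective ((cotangentMap T.i).prod (cotangentMap T.j)) := by
  constructor
  · rw [← LinearMap.ker_eq_bot, LinearMap.ker_eq_bot']
    intro c hc
    have hc' : cotangentMap T.i c = 0 ∧ cotangentMap T.j c = 0 := by simpa using hc
    rw [← Module.forall_dual_apply_eq_zero_iff k]
    intro φ
    have h1 : dualCotangent T.D φ ∈ LinearMap.range (dLie T.i) ⊔ LinearMap.range (dLie T.j) := by
      rw [T.isCompl.sup_eq_top]; trivial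
    obtain ⟨_, ⟨ξ, rfl⟩, _, ⟨η, rfl⟩, h2⟩ := Submodule.mem_sup.mp h1
    obtain ⟨ξ, rfl⟩ := dualCotangent_bijective.2 ξ
    obtain ⟨η, rfl⟩ := dualCotangent_bijective.2 η
    rw [← dualCotangent_comp, ← dualCotangent_comp, ← map_add] at h2
    rw [← dualCotangent_bijective.1 h2]
    simp [hc'.1, hc'.2]
  · rw [← LinearMap.dualMap_injective_iff, ← LinearMap.ker_eq_bot, LinearMap.ker_eq_bot']
    intro φ hφ
    let φ₁ := φ.comp (LinearMap.inl k _ _)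
    let φ₂ := φ.comp (LinearMap.inr k _ _)
    have h1 : φ₁.comp (cotangentMap T.i) + φ₂.comp (cotangentMap T.j) = 0 := by
      ext c
      have := congr($hφ (Submodule.Quotient.mk c))
      simp only [LinearMap.dualMap_apply, LinearMap.prod_apply, LinearMap.zero_apply] at this
      simp only [φ₁, φ₂, LinearMap.comp_apply, LinearMap.add_apply, LinearMap.inl_apply,
        LinearMap.inr_apply, ← map_add, Submodule.mkQ_apply]
      simpa using this
    have h2 : dLie T.i (dualCotangent _ φ₁) + dLie T.j (dualCotangent _ φ₂) = 0 := by
      rw [← dualCotangent_comp, ← dualCotangent_comp, ← map_add, h1, map_zero]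
    -- `Lie` is only an additive monoid, so that the difference is written with the scalar `-1`.
    have h3 : dLie T.i (dualCotangent _ φ₁) = 0 :=
      Submodule.disjoint_def.mp T.isCompl.disjoint _ ⟨_, rfl⟩
        ⟨(-1 : k) • dualCotangent _ φ₂, by
          rw [map_smul]
          refine Subtype.ext (LinearMap.ext fun f => ?_)
          have h : (dLie T.i (dualCotangent _ φ₁)).1 f + (dLie T.j (dualCotangent _ φ₂)).1 f = 0 :=
            congr(($h2).1 f)
          change (-1 : k) * (dLie T.j (dualCotangent _ φ₂)).1 f = _
          linear_combination -h⟩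
    have h4 : dLie T.j (dualCotangent _ φ₂) = 0 := by rwa [h3, zero_add] at h2
    have h5 : φ₁ = 0 := dualCotangent_bijective.1 (dLie_injective T.i (by rw [h3]; simp))
    have h6 : φ₂ = 0 := dualCotangent_bijective.1 (dLie_injective T.j (by rw [h4]; simp))
    exact LinearMap.prod_ext h5 h6

/-- A tangent vector of `D` at the unit with coefficients in `M` is the sum of one of `G` and
one of `G^*`. -/
theorem exists_decomposition (w : Stk T.D (unitPt T.D) →ₗ[k] M)
    (hw : IsDerAlong (evAlg T.D R) w) :
    ∃ (v : Stk T.G (unitPt T.G) →ₗ[k] M) (v' : Stk T.Gs (unitPt T.Gs) →ₗ[k] M),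
      IsDerAlong (evAlg T.G R) v ∧ IsDerAlong (evAlg T.Gs R) v' ∧
        w = v.comp (stkHomAlg T.i).toLinearMap + v'.comp (stkHomAlg T.j).toLinearMap := by
  let e := LinearEquiv.ofBijective _ T.cotangentMap_prod_bijective
  let W : Cotangent T.D →ₗ[k] M := (leibnizSpan T.D).liftQ w ((isDerAlong_evAlg_iff w).mp hw)
  refine ⟨_, _, isDerAlong_comp_mkQ R ((W.comp e.symm.toLinearMap).comp (LinearMap.inl k _ _)),
    isDerAlong_comp_mkQ R ((W.comp e.symm.toLinearMap).comp (LinearMap.inr k _ _)), ?_⟩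
  apply LinearMap.ext
  intro f
  have h1 : e (Submodule.Quotient.mk f) = (Submodule.Quotient.mk (stkHomAlg T.i f), 0) +
      (0, Submodule.Quotient.mk (stkHomAlg T.j f)) := by
    rw [Prod.mk_add_mk, add_zero, zero_add]
    rfl
  have h2 : w f = W (e.symm (e (Submodule.Quotient.mk f))) := by
    rw [e.symm_apply_apply]
    rfl
  rw [h2, h1, map_add, map_add]
  rfl

/-- The sum of the tangent spaces of `G` and `G^*` is direct, for arbitrary coefficients. -/
theorem decomposition_unique {v : Stk T.G (unitPt T.G) →ₗ[k] M}
    {v' : Stk T.Gs (unitPt T.Gs) →ₗ[k] M}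
    (hv : IsDerAlong (evAlg T.G R) v) (hv' : IsDerAlong (evAlg T.Gs R) v')
    (h : v.comp (stkHomAlg T.i).toLinearMap = v'.comp (stkHomAlg T.j).toLinearMap) : v' = 0 := by
  apply LinearMap.ext
  intro f
  let V := (leibnizSpan T.G).liftQ v ((isDerAlong_evAlg_iff v).mp hv)
  let V' := (leibnizSpan T.Gs).liftQ v' ((isDerAlong_evAlg_iff v').mp hv')
  obtain ⟨c, hc⟩ := T.cotangentMap_prod_bijective.2 (0, Submodule.Quotient.mk f)
  obtain ⟨g, rfl⟩ := Submodule.mkQ_surjective _ c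
  have h1 : V (cotangentMap T.i (Submodule.Quotient.mk g)) =
      V' (cotangentMap T.j (Submodule.Quotient.mk g)) := congr($h g)
  have h2 : cotangentMap T.i (Submodule.Quotient.mk g) = 0 := congrArg Prod.fst hc
  have h3 : cotangentMap T.j (Submodule.Quotient.mk g) = Submodule.Quotient.mk f :=
    congrArg Prod.snd hc
  rw [h2, h3, map_zero] at h1
  exact h1.symm

end GroupTriple

/-! ### Derivations and the map from `G^*` to `D/G` -/

section Smooth
variable {k : Type u} [Field k]
variable {R : Type u} [CommRing R] [Algebra k R]
variable {M : Type u} [AddCommGroup M] [Module R M] [Module Rᵐᵒᵖ M] [IsCentralScalar R M]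
  [Module k M] [IsScalarTower k R M] [IsScalarTower k Rᵐᵒᵖ M]

/-- The infinitesimal lifting property of a smooth morphism, for the extension `R ⊕ M → R` of a
local ring `R`. -/
theorem exists_infinitesimal_lift [IsLocalRing R] {X Y : Sch k} (q : X ⟶ Y) [Smooth q.left]
    (x : specO k R ⟶ X) (y : specO k (TrivSqZeroExt R M) ⟶ Y)
    (h : specMap (tszFst k R M) ≫ y = x ≫ q) :
    ∃ z : specO k (TrivSqZeroExt R M) ⟶ X, specMap (tszFst k R M) ≫ z = x ∧ z ≫ q = y := by
  obtain ⟨p, hp⟩ : ∃ p, x.left (IsLocalRing.closedPoint R) = p := ⟨_, rfl⟩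
  obtain ⟨ρ, hρ, rfl⟩ := exists_eq_specMap_pt x hp
  have hloc : IsLocalHom (stkMap q p).toRingHom :=
    inferInstanceAs (IsLocalHom (q.left.stalkMap p).hom)
  have hloc' : IsLocalHom (ρ.comp (stkMap q p)).toRingHom :=
    inferInstanceAs (IsLocalHom (ρ.toRingHom.comp (stkMap q p).toRingHom))
  obtain ⟨v, hv, rfl⟩ := exists_eq_tszHom_pt (ρ.comp (stkMap q p)) y (by
    rw [h, Category.assoc, ← stkMap_pt, ← Category.assoc, specMap_comp])
  have hs : (q.left.stalkMap p).hom.FormallySmooth :=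
    Scheme.Hom.mem_smoothLocus.mp (q.left.smoothLocus_eq_top ▸ trivial)
  let _ : Algebra (Stk Y (q.left p)) (Stk X p) := (q.left.stalkMap p).hom.toAlgebra
  let _ : Algebra (Stk Y (q.left p)) (TrivSqZeroExt R M) := (tszHom _ v hv).toRingHom.toAlgebra
  let _ : Algebra (Stk Y (q.left p)) R := (ρ.comp (stkMap q p)).toRingHom.toAlgebra
  have hs' : Algebra.FormallySmooth (Stk Y (q.left p)) (Stk X p) := hs
  let g : TrivSqZeroExt R M →ₐ[Stk Y (q.left p)] R :=
    { (tszFst k R M).toRingHom with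
      commutes' := fun f => fst_tszHom _ v hv f }
  let ρ' : Stk X p →ₐ[Stk Y (q.left p)] R := { ρ.toRingHom with commutes' := fun f => rfl }
  have hg : Function.Surjective g := fun r => ⟨tszInl k R M r, rfl⟩
  have hnil : IsNilpotent (RingHom.ker g) := by
    refine ⟨2, ?_⟩
    rw [Ideal.zero_eq_bot, eq_bot_iff, pow_two, Ideal.mul_le]
    intro a ha b hb
    have ha' : a.fst = 0 := ha
    have hb' : b.fst = 0 := hb
    refine TrivSqZeroExt.ext ?_ ?_ <;> simp [ha', hb']
  let φ := Algebra.FormallySmooth.liftOfSurjective ρ' g hg hnil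
  have hφ : ∀ f, g (φ f) = ρ f :=
    Algebra.FormallySmooth.liftOfSurjective_apply ρ' g hg hnil
  let ψ : Stk X p →ₐ[k] TrivSqZeroExt R M :=
    { φ.toRingHom with
      commutes' := fun r => by
        have h1 : φ (stkMap q p (algebraMap k _ r)) = tszHom _ v hv (algebraMap k _ r) :=
          φ.commutes _
        rw [AlgHom.commutes, AlgHom.commutes] at h1
        exact h1 }
  refine ⟨specMap ψ ≫ pt X p, ?_, ?_⟩
  · rw [← Category.assoc, specMap_comp]
    congr 2
    exact AlgHom.ext hφ
  · rw [Category.assoc, ← stkMap_pt, ← Category.assoc, specMap_comp]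
    congr 2
    exact AlgHom.ext fun f => φ.commutes f

end Smooth

namespace GroupTriple
variable {k : Type u} [Field k] {T : GroupTriple k} (H : T.Quotient)

theorem mono_i (T : GroupTriple k) : Mono T.i := by
  have : Mono T.i.left := inferInstance
  exact Over.mono_of_mono_left T.i

theorem comp_i_eq_one {Z : Sch k} {g : Z ⟶ T.G} (h : g ≫ T.i = 1) : g = 1 := by
  have := T.mono_i
  rw [← cancel_mono T.i, h]
  exact (map_one (IsMonHom.monoidHom T.i Z)).symm

theorem comp_mul_hom {G G' : Sch k} [GrpObj G] [GrpObj G'] (i : G ⟶ G') [IsMonHom i] {Z : Sch k}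
    (a b : Z ⟶ G) : (a * b) ≫ i = (a ≫ i) * (b ≫ i) :=
  map_mul (IsMonHom.monoidHom i Z) a b

variable {M : Type u} [AddCommGroup M]

section
variable {R : Type u} [CommRing R] [Algebra k R] [IsLocalRing R]
variable [Module R M] [Module Rᵐᵒᵖ M] [IsCentralScalar R M]
  [Module k M] [IsScalarTower k R M] [IsScalarTower k Rᵐᵒᵖ M]

/-- Points of `G^*` over `R ⊕ M` with the same reduction and the same image in `D/G` agree: they
differ by a tangent vector that is tangent both to `G` and to `G^*`. -/
theorem Quotient.f_infinitesimal_injective (x y : specO k (TrivSqZeroExt R M) ⟶ T.Gs)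
    (h : specMap (tszFst k R M) ≫ x = specMap (tszFst k R M) ≫ y) (hf : x ≫ H.f = y ≫ H.f) :
    x = y := by
  simp only [Quotient.f, ← Category.assoc] at hf
  obtain ⟨g, hg⟩ := (H.eq_iff _ _ _).mp hf
  have hg1 : specMap (tszFst k R M) ≫ g = 1 := by
    apply comp_i_eq_one
    have := congrArg (specMap (tszFst k R M) ≫ ·) hg
    simp only [MonObj.comp_mul, ← Category.assoc, h] at this
    simpa using this.symm
  obtain ⟨v, hv, rfl⟩ := exists_eq_expM g hg1
  obtain ⟨v', hv', hx⟩ := exists_eq_expM (R := R) (M := M) (x⁻¹ * y) (by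
    rw [MonObj.comp_mul, ← h, GrpObj.comp_inv, inv_mul_cancel])
  have h1 : expM v hv ≫ T.i = expM v' hv' ≫ T.j := by
    rw [← hx, comp_mul_hom, hg, ← mul_assoc, ← comp_mul_hom, inv_mul_cancel]
    have : (1 : specO k (TrivSqZeroExt R M) ⟶ T.Gs) ≫ T.j = 1 :=
      map_one (IsMonHom.monoidHom T.j _)
    rw [this, one_mul]
  rw [expM_comp, expM_comp] at h1
  have h2 := T.decomposition_unique hv hv' (expM_injective h1)
  subst h2
  rw [expM_zero] at hx
  exact (inv_mul_eq_one.mp hx)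

/-- Every point of `D/G` over `R ⊕ M` whose reduction is lifted to `G^*` can be lifted to `G^*`:
lift it to `D` and remove the component along `G`. -/
theorem Quotient.f_infinitesimal_surjective (x : specO k R ⟶ T.Gs)
    (y : specO k (TrivSqZeroExt R M) ⟶ H.Q)
    (h : specMap (tszFst k R M) ≫ y = x ≫ H.f) :
    ∃ z : specO k (TrivSqZeroExt R M) ⟶ T.Gs, specMap (tszFst k R M) ≫ z = x ∧ z ≫ H.f = y := by
  obtain ⟨d, hd, rfl⟩ := exists_infinitesimal_lift H.q (x ≫ T.j) y (by
    rw [h, Quotient.f, Category.assoc])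
  let x₀ := specMap (tszInl k R M) ≫ x
  have hx₀ : specMap (tszFst k R M) ≫ x₀ = x := by
    rw [← Category.assoc, specMap_comp, tszFst_comp_tszInl, specMap_id, Category.id_comp]
  obtain ⟨w, hw, hwd⟩ := exists_eq_expM (R := R) (M := M) ((x₀ ≫ T.j)⁻¹ * d) (by
    rw [MonObj.comp_mul, GrpObj.comp_inv, ← Category.assoc, hx₀, hd, inv_mul_cancel])
  obtain ⟨v, v', hv, hv', rfl⟩ := T.exists_decomposition w hw
  have h1 : d = ((x₀ * expM v' hv') ≫ T.j) * (expM v hv ≫ T.i) := by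
    rw [comp_mul_hom, mul_assoc, expM_comp, expM_comp, expM_mul, ← inv_mul_eq_iff_eq_mul, hwd]
    exact expM_congr (add_comm _ _)
  refine ⟨x₀ * expM v' hv', ?_, ?_⟩
  · rw [MonObj.comp_mul, hx₀, tszFst_expM, mul_one]
  · rw [Quotient.f, ← Category.assoc]
    exact (H.eq_iff _ _ _).mpr ⟨_, h1⟩

end

end GroupTriple

/-! ### The map from `G^*` to `D/G` is étale -/

namespace GroupTriple
variable {k : Type u} [Field k] {T : GroupTriple k} (H : T.Quotient)

/-- Derivations of the local rings extend uniquely along `f : G^* ⟶ D/G`: they are points over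
square-zero extensions, and these lift uniquely. -/
theorem Quotient.f_existsUnique_derivation (u : T.Gs.left) {M : Type u} [AddCommGroup M]
    [Module (Stk T.Gs u) M] [Module k M] [IsScalarTower k (Stk T.Gs u) M]
    (v : Stk H.Q (H.f.left u) →ₗ[k] M) (hv : IsDerAlong (stkMap H.f u) v) :
    ∃! w : Derivation k (Stk T.Gs u) M, ∀ a, w (stkMap H.f u a) = v a := by
  let B := Stk T.Gs u
  let _ : Module Bᵐᵒᵖ M := Module.compHom M ((RingHom.id B).fromOpposite mul_comm)
  have _ : IsCentralScalar B M := ⟨fun _ _ => rfl⟩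
  have _ : IsScalarTower k Bᵐᵒᵖ M := ⟨fun c b m => by
    change (MulOpposite.unop (c • b)) • m = c • (MulOpposite.unop b • m)
    rw [MulOpposite.unop_smul, smul_assoc]⟩
  have hloc : IsLocalHom (AlgHom.id k B).toRingHom := ⟨fun _ h => h⟩
  have hpt : ∀ (w : B →ₗ[k] M) (hw : IsDerAlong (AlgHom.id k B) w),
      (specMap (tszHom _ w hw) ≫ pt T.Gs u) ≫ H.f =
        specMap (tszHom _ _ (hw.comp (stkMap H.f u))) ≫ pt H.Q _ := by
    intro w hw
    rw [Category.assoc, ← stkMap_pt, ← Category.assoc, specMap_comp, tszHom_comp]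
  have hred : ∀ (w : B →ₗ[k] M) (hw : IsDerAlong (AlgHom.id k B) w),
      specMap (tszFst k B M) ≫ specMap (tszHom _ w hw) ≫ pt T.Gs u = pt T.Gs u := by
    intro w hw
    rw [← Category.assoc, specMap_comp, tszFst_comp_tszHom, specMap_id, Category.id_comp]
  obtain ⟨z, hz, hzf⟩ := H.f_infinitesimal_surjective (R := B) (M := M) (pt T.Gs u)
    (specMap (tszHom _ v hv) ≫ pt H.Q _) (by
      rw [← Category.assoc, specMap_comp, tszFst_comp_tszHom, stkMap_pt])
  obtain ⟨w, hw, rfl⟩ := exists_eq_tszHom_pt (AlgHom.id k B) z (by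
    rw [hz, specMap_id, Category.id_comp])
  have hwv : ∀ a, w (stkMap H.f u a) = v a := by
    intro a
    rw [hpt] at hzf
    have := congr(($(specMap_pt_injective _ _ hzf) a).snd)
    rwa [snd_tszHom, snd_tszHom] at this
  refine ⟨Derivation.mk' w (fun a b => hw a b), hwv, fun w' hw' => ?_⟩
  have hd : IsDerAlong (AlgHom.id k B) (w' : B →ₗ[k] M) := fun a b => w'.leibniz a b
  have h2 := H.f_infinitesimal_injective _ _ ((hred w' hd).trans (hred w hw).symm) (by
    rw [hpt, hpt]
    congr 2
    apply AlgHom.ext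
    intro a
    apply TrivSqZeroExt.ext
    · rw [fst_tszHom, fst_tszHom]
    · rw [snd_tszHom, snd_tszHom]
      exact (hw' a).trans (hwv a).symm)
  have h3 := tszHom_injective (specMap_pt_injective _ _ h2)
  ext a
  exact congr($h3 a)

end GroupTriple

section Etale

/-- A form of the Jacobian criterion: if `B` is formally smooth over `k` and derivations extend
uniquely from `A` to `B`, then `B` is formally étale over `A`. -/
theorem formallyEtale_of_existsUnique_derivation (k A B : Type u) [Field k] [CommRing A]
    [CommRing B] [Algebra k A] [Algebra k B] [Algebra A B] [IsScalarTower k A B]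
    [Algebra.FormallySmooth k B]
    (h : ∀ (M : Type u) [AddCommGroup M] [Module B M] [Module k M] [IsScalarTower k B M]
      (v : A →ₗ[k] M), IsDerAlong (IsScalarTower.toAlgHom k A B) v →
      ∃! w : Derivation k B M, ∀ a, w (algebraMap A B a) = v a) :
    Algebra.FormallyEtale A B := by
  have h1 : Subsingleton Ω[B⁄A] := by
    obtain ⟨w, -, hw⟩ := h Ω[B⁄A] 0 (isDerAlong_zero _)
    have h2 : (KaehlerDifferential.D A B).restrictScalars k = 0 :=
      (hw _ (fun a => by simp)).trans (hw 0 (fun a => by simp)).symm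
    rw [← not_nontrivial_iff_subsingleton]
    intro hn
    have h3 := KaehlerDifferential.span_range_derivation A B
    have h4 : Set.range (KaehlerDifferential.D A B) ⊆ {0} := by
      rintro _ ⟨b, rfl⟩
      exact congr($h2 b)
    have h5 : (⊤ : Submodule B Ω[B⁄A]) ≤ ⊥ := by
      rw [← h3, Submodule.span_le]
      exact h4
    exact bot_ne_top (eq_top_iff.mpr h5)
  have h2 : Function.Injective (KaehlerDifferential.mapBaseChange k A B) := by
    let v : A →ₗ[k] B ⊗[A] Ω[A⁄k] :=
      { toFun := fun a => 1 ⊗ₜ KaehlerDifferential.D k A a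
        map_add' := fun a b => by rw [map_add, TensorProduct.tmul_add]
        map_smul' := fun c a => by
          rw [Derivation.map_smul, TensorProduct.tmul_smul]; rfl }
    obtain ⟨w, hw, -⟩ := h _ v (fun a b => by
      simp only [v, LinearMap.coe_mk, AddHom.coe_mk, Derivation.leibniz, TensorProduct.tmul_add,
        IsScalarTower.coe_toAlgHom', algebraMap_smul, TensorProduct.tmul_smul])
    have h3 : w.liftKaehlerDifferential.comp (KaehlerDifferential.mapBaseChange k A B) =
        LinearMap.id := by
      apply TensorProduct.AlgebraTensorModule.curry_injective
      ext a
      have h5 : w (algebraMap A B a) = 1 ⊗ₜ KaehlerDifferential.D k A a := hw a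
      simpa using h5
    exact Function.LeftInverse.injective (g := w.liftKaehlerDifferential) (fun x => congr($h3 x))
  have h3 : Subsingleton (Algebra.H1Cotangent A B) := by
    refine subsingleton_of_forall_eq 0 fun x => ?_
    have h4 : Algebra.H1Cotangent.δ k A B x = 0 := by
      apply h2
      rw [map_zero]
      exact (Algebra.H1Cotangent.exact_δ_mapBaseChange k A B _).mpr ⟨x, rfl⟩
    obtain ⟨y, rfl⟩ := (Algebra.H1Cotangent.exact_map_δ k A B x).mp h4
    rw [Subsingleton.elim y 0, map_zero]
  have h4 : Algebra.FormallySmooth A B := ⟨inferInstance, h3⟩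
  have h5 : Algebra.FormallyUnramified A B := ⟨h1⟩
  exact Algebra.FormallyEtale.of_formallyUnramified_and_formallySmooth

theorem formallySmooth_toStalk (A : Type u) [CommRing A] (p : PrimeSpectrum.Top A) :
    (StructureSheaf.toStalk A p).hom.FormallySmooth := by
  have h : Algebra.FormallySmooth A
      ((structurePresheafInCommRingCat A).stalk p) :=
    have := PrimeSpectrum.isPrime p
    Algebra.FormallySmooth.of_isLocalization (Ideal.primeCompl (α := A) p.asIdeal)
  exact h

theorem RingHom.FormallyEtale.smooth {A B : Type u} [CommRing A] [CommRing B] {f : A →+* B}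
    (hf : f.FormallyEtale) : f.FormallySmooth := by
  let _ := f.toAlgebra
  have h : Algebra.FormallyEtale A B := hf
  exact (inferInstance : Algebra.FormallySmooth A B)

theorem RingHom.FormallyEtale.unramified {A B : Type u} [CommRing A] [CommRing B] {f : A →+* B}
    (hf : f.FormallyEtale) : f.FormallyUnramified := by
  let _ := f.toAlgebra
  have h : Algebra.FormallyEtale A B := hf
  exact (inferInstance : Algebra.FormallyUnramified A B)

/-- The local rings of a smooth scheme over `k` are formally smooth over `k`. -/
theorem formallySmooth_stk {k : Type u} [Field k] (X : Sch k) [Smooth X.hom] (x : X.left) :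
    Algebra.FormallySmooth k (Stk X x) := by
  have h1 : (X.hom.stalkMap x).hom.FormallySmooth :=
    Scheme.Hom.mem_smoothLocus.mp (X.hom.smoothLocus_eq_top ▸ trivial)
  let θ : CommRingCat.of k ⟶ (Spec (CommRingCat.of k)).presheaf.stalk (X.hom x) :=
    Spec.preimage ((Spec (CommRingCat.of k)).fromSpecStalk (X.hom x))
  have h2 : CommRingCat.ofHom (algebraMap k (Stk X x)) = θ ≫ X.hom.stalkMap x := by
    apply Spec.map_injective
    rw [map_algebraMap_stk, Spec.map_comp, ← Scheme.SpecMap_stalkMap_fromSpecStalk,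
      Spec.map_preimage]
  have h3 : θ.hom.FormallySmooth := by
    have hθ : θ = StructureSheaf.toStalk k (X.hom x) := by
      apply Spec.map_injective
      rw [Spec.map_preimage]
      exact Spec.fromSpecStalk_eq (CommRingCat.of k) (X.hom x)
    rw [hθ]
    exact formallySmooth_toStalk k _
  have h5 : (algebraMap k (Stk X x)).FormallySmooth := by
    have : algebraMap k (Stk X x) = (X.hom.stalkMap x).hom.comp θ.hom :=
      congrArg CommRingCat.Hom.hom h2
    rw [this]
    exact h3.comp h1
  exact RingHom.formallySmooth_algebraMap.mp h5

end Etale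

namespace GroupTriple
variable {k : Type u} [Field k] {T : GroupTriple k} (H : T.Quotient)

/-- The map `G^* ⟶ D/G` is étale, since `𝔤^*` is a complement of `𝔤` in `𝔡` and `G^*` is smooth. -/
instance Quotient.etale_f : Etale H.f.left := by
  have h1 : ∀ u, (H.f.left.stalkMap u).hom.FormallyEtale := by
    intro u
    let _ : Algebra (Stk H.Q (H.f.left u)) (Stk T.Gs u) := (stkMap H.f u).toRingHom.toAlgebra
    have _ : IsScalarTower k (Stk H.Q (H.f.left u)) (Stk T.Gs u) :=
      IsScalarTower.of_algebraMap_eq' (stkMap H.f u).comp_algebraMap.symm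
    have := T.algGs.smooth
    have := formallySmooth_stk T.Gs u
    exact formallyEtale_of_existsUnique_derivation k (Stk H.Q (H.f.left u)) (Stk T.Gs u)
      fun M _ _ _ _ v hv => H.f_existsUnique_derivation u v hv
  have : LocallyOfFiniteType H.f.left := by
    have := T.algGs.smooth
    have : LocallyOfFiniteType (H.f.left ≫ H.Q.hom) := by
      rw [Over.w]; infer_instance
    exact locallyOfFiniteType_of_comp _ H.Q.hom
  have : IsLocallyNoetherian H.Q.left := LocallyOfFiniteType.isLocallyNoetherian H.Q.hom
  have : LocallyOfFinitePresentation H.f.left :=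
    LocallyOfFinitePresentation.iff_locallyOfFiniteType.mpr inferInstance
  have : Smooth H.f.left := by
    rw [← Scheme.Hom.smoothLocus_eq_top_iff, eq_top_iff]
    exact fun u _ => RingHom.FormallyEtale.smooth (h1 u)
  have : FormallyUnramified H.f.left :=
    HasRingHomProperty.of_stalkMap RingHom.FormallyUnramified.ofLocalizationPrime
      fun u => RingHom.FormallyEtale.unramified (h1 u)
  exact Etale.of_formallyUnramified_of_flat _

end GroupTriple

/-! ### Dual bases and the canonical element -/

section Lagrangian
variable {k : Type u} [Field k] {U V W : Type u} [AddCommGroup U] [Module k U] [AddCommGroup V]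
  [Module k V] [AddCommGroup W] [Module k W]

/-- Tensors are determined by the contractions of their second factor. -/
theorem eq_of_contract [FiniteDimensional k V]
    {r r' : V ⊗[k] V} (h : ∀ φ : Module.Dual k V,
      TensorProduct.rid k _ (LinearMap.lTensor V φ r) =
        TensorProduct.rid k _ (LinearMap.lTensor V φ r')) : r = r' := by
  let b := Module.finBasis k V
  have key : ∀ r : V ⊗[k] V,
      r = ∑ c, TensorProduct.rid k _ (LinearMap.lTensor V (b.coord c) r) ⊗ₜ[k] b c := by
    intro r
    induction r with
    | zero => simp
    | tmul u v =>
      simp only [LinearMap.lTensor_tmul, TensorProduct.rid_tmul, TensorProduct.smul_tmul,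
        ← TensorProduct.tmul_sum, b.coord_apply, b.sum_repr]
    | add r r' h h' =>
      nth_rw 1 [h, h']
      simp only [map_add, TensorProduct.add_tmul, Finset.sum_add_distrib]
  rw [key r, key r']
  simp only [h]

/-- The contractions of the second factor of a given tensor lie in a finite-dimensional space. -/
theorem exists_contract_mem (B : LinearMap.BilinForm k V) (r : V ⊗[k] V) :
    ∃ W : Submodule k V, FiniteDimensional k W ∧
      ∀ η, TensorProduct.rid k _ (LinearMap.lTensor _ (B η) r) ∈ W := by
  induction r with
  | zero => exact ⟨⊥, inferInstance, fun η => by simp⟩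
  | tmul u v =>
    refine ⟨k ∙ u, inferInstance, fun η => ?_⟩
    simpa using Submodule.smul_mem _ _ (Submodule.mem_span_singleton_self u)
  | add r r' h h' =>
    obtain ⟨W, _, hW⟩ := h
    obtain ⟨W', _, hW'⟩ := h'
    refine ⟨W ⊔ W', inferInstance, fun η => ?_⟩
    rw [map_add, map_add]
    exact add_mem (Submodule.mem_sup_left (hW η)) (Submodule.mem_sup_right (hW' η))

/-- If complementary Lagrangian subspaces `U` and `W` of `V` have a canonical element `r`, then they
have finite rank, since the contraction with `r` is the identity of `W`; hence they have dual bases,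
and `r` is given by these. -/
theorem exists_dualBases_of_lagrangian (i : U →ₗ[k] V) (j : W →ₗ[k] V)
    (B : LinearMap.BilinForm k V) (hi : Function.Injective i) (hj : Function.Injective j)
    (hsymm : ∀ v w, B v w = B w v) (hB : B.Nondegenerate)
    (hLi : B.orthogonal (LinearMap.range i) = LinearMap.range i)
    (hLj : B.orthogonal (LinearMap.range j) = LinearMap.range j)
    (hc : IsCompl (LinearMap.range i) (LinearMap.range j)) (r : V ⊗[k] V)
    (hr : ∀ η ∈ LinearMap.range i, TensorProduct.rid k _ (LinearMap.lTensor _ (B η) r) = 0)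
    (hr' : ∀ η ∈ LinearMap.range j, TensorProduct.rid k _ (LinearMap.lTensor _ (B η) r) = η) :
    ∃ (n : ℕ) (e : Fin n → W) (x : Fin n → U),
      (∀ a b, B (j (e a)) (i (x b)) = if a = b then 1 else 0) ∧
      (∀ η, ∑ a, B (j η) (i (x a)) • e a = η) ∧ (∀ ξ, ∑ a, B (j (e a)) (i ξ) • x a = ξ) ∧
      r = ∑ a, j (e a) ⊗ₜ[k] i (x a) := by
  have hii : ∀ ξ χ, B (i ξ) (i χ) = 0 := fun ξ χ => by
    have h : i χ ∈ B.orthogonal (LinearMap.range i) := by rw [hLi]; exact ⟨χ, rfl⟩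
    exact h _ ⟨ξ, rfl⟩
  have hU : ∀ ξ, (∀ η, B (j η) (i ξ) = 0) → ξ = 0 := by
    intro ξ h
    have h1 : i ξ ∈ LinearMap.range j := by
      rw [← hLj]
      rintro _ ⟨η, rfl⟩
      exact h η
    exact hi ((Submodule.disjoint_def.mp hc.disjoint _ ⟨ξ, rfl⟩ h1).trans (map_zero i).symm)
  have hW : ∀ η, (∀ ξ, B (j η) (i ξ) = 0) → η = 0 := by
    intro η h
    have h1 : j η ∈ LinearMap.range i := by
      rw [← hLi]
      rintro _ ⟨ξ, rfl⟩
      exact (hsymm _ _).trans (h ξ)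
    exact hj ((Submodule.disjoint_def.mp hc.disjoint _ h1 ⟨η, rfl⟩).trans (map_zero j).symm)
  have hfin : FiniteDimensional k (LinearMap.range j) := by
    obtain ⟨W, _, hW⟩ := exists_contract_mem B r
    refine Submodule.finiteDimensional_of_le (S₂ := W) fun η hη => ?_
    rw [← hr' η hη]
    exact hW η
  have : FiniteDimensional k W := Module.Finite.equiv (LinearEquiv.ofInjective j hj).symm
  let p : U →ₗ[k] Module.Dual k W := (B.compl₁₂ j i).flip
  have hp : Function.Injective p := by
    rw [← LinearMap.ker_eq_bot, LinearMap.ker_eq_bot']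
    exact fun ξ h => hU ξ fun η => congr($h η)
  have : FiniteDimensional k U := Module.Finite.of_injective p hp
  have hp' : Function.Injective p.flip := by
    rw [← LinearMap.ker_eq_bot, LinearMap.ker_eq_bot']
    exact fun η h => hW η fun ξ => congr($h ξ)
  have hdim : Module.finrank k U = Module.finrank k (Module.Dual k W) := by
    apply le_antisymm (LinearMap.finrank_le_finrank_of_injective hp)
    rw [Subspace.dual_finrank_eq, ← Subspace.dual_finrank_eq (K := k) (V := U)]
    exact LinearMap.finrank_le_finrank_of_injective hp'
  let q := LinearEquiv.ofInjectiveOfFinrankEq p hp hdim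
  have hq : ∀ φ η, B (j η) (i (q.symm φ)) = φ η := fun φ η => congr($(q.apply_symm_apply φ) η)
  let b := Module.finBasis k W
  have he : ∀ η, ∑ a, B (j η) (i (q.symm (b.coord a))) • b a = η := by
    intro η
    simp only [hq, b.coord_apply]
    exact b.sum_repr η
  refine ⟨_, b, fun a => q.symm (b.coord a), fun a c => ?_, he, fun ξ => ?_, ?_⟩
  · rw [hq, b.coord_apply, b.repr_self, Finsupp.single_apply]
  · apply q.injective
    rw [map_sum]
    simp only [map_smul, q.apply_symm_apply]
    refine b.ext fun c => ?_
    simp only [LinearMap.sum_apply, LinearMap.smul_apply, b.coord_apply, b.repr_self,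
      Finsupp.single_apply, smul_eq_mul, mul_ite, mul_one, mul_zero, Finset.sum_ite_eq,
      Finset.mem_univ, if_true]
    rfl
  · have : FiniteDimensional k V := by
      have h3 : FiniteDimensional k (⊤ : Submodule k V) := by
        rw [← hc.sup_eq_top]; infer_instance
      exact Module.finite_def.mpr ((Submodule.fg_top _).mp h3.1)
    apply eq_of_contract
    intro φ
    obtain ⟨η, rfl⟩ : ∃ η, B η = φ :=
      ⟨(B.toDual hB).symm φ,
        LinearMap.ext fun v => LinearMap.BilinForm.apply_toDual_symm_apply φ v⟩
    have hη : η ∈ LinearMap.range i ⊔ LinearMap.range j := by rw [hc.sup_eq_top]; trivial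
    obtain ⟨_, ⟨ξ, rfl⟩, _, ⟨χ, rfl⟩, rfl⟩ := Submodule.mem_sup.mp hη
    rw [map_add, LinearMap.lTensor_add, LinearMap.add_apply, map_add, LinearMap.add_apply, map_add,
      hr _ ⟨ξ, rfl⟩, hr' _ ⟨χ, rfl⟩]
    simp only [map_sum, LinearMap.lTensor_tmul, TensorProduct.rid_tmul, hii, zero_smul,
      Finset.sum_const_zero, zero_add]
    conv_lhs => rw [← he χ]
    rw [map_sum]
    simp only [map_smul]

end Lagrangian

/-- A form of `exists_dualBases_of_lagrangian` that does not presuppose subtraction, as Lie algebras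
here carry only the structure of an additive monoid. -/
theorem exists_dualBases_of_lagrangian' {k : Type u} [Field k] {U V W : Type u}
    [AddCommMonoid U] [Module k U] [AddCommMonoid V] [Module k V] [AddCommMonoid W] [Module k W]
    (i : U →ₗ[k] V) (j : W →ₗ[k] V)
    (B : LinearMap.BilinForm k V) (hi : Function.Injective i) (hj : Function.Injective j)
    (hsymm : ∀ v w, B v w = B w v) (hB : B.Nondegenerate)
    (hLi : B.orthogonal (LinearMap.range i) = LinearMap.range i)
    (hLj : B.orthogonal (LinearMap.range j) = LinearMap.range j)
    (hc : IsCompl (LinearMap.range i) (LinearMap.range j)) (r : V ⊗[k] V)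
    (hr : ∀ η ∈ LinearMap.range i, TensorProduct.rid k _ (LinearMap.lTensor _ (B η) r) = 0)
    (hr' : ∀ η ∈ LinearMap.range j, TensorProduct.rid k _ (LinearMap.lTensor _ (B η) r) = η) :
    ∃ (n : ℕ) (e : Fin n → W) (x : Fin n → U),
      (∀ a b, B (j (e a)) (i (x b)) = if a = b then 1 else 0) ∧
      (∀ η, ∑ a, B (j η) (i (x a)) • e a = η) ∧ (∀ ξ, ∑ a, B (j (e a)) (i ξ) • x a = ξ) ∧
      r = ∑ a, j (e a) ⊗ₜ[k] i (x a) :=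
  let _ : AddCommGroup U := Module.addCommMonoidToAddCommGroup k
  let _ : AddCommGroup V := Module.addCommMonoidToAddCommGroup k
  let _ : AddCommGroup W := Module.addCommMonoidToAddCommGroup k
  exists_dualBases_of_lagrangian i j B hi hj hsymm hB hLi hLj hc r hr hr'

namespace GroupTriple
variable {k : Type u} [Field k] (T : GroupTriple k)

/-- Dual bases `e` of `𝔤^*` and `x` of `𝔤`, with respect to the pairing on `𝔡`. -/
structure DualBases where
  n : ℕ
  e : Fin n → Lie T.Gs
  x : Fin n → Lie T.G
  pairing : ∀ a b, T.form (dLie T.j (e a)) (dLie T.i (x b)) = if a = b then 1 else 0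
  sum_e : ∀ η : Lie T.Gs, ∑ a, T.form (dLie T.j η) (dLie T.i (x a)) • e a = η
  sum_x : ∀ ξ : Lie T.G, ∑ a, T.form (dLie T.j (e a)) (dLie T.i ξ) • x a = ξ

theorem form_comm (ξ χ : Lie T.D) : T.form ξ χ = T.form χ ξ := T.symm.eq ξ χ

theorem form_dLie_i (ξ χ : Lie T.G) : T.form (dLie T.i ξ) (dLie T.i χ) = 0 := by
  have h : dLie T.i χ ∈ T.form.orthogonal (LinearMap.range (dLie T.i)) := by
    rw [T.lagrangian_G]; exact ⟨χ, rfl⟩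
  exact h _ ⟨ξ, rfl⟩

theorem exists_dualBases {r : Lie T.D ⊗[k] Lie T.D} (hr : T.IsCanonicalElement r) :
    ∃ b : T.DualBases, r = ∑ a, dLie T.j (b.e a) ⊗ₜ[k] dLie T.i (b.x a) := by
  obtain ⟨n, e, x, h1, h2, h3, h4⟩ := exists_dualBases_of_lagrangian' (dLie T.i) (dLie T.j) T.form
    (dLie_injective T.i) (dLie_injective T.j) T.form_comm T.nondegenerate T.lagrangian_G
    T.lagrangian_Gs T.isCompl r hr.1 hr.2
  exact ⟨⟨n, e, x, h1, h2, h3⟩, h4⟩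

end GroupTriple

/-! ### Functoriality of velocity fields -/

section Naturality
variable {k : Type u} [Field k]

/-- The homomorphism of dual numbers induced by a homomorphism of algebras. -/
def dualNumberMap {A B : Type u} [CommRing A] [Algebra k A] [CommRing B] [Algebra k B]
    (φ : A →ₐ[k] B) : DualNumber A →ₐ[k] DualNumber B where
  toFun x := TrivSqZeroExt.inl (φ x.fst) + TrivSqZeroExt.inr (φ x.snd)
  map_one' := by ext <;> simp
  map_mul' x y := by ext <;> simp
  map_zero' := by ext <;> simp
  map_add' x y := by ext <;> simp
  commutes' r := by ext <;> simp [TrivSqZeroExt.algebraMap_eq_inl']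

theorem snd_dualNumberMap {A B : Type u} [CommRing A] [Algebra k A] [CommRing B] [Algebra k B]
    (φ : A →ₐ[k] B) (x : DualNumber A) : (dualNumberMap φ x).snd = φ x.snd := zero_add _

theorem snd_expDer {A : Type u} [CommRing A] [Algebra k A] (v : Derivation k A A) (f : A) :
    (expDer v f).snd = v f := zero_add _

variable {N N' : Sch k} [GrpObj N] [GrpObj N'] (ι : N' ⟶ N) [IsMonHom ι]

theorem specMap_dualNumberMap_expPt {A B : Type u} [CommRing A] [Algebra k A] [CommRing B]
    [Algebra k B] (φ : A →ₐ[k] B) (ξ : Lie N) :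
    specMap (dualNumberMap φ) ≫ expPt (1 ⊗ₜ[k] ξ : A ⊗[k] Lie N) =
      expPt (1 ⊗ₜ[k] ξ : B ⊗[k] Lie N) := by
  rw [expPt, expPt, ← Category.assoc, specMap_comp]
  congr 2
  ext f
  · simp [dualNumberMap, expHom]
  · simp [dualNumberMap, expHom, contract_tmul]

theorem expPt_comp {B : Type u} [CommRing B] [Algebra k B] (ξ : Lie N') :
    expPt (1 ⊗ₜ[k] ξ : B ⊗[k] Lie N') ≫ ι = expPt (1 ⊗ₜ[k] dLie ι ξ : B ⊗[k] Lie N) := by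
  rw [expPt, expPt, Category.assoc, ← specMap_stkHomAlg, ← Category.assoc, specMap_comp]
  congr 2
  apply AlgHom.ext
  intro f
  have h := ev_stkHom ι f
  ext
  · simp [expHom, stkHomAlg, h]
  · simp [expHom, contract_tmul, stkHomAlg]
    rfl

/-- Velocity fields of families that are related by a morphism `ψ` and a homomorphism `ι` of the
parametrizing groups are related by `ψ`. -/
theorem velocity_naturality {X Y : Sch k} (ψ : Y ⟶ X) (y : Y.left)
    {m : specO k (Stk X (ψ.left y)) ⊗ N ⟶ X} {m' : specO k (Stk Y y) ⊗ N' ⟶ Y}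
    (hm : lift (𝟙 _) 1 ≫ m = pt X _) (hm' : lift (𝟙 _) 1 ≫ m' = pt Y y)
    (h : m' ≫ ψ = (specMap (stkMap ψ y) ⊗ₘ ι) ≫ m) (ξ : Lie N') (f : Stk X (ψ.left y)) :
    velocity m' hm' ξ (stkMap ψ y f) = stkMap ψ y (velocity m hm (dLie ι ξ) f) := by
  have h1 := velocityFun_spec m' hm' ξ
  have h2 := velocityFun_spec m hm (dLie ι ξ)
  have h0 : (dualNumberMap (stkMap ψ y)).comp (inlHom _) =
      (inlHom (Stk Y y)).comp (stkMap ψ y) := by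
    ext f <;> simp [dualNumberMap, inlHom]
  have h3 : specMap ((expDer (velocityFun m' hm' ξ)).comp (stkMap ψ y)) ≫ pt X _ =
      specMap ((dualNumberMap (stkMap ψ y)).comp (expDer (velocityFun m hm (dLie ι ξ)))) ≫
        pt X _ := by
    rw [← specMap_comp, Category.assoc, stkMap_pt, ← Category.assoc, h1, orbitPt,
      Category.assoc, h, ← specMap_comp, Category.assoc, h2, comp_orbitPt, orbitPt,
      specMap_dualNumberMap_expPt, ← expPt_comp, lift_map_assoc, specMap_comp, h0]
  have h4 := congr(($(specMap_pt_injective _ _ h3) f).snd)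
  rwa [AlgHom.comp_apply, AlgHom.comp_apply, snd_expDer, snd_dualNumberMap, snd_expDer] at h4

/-- Constant families have velocity zero. -/
theorem velocity_trivial {X : Sch k} (x : X.left)
    (hm : lift (𝟙 _) (1 : specO k (Stk X x) ⟶ N) ≫ (fst _ _ ≫ pt X x) = pt X x) (ξ : Lie N) :
    velocity (fst _ _ ≫ pt X x) hm ξ = 0 := by
  have h1 := velocityFun_spec _ hm ξ
  have h2 : specMap (expDer (velocityFun _ hm ξ)) ≫ pt X x =
      specMap (expDer 0) ≫ pt X x := by
    rw [h1, orbitPt, lift_fst_assoc]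
    congr 2
    ext f <;> simp [inlHom, expDer]
  ext f
  have h4 := congr(($(specMap_pt_injective _ _ h2) f).snd)
  rwa [snd_expDer, snd_expDer] at h4

end Naturality

/-! ### Frames of vector fields -/

section Frames
variable {k : Type u} [Field k]

/-- The pairing of differential forms with given derivations. -/
def frameMap {A : Type u} [CommRing A] [Algebra k A] {n : ℕ} (v : Fin n → Derivation k A A) :
    Ω[A⁄k] →ₗ[A] (Fin n → A) :=
  LinearMap.pi fun a => (v a).liftKaehlerDifferential

/-- The derivations `v` form a frame: pairing with them identifies the module of differentials with
a free module. -/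
def IsFrame {A : Type u} [CommRing A] [Algebra k A] {n : ℕ} (v : Fin n → Derivation k A A) : Prop :=
  Function.Bijective (frameMap v)

/-- The forms dual to a frame. -/
theorem IsFrame.exists_dual {A : Type u} [CommRing A] [Algebra k A] {n : ℕ}
    {v : Fin n → Derivation k A A} (hv : IsFrame v) :
    ∃ ω : Fin n → Ω[A⁄k],
      (∀ a b, (v a).liftKaehlerDifferential (ω b) = if a = b then 1 else 0) ∧
      ∀ η : Ω[A⁄k], η = ∑ a, (v a).liftKaehlerDifferential η • ω a := by
  choose ω hω using fun b : Fin n => hv.2 (fun a => if a = b then 1 else 0)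
  have h1 : ∀ a b, (v a).liftKaehlerDifferential (ω b) = if a = b then 1 else 0 := fun a b =>
    congr($(hω b) a)
  refine ⟨ω, h1, fun η => hv.1 ?_⟩
  ext a
  simp [frameMap, h1]

/-- Linear forms on `V` that are a basis of the dual space, with coordinate functions `L`, are dual
to a basis of `V`. The dimension of `V` is not assumed to be finite. -/
theorem exists_predual_basis {V : Type u} [AddCommGroup V] [Module k V] {n : ℕ}
    (φ : Fin n → Module.Dual k V) (L : Fin n → Module.Dual k (Module.Dual k V))
    (h1 : ∀ a b, L a (φ b) = if a = b then 1 else 0) (h2 : ∀ ψ, ∑ a, L a ψ • φ a = ψ) :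
    ∃ c : Fin n → V, (∀ a b, φ a (c b) = if a = b then 1 else 0) ∧
      ∀ v, v = ∑ a, φ a v • c a := by
  let p : V →ₗ[k] (Fin n → k) := LinearMap.pi φ
  have hinj : Function.Injective p := by
    rw [← LinearMap.ker_eq_bot, LinearMap.ker_eq_bot']
    intro v hv
    rw [← Module.forall_dual_apply_eq_zero_iff k]
    intro ψ
    rw [← h2 ψ, LinearMap.sum_apply]
    refine Finset.sum_eq_zero fun a _ => ?_
    rw [LinearMap.smul_apply, show φ a v = 0 from congr($hv a), smul_zero]
  have hsurj : Function.Surjective p := by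
    rw [← LinearMap.range_eq_top]
    by_contra hr
    obtain ⟨l, hl, hle⟩ := Submodule.exists_le_ker_of_lt_top _ (lt_top_iff_ne_top.mpr hr)
    apply hl
    have h3 : ∑ a, l (Pi.single a 1) • φ a = 0 := by
      ext v
      have h4 : l (p v) = 0 := hle ⟨v, rfl⟩
      rw [← LinearMap.sum_single_apply (fun _ => k) (p v)] at h4
      rw [LinearMap.zero_apply, ← h4, map_sum, LinearMap.sum_apply]
      refine Finset.sum_congr rfl fun a _ => ?_
      have h5 : (Pi.single a (p v a) : Fin n → k) = p v a • Pi.single a (1 : k) := by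
        simp [← Pi.single_smul]
      rw [h5, map_smul, LinearMap.smul_apply, smul_eq_mul, smul_eq_mul, mul_comm]
      rfl
    refine LinearMap.pi_ext' fun a => LinearMap.ext_ring ?_
    have h6 := congrArg (L a) h3
    simpa [h1] using h6
  choose c hc using fun b : Fin n => hsurj (fun a => if a = b then 1 else 0)
  have h3 : ∀ a b, φ a (c b) = if a = b then 1 else 0 := fun a b => congr($(hc b) a)
  refine ⟨c, h3, fun v => hinj ?_⟩
  ext a
  simp [p, h3]

variable {G : Sch k} [GrpObj G]

/-- Local coordinates at the unit: functions dual to a basis of the Lie algebra. Tangent vectors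
with arbitrary coefficients are determined by their values on the coordinates. -/
theorem exists_coordinates {n : ℕ} (e : Fin n → Lie G) (L : Fin n → Module.Dual k (Lie G))
    (h1 : ∀ a b, L a (e b) = if a = b then 1 else 0) (h2 : ∀ ξ, ∑ a, L a ξ • e a = ξ) :
    ∃ c : Fin n → Stk G (unitPt G), (∀ a b, (e a).1 (c b) = if a = b then 1 else 0) ∧
      ∀ (R M : Type u) [CommRing R] [Algebra k R] [AddCommGroup M] [Module R M] [Module k M]
        [IsScalarTower k R M] (w : Stk G (unitPt G) →ₗ[k] M), IsDerAlong (evAlg G R) w →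
        ∀ f, w f = ∑ a, (e a).1 f • w (c a) := by
  let E := LinearEquiv.ofBijective (dualCotangent G) dualCotangent_bijective
  have hE : ∀ ξ f, E.symm ξ ((leibnizSpan G).mkQ f) = ξ.1 f := fun ξ f =>
    congr(($(E.apply_symm_apply ξ)).1 f)
  obtain ⟨c, hc, hc'⟩ := exists_predual_basis (fun a => E.symm (e a))
    (fun a => (L a).comp E.toLinearMap) (fun a b => by simpa using h1 a b)
    (fun ψ => by
      apply E.injective
      rw [map_sum]
      simpa using h2 (E ψ))
  choose c' hc'' using fun a => (leibnizSpan G).mkQ_surjective (c a)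
  refine ⟨c', fun a b => by rw [← hE, hc'', hc], ?_⟩
  intro R M _ _ _ _ _ _ w hw f
  have hw' := (isDerAlong_evAlg_iff w).mp hw
  have h3 : ∀ f, w f = (leibnizSpan G).liftQ w hw' ((leibnizSpan G).mkQ f) := fun f => by simp
  rw [h3, hc' ((leibnizSpan G).mkQ f), map_sum]
  refine Finset.sum_congr rfl fun a _ => ?_
  rw [map_smul, hE, ← hc'', ← h3]

end Frames

theorem isDerAlong_lie {k : Type u} [Field k] {G : Sch k} [GrpObj G] (R : Type u) [CommRing R]
    [Algebra k R] (ξ : Lie G) : IsDerAlong (evAlg G R) ((Algebra.linearMap k R).comp ξ.1) := by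
  intro f h
  refine (congrArg (algebraMap k R) (ξ.2 f h)).trans ?_
  rw [RingHom.map_add, RingHom.map_mul, RingHom.map_mul]
  rfl

section Translates
variable {k : Type u} [Field k] {G : Sch k} [GrpObj G] (g : G.left)
variable {M : Type u} [AddCommGroup M] [Module (Stk G g) M] [Module (Stk G g)ᵐᵒᵖ M]
  [IsCentralScalar (Stk G g) M] [Module k M] [IsScalarTower k (Stk G g) M]
  [IsScalarTower k (Stk G g)ᵐᵒᵖ M]
variable {M' : Type u} [AddCommGroup M'] [Module (Stk G g) M'] [Module (Stk G g)ᵐᵒᵖ M']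
  [IsCentralScalar (Stk G g) M'] [Module k M'] [IsScalarTower k (Stk G g) M']
  [IsScalarTower k (Stk G g)ᵐᵒᵖ M']

/-- The derivation `v` at `g` is the right translate of the tangent vector `w` at the unit. -/
def IsRightTranslate (w : Stk G (unitPt G) →ₗ[k] M) (v : Stk G g →ₗ[k] M) : Prop :=
  ∃ (hw : IsDerAlong (evAlg G (Stk G g)) w) (hv : IsDerAlong (AlgHom.id k (Stk G g)) v),
    expM w hw * (specMap (tszInl k (Stk G g) M) ≫ pt G g) = specMap (tszHom _ v hv) ≫ pt G g

variable {g}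

theorem IsRightTranslate.map {w : Stk G (unitPt G) →ₗ[k] M} {v : Stk G g →ₗ[k] M}
    (h : IsRightTranslate g w v) (θ : M →ₗ[Stk G g] M') :
    IsRightTranslate g ((θ.restrictScalars k).comp w) ((θ.restrictScalars k).comp v) := by
  obtain ⟨hw, hv, h⟩ := h
  refine ⟨hw.map θ, hv.map θ, ?_⟩
  rw [← tszMap_expM, ← tszMap_comp_tszHom hv, ← specMap_comp, Category.assoc, ← h, MonObj.comp_mul,
    ← Category.assoc (specMap _) (specMap _), specMap_comp, tszMap_comp_tszInl]

theorem IsRightTranslate.right_unique {w : Stk G (unitPt G) →ₗ[k] M} {v v' : Stk G g →ₗ[k] M}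
    (h : IsRightTranslate g w v) (h' : IsRightTranslate g w v') : v = v' := by
  obtain ⟨hw, hv, h⟩ := h
  obtain ⟨hw', hv', h'⟩ := h'
  exact tszHom_injective (specMap_pt_injective _ _ (h.symm.trans h'))

theorem IsRightTranslate.left_unique {w w' : Stk G (unitPt G) →ₗ[k] M} {v : Stk G g →ₗ[k] M}
    (h : IsRightTranslate g w v) (h' : IsRightTranslate g w' v) : w = w' := by
  obtain ⟨hw, hv, h⟩ := h
  obtain ⟨hw', hv', h'⟩ := h'
  exact expM_injective (mul_right_cancel (h.trans h'.symm))

/-- Every tangent vector at the unit has a right translate at `g`. -/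
theorem exists_isRightTranslate {w : Stk G (unitPt G) →ₗ[k] M}
    (hw : IsDerAlong (evAlg G (Stk G g)) w) : ∃ v, IsRightTranslate g w v := by
  have hloc : IsLocalHom (AlgHom.id k (Stk G g)).toRingHom := ⟨fun _ h => h⟩
  obtain ⟨v, hv, h⟩ := exists_eq_tszHom_pt (AlgHom.id k (Stk G g))
    (expM w hw * (specMap (tszInl k (Stk G g) M) ≫ pt G g)) (by
      rw [MonObj.comp_mul, tszFst_expM, one_mul, ← Category.assoc, specMap_comp,
        tszFst_comp_tszInl])
  exact ⟨v, hw, hv, h⟩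

/-- Every derivation at `g` is the right translate of a tangent vector at the unit. -/
theorem exists_eq_isRightTranslate {v : Stk G g →ₗ[k] M}
    (hv : IsDerAlong (AlgHom.id k (Stk G g)) v) : ∃ w, IsRightTranslate g w v := by
  obtain ⟨w, hw, h⟩ := exists_eq_expM (R := Stk G g) ((specMap (tszHom _ v hv) ≫ pt G g) *
    (specMap (tszInl k (Stk G g) M) ≫ pt G g)⁻¹) (by
      rw [MonObj.comp_mul, GrpObj.comp_inv, ← Category.assoc, specMap_comp, tszFst_comp_tszHom,
        ← Category.assoc, specMap_comp, tszFst_comp_tszInl, mul_inv_cancel])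
  exact ⟨w, hw, hv, by rw [← h, inv_mul_cancel_right]⟩

theorem isRightTranslate_zero : IsRightTranslate g (0 : Stk G (unitPt G) →ₗ[k] M) 0 := by
  refine ⟨isDerAlong_zero _, isDerAlong_zero _, ?_⟩
  rw [expM_zero, one_mul]
  congr 2
  apply AlgHom.ext
  intro f
  apply TrivSqZeroExt.ext <;> simp

theorem isRightTranslate_rightInv (ξ : Lie G) :
    IsRightTranslate g ((Algebra.linearMap k (Stk G g)).comp ξ.1) (rightInv g ξ).toLinearMap := by
  have hw := isDerAlong_lie (Stk G g) ξ
  have hv : IsDerAlong (AlgHom.id k (Stk G g)) (rightInv g ξ).toLinearMap :=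
    fun a b => (rightInv g ξ).leibniz a b
  refine ⟨hw, hv, ?_⟩
  have h1 := velocityFun_spec ((snd _ _ : specO k (Stk G g) ⊗ G ⟶ G) * (fst _ _ ≫ pt G g)) (by
    rw [MonObj.comp_mul, lift_snd, ← Category.assoc, lift_fst, Category.id_comp, one_mul]) ξ
  have h2 : expM _ hw = expPt (1 ⊗ₜ[k] ξ : Stk G g ⊗[k] Lie G) := by
    rw [expM, expPt]
    congr 2
    apply AlgHom.ext
    intro f
    apply TrivSqZeroExt.ext
    · simp [expHom, evAlg_apply]
    · simp [expHom, contract_tmul, Algebra.algebraMap_eq_smul_one]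
  rw [h2]
  refine Eq.trans ?_ h1.symm
  rw [orbitPt, MonObj.comp_mul, lift_snd, ← Category.assoc, lift_fst]
  rfl

end Translates

section Frames
variable {k : Type u} [Field k] {G : Sch k} [GrpObj G]

/-- The right-invariant vector fields of a basis of the Lie algebra form a frame: a derivation is a
point of `G` over a square-zero extension, and it differs from the constant point `g` by an
infinitesimal point at the unit. -/
theorem isFrame_rightInv {n : ℕ} (e : Fin n → Lie G) (L : Fin n → Module.Dual k (Lie G))
    (h1 : ∀ a b, L a (e b) = if a = b then 1 else 0) (h2 : ∀ ξ, ∑ a, L a ξ • e a = ξ)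
    (g : G.left) : IsFrame fun a => rightInv g (e a) := by
  obtain ⟨c, hc, hc'⟩ := exists_coordinates e L h1 h2
  -- The tangent vector `w₀` and the derivation `v₀` with values in `Bⁿ`, where `B = 𝒪_{G,g}`, are
  -- universal.
  let w₀ : Stk G (unitPt G) →ₗ[k] (Fin n → (Stk G g)) :=
    LinearMap.pi fun a => (Algebra.linearMap k (Stk G g)).comp (e a).1
  have hw₀ : IsDerAlong (evAlg G (Stk G g)) w₀ := by
    intro f h
    ext a
    exact isDerAlong_lie (Stk G g) (e a) f h
  obtain ⟨v₀, h0⟩ := exists_isRightTranslate (g := g) hw₀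
  have hv₀ : ∀ f a, v₀ f a = rightInv g (e a) f := by
    intro f a
    have := h0.map (LinearMap.proj (R := (Stk G g)) (φ := fun _ : Fin n => (Stk G g)) a)
    exact congr($(this.right_unique (isRightTranslate_rightInv (e a))) f)
  -- The homomorphism `Bⁿ → M` with `θ(w₀) = w` satisfies `θ(v₀) = v` if `w` corresponds to `v`.
  let θ {M : Type u} [AddCommGroup M] [Module (Stk G g) M] (m : Fin n → M) :
      (Fin n → (Stk G g)) →ₗ[(Stk G g)] M :=
    Fintype.linearCombination (Stk G g) m
  obtain ⟨m, hm⟩ : ∃ m : Fin n → Ω[Stk G g⁄k],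
      ∀ f, KaehlerDifferential.D k (Stk G g) f = ∑ a, rightInv g (e a) f • m a := by
    let _ : Module (Stk G g)ᵐᵒᵖ Ω[Stk G g⁄k] :=
      Module.compHom _ ((RingHom.id (Stk G g)).fromOpposite mul_comm)
    have _ : IsCentralScalar (Stk G g) Ω[Stk G g⁄k] := ⟨fun _ _ => rfl⟩
    have _ : IsScalarTower k (Stk G g)ᵐᵒᵖ Ω[Stk G g⁄k] := ⟨fun c b m => by
      change (MulOpposite.unop (c • b)) • m = c • (MulOpposite.unop b • m)
      rw [MulOpposite.unop_smul, smul_assoc]⟩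
    obtain ⟨w, hw⟩ := exists_eq_isRightTranslate (g := g)
      (v := (KaehlerDifferential.D k (Stk G g)).toLinearMap)
      (fun a b => (KaehlerDifferential.D k (Stk G g)).leibniz a b)
    have h3 := h0.map (θ fun a => w (c a))
    have h4 : ((θ fun a => w (c a)).restrictScalars k).comp w₀ = w := by
      ext f
      rw [hc' (Stk G g) _ w hw.choose f]
      simp [θ, w₀, Fintype.linearCombination_apply]
    rw [h4] at h3
    refine ⟨fun a => w (c a), fun f => (congr($(hw.right_unique h3) f)).trans ?_⟩
    simp [θ, Fintype.linearCombination_apply, hv₀]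
  have hind : ∀ m : Fin n → (Stk G g), (∀ f, ∑ a, rightInv g (e a) f • m a = 0) → m = 0 := by
    intro m hm
    have h3 := h0.map (θ m)
    have h4 : ((θ m).restrictScalars k).comp v₀ = 0 := by
      ext f
      have := hm f
      simpa [θ, Fintype.linearCombination_apply, hv₀] using this
    rw [h4] at h3
    have h5 := h3.left_unique isRightTranslate_zero
    ext b
    have := congr($h5 (c b))
    simpa [θ, w₀, Fintype.linearCombination_apply, hc] using this
  have hη : ∀ η : Ω[Stk G g⁄k], η = ∑ a, (rightInv g (e a)).liftKaehlerDifferential η • m a := by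
    intro η
    have hη : η ∈ Submodule.span (Stk G g) (Set.range (KaehlerDifferential.D k (Stk G g))) := by
      rw [KaehlerDifferential.span_range_derivation]; trivial
    induction hη using Submodule.span_induction with
    | mem η h =>
      obtain ⟨f, rfl⟩ := h
      simpa using hm f
    | zero => simp
    | add η η' _ _ h h' => simp only [map_add, add_smul, Finset.sum_add_distrib, ← h, ← h']
    | smul b η _ h =>
      simp only [map_smul, smul_assoc, ← Finset.smul_sum, ← h]
  constructor
  · intro η η' h
    rw [hη η, hη η']
    exact Finset.sum_congr rfl fun a _ => congrArg (· • m a) congr($h a)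
  · have hdual : ∀ b,
        (fun a => (rightInv g (e b)).liftKaehlerDifferential (m a)) = Pi.single b 1 := by
      intro b
      rw [← sub_eq_zero]
      refine hind _ fun f => ?_
      have h3 := congrArg (rightInv g (e b)).liftKaehlerDifferential (hm f)
      simp only [Derivation.liftKaehlerDifferential_comp_D, map_sum, map_smul] at h3
      simp only [Pi.sub_apply, smul_sub, Finset.sum_sub_distrib, ← h3]
      simp [Pi.single_apply]
    intro c
    refine ⟨∑ a, c a • m a, ?_⟩
    ext b
    have h3 : ∀ a, (rightInv g (e b)).liftKaehlerDifferential (m a) = if a = b then 1 else 0 :=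
      fun a => (congr($(hdual b) a)).trans (Pi.single_apply _ _ _)
    simp [frameMap, h3]

end Frames

/-! ### Étale morphisms and local rings -/

section Stalks
variable {k : Type u} [Field k] {X Y : Sch k} (φ : Y ⟶ X)

theorem flat_stkMap [Flat φ.left] (y : Y.left) : (stkMap φ y).toRingHom.Flat :=
  Flat.stalkMap φ.left y

theorem isLocalHom_stkMap (y : Y.left) : IsLocalHom (stkMap φ y).toRingHom :=
  φ.left.toLRSHom.prop y

theorem formallyEtale_stkMap [Etale φ.left] (y : Y.left) :
    (stkMap φ y).toRingHom.FormallyEtale := by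
  let _ : Algebra (Stk X (φ.left y)) (Stk Y y) := (stkMap φ y).toRingHom.toAlgebra
  have h1 : Algebra.FormallySmooth (Stk X (φ.left y)) (Stk Y y) := by
    have : (φ.left.stalkMap y).hom.FormallySmooth :=
      Scheme.Hom.mem_smoothLocus.mp (φ.left.smoothLocus_eq_top ▸ trivial)
    exact this
  have h2 : Algebra.FormallyUnramified (Stk X (φ.left y)) (Stk Y y) :=
    FormallyUnramified.stalkMap φ.left y
  exact Algebra.FormallyEtale.of_formallyUnramified_and_formallySmooth

theorem faithfullyFlat_stkMap [Flat φ.left] (y : Y.left) :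
    (stkMap φ y).toRingHom.FaithfullyFlat := by
  let _ : Algebra (Stk X (φ.left y)) (Stk Y y) := (stkMap φ y).toRingHom.toAlgebra
  have h1 : Module.Flat (Stk X (φ.left y)) (Stk Y y) := flat_stkMap φ y
  have h2 : IsLocalHom (algebraMap (Stk X (φ.left y)) (Stk Y y)) := isLocalHom_stkMap φ y
  exact Module.FaithfullyFlat.of_flat_of_isLocalHom

theorem stkMap_injective [Flat φ.left] (y : Y.left) : Function.Injective (stkMap φ y) := by
  let _ : Algebra (Stk X (φ.left y)) (Stk Y y) := (stkMap φ y).toRingHom.toAlgebra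
  have h1 : Module.FaithfullyFlat (Stk X (φ.left y)) (Stk Y y) := faithfullyFlat_stkMap φ y
  exact FaithfulSMul.algebraMap_injective (Stk X (φ.left y)) (Stk Y y)

/-- Frames descend along étale homomorphisms that are faithfully flat. -/
theorem isFrame_of_etale {A B : Type u} [CommRing A] [Algebra k A] [CommRing B] [Algebra k B]
    (ψ : A →ₐ[k] B) (h1 : ψ.toRingHom.FormallyEtale) (h2 : ψ.toRingHom.FaithfullyFlat) {n : ℕ}
    {v : Fin n → Derivation k A A} {w : Fin n → Derivation k B B}
    (h : ∀ a f, w a (ψ f) = ψ (v a f)) (hw : IsFrame w) : IsFrame v := by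
  let _ : Algebra A B := ψ.toRingHom.toAlgebra
  have _ : IsScalarTower k A B := IsScalarTower.of_algebraMap_eq' ψ.comp_algebraMap.symm
  have _ : Algebra.FormallyEtale A B := h1
  have _ : Module.FaithfullyFlat A B := h2
  have key : (TensorProduct.piScalarRight A B B (Fin n)).toLinearMap.comp
      ((frameMap v).baseChange B) =
      (frameMap w).comp
        (KaehlerDifferential.tensorKaehlerEquivOfFormallyEtale k A B).toLinearMap := by
    apply TensorProduct.AlgebraTensorModule.curry_injective
    ext f a
    have h5 : w a (algebraMap A B f) = algebraMap A B (v a f) := h a f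
    simp [frameMap, h5, Algebra.smul_def]
  have h3 : Function.Bijective ((frameMap v).baseChange B) := by
    have h4 : Function.Bijective ((frameMap w).comp
        (KaehlerDifferential.tensorKaehlerEquivOfFormallyEtale k A B).toLinearMap) :=
      hw.comp (LinearEquiv.bijective _)
    rw [← key] at h4
    exact (Function.Bijective.of_comp_iff' (LinearEquiv.bijective
      (TensorProduct.piScalarRight A B B (Fin n))) _).mp h4
  exact (Module.FaithfullyFlat.lTensor_bijective_iff_bijective A B (frameMap v)).mp h3

end Stalks

/-! ### Equivariance of infinitesimal actions -/

section Equivariance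
variable {k : Type u} [Field k] {N N' : Sch k} [GrpObj N] [GrpObj N'] (ι : N' ⟶ N) [IsMonHom ι]

/-- Infinitesimal actions are related by equivariant morphisms. -/
theorem infAct_stkMap {X Y : Sch k} [ModObj N X] [ModObj N' Y] (ψ : Y ⟶ X)
    (hψ : ∀ (Z : Sch k) (g : Z ⟶ N') (y : Z ⟶ Y), (g • y) ≫ ψ = (g ≫ ι) • (y ≫ ψ))
    (y : Y.left) (ξ : Lie N') (f : Stk X (ψ.left y)) :
    infAct y ξ (stkMap ψ y f) = stkMap ψ y (infAct (ψ.left y) (dLie ι ξ) f) := by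
  refine velocity_naturality ι ψ y _ _ ?_ ξ f
  rw [hψ, ModObj.comp_smul, Category.assoc, tensorHom_fst_assoc, stkMap_pt, tensorHom_snd]

theorem infAct_stkMap_rightInv {X : Sch k} [ModObj N X] (ψ : N' ⟶ X)
    (hψ : ∀ (Z : Sch k) (g y : Z ⟶ N'), (g * y) ≫ ψ = (g ≫ ι) • (y ≫ ψ))
    (y : N'.left) (ξ : Lie N') (f : Stk X (ψ.left y)) :
    rightInv y ξ (stkMap ψ y f) = stkMap ψ y (infAct (ψ.left y) (dLie ι ξ) f) := by
  refine velocity_naturality ι ψ y _ _ ?_ ξ f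
  rw [hψ, ModObj.comp_smul, Category.assoc, tensorHom_fst_assoc, stkMap_pt, tensorHom_snd]

end Equivariance

namespace GroupTriple
variable {k : Type u} [Field k] {T : GroupTriple k} (H : T.Quotient)

theorem Quotient.rightInv_stkMap_f (u : T.Gs.left) (η : Lie T.Gs) (f : Stk H.Q (H.f.left u)) :
    rightInv u η (stkMap H.f u f) = stkMap H.f u (infAct (H.f.left u) (dLie T.j η) f) := by
  refine infAct_stkMap_rightInv T.j H.f (fun Z g y => ?_) u η f
  rw [Quotient.f, ← Category.assoc, comp_mul_hom, H.map_mul, Category.assoc]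

theorem isFrame_rightInv (b : T.DualBases) (u : T.Gs.left) :
    IsFrame fun a => rightInv u (b.e a) :=
  MomentMap.isFrame_rightInv b.e
    (fun a => (T.form.flip (dLie T.i (b.x a))).comp (dLie T.j))
    (fun a c => (b.pairing c a).trans (by simp [eq_comm])) b.sum_e u

/-- The infinitesimal action of `𝔤^*` on `D/G` is a frame over the image of `G^*`. -/
theorem Quotient.isFrame_infAct (b : T.DualBases) (u : T.Gs.left) :
    IsFrame fun a => infAct (H.f.left u) (dLie T.j (b.e a)) :=
  isFrame_of_etale (stkMap H.f u) (formallyEtale_stkMap H.f u) (faithfullyFlat_stkMap H.f u)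
    (fun a f => H.rightInv_stkMap_f u (b.e a) f) (isFrame_rightInv b u)

end GroupTriple

/-! ### The moment map condition as a formula for the bracket -/

theorem pullForm_smul {k : Type u} [Field k] {A B : Type u} [CommRing A] [Algebra k A] [CommRing B]
    [Algebra k B] (φ : B →ₐ[k] A) (b : B) (ω : Ω[B⁄k]) :
    pullForm φ (b • ω) = φ b • pullForm φ ω := by
  let _ : Algebra B A := φ.toRingHom.toAlgebra
  have _ : IsScalarTower k B A := IsScalarTower.of_algebraMap_eq' φ.comp_algebraMap.symm
  have h1 : KaehlerDifferential.map k k B A (b • ω) = φ b • KaehlerDifferential.map k k B A ω := by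
    rw [map_smul]
    rfl
  exact h1

theorem pullForm_D {k : Type u} [Field k] {A B : Type u} [CommRing A] [Algebra k A] [CommRing B]
    [Algebra k B] (φ : B →ₐ[k] A) (b : B) :
    pullForm φ (KaehlerDifferential.D k B b) = KaehlerDifferential.D k A (φ b) := by
  have h1 := pullForm_apply φ 1 b
  rwa [one_smul, map_one, one_smul] at h1

theorem liftKaehlerDifferential_add {k A M : Type u} [Field k] [CommRing A] [Algebra k A]
    [AddCommGroup M] [Module k M] [Module A M] [IsScalarTower k A M] (v w : Derivation k A M) :
    (v + w).liftKaehlerDifferential = v.liftKaehlerDifferential + w.liftKaehlerDifferential :=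
  Derivation.liftKaehlerDifferential_unique _ _ (by ext f; simp)

theorem derivation_sum_apply {k A M : Type u} [Field k] [CommRing A] [Algebra k A]
    [AddCommGroup M] [Module k M] [Module A M] {n : ℕ} (v : Fin n → Derivation k A M) (f : A) :
    (∑ a, v a) f = ∑ a, v a f :=
  (congrFun (map_sum Derivation.coeFnAddMonoidHom v Finset.univ) f).trans (Finset.sum_apply _ _ _)

theorem liftKaehlerDifferential_sub {k A M : Type u} [Field k] [CommRing A] [Algebra k A]
    [AddCommGroup M] [Module k M] [Module A M] [IsScalarTower k A M] (v w : Derivation k A M) :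
    (v - w).liftKaehlerDifferential = v.liftKaehlerDifferential - w.liftKaehlerDifferential :=
  Derivation.liftKaehlerDifferential_unique _ _ (by ext f; simp)

theorem liftKaehlerDifferential_smul {k A M : Type u} [Field k] [CommRing A] [Algebra k A]
    [AddCommGroup M] [Module k M] [Module A M] [IsScalarTower k A M] (c : k)
    (v : Derivation k A M) (ω : Ω[A⁄k]) :
    (c • v).liftKaehlerDifferential ω = c • v.liftKaehlerDifferential ω := by
  have h : (c • v).liftKaehlerDifferential = algebraMap k A c • v.liftKaehlerDifferential :=
    Derivation.liftKaehlerDifferential_unique _ _ (by ext f; simp)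
  rw [h, LinearMap.smul_apply, algebraMap_smul]

/-- Relations of the form `V(φ^* ω) = ∑ φ^*(v_a(ω)) V_a` hold if they hold for exact forms. -/
theorem liftKaehlerDifferential_pullForm {k : Type u} [Field k] {A B : Type u} [CommRing A]
    [Algebra k A] [CommRing B] [Algebra k B] {M : Type u} [AddCommGroup M] [Module k M] [Module A M]
    [IsScalarTower k A M] (φ : B →ₐ[k] A) {n : ℕ} (V : Derivation k A M)
    (v : Fin n → Derivation k B B) (W : Fin n → M)
    (h : ∀ f, V (φ f) = ∑ a, φ (v a f) • W a) (ω : Ω[B⁄k]) :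
    V.liftKaehlerDifferential (pullForm φ ω) =
      ∑ a, φ ((v a).liftKaehlerDifferential ω) • W a := by
  have hω : ω ∈ Submodule.span B (Set.range (KaehlerDifferential.D k B)) := by
    rw [KaehlerDifferential.span_range_derivation]; trivial
  induction hω using Submodule.span_induction with
  | mem η h' =>
    obtain ⟨f, rfl⟩ := h'
    rw [pullForm_D]
    simpa using h f
  | zero => simp
  | add η η' _ _ h h' => simp only [map_add, h, h', add_smul, Finset.sum_add_distrib]
  | smul c η _ h =>
    simp only [pullForm_smul, map_smul, h, smul_eq_mul, map_mul, mul_smul, Finset.smul_sum]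

/-- The values of a differential form on a linear family of vector fields. -/
def evalForm {k A V : Type u} [Field k] [CommRing A] [Algebra k A] [AddCommMonoid V] [Module k V]
    (v : V →ₗ[k] Derivation k A A) (ω : Ω[A⁄k]) : V →ₗ[k] A where
  toFun η := (v η).liftKaehlerDifferential ω
  map_add' η η' := by
    rw [map_add, liftKaehlerDifferential_add, LinearMap.add_apply]
  map_smul' c η := by
    rw [map_smul, liftKaehlerDifferential_smul, RingHom.id_apply]

namespace GroupTriple
variable {k : Type u} [Field k] {T : GroupTriple k} (H : T.Quotient) (P : T.PoissonVariety)

theorem infAct_mu {μ : P.X ⟶ H.Q} (hμ : IsEquivariant H P μ) (x : P.X.left) (ξ : Lie T.G)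
    (f : Stk H.Q (μ.left x)) :
    infAct x ξ (stkMap μ x f) = stkMap μ x (infAct (μ.left x) (dLie T.i ξ) f) :=
  infAct_stkMap T.i μ hμ x ξ f

variable {P} in
/-- The formula `{μ^* f, h} = ∑ μ^*(xᵃ f) x_a(h)` at a point `x` of `X`. It makes sense at all
points, without a condition of admissibility, and does not involve a choice of complement of `𝔤`
other than `𝔤^*`. -/
def BracketFormula (b : T.DualBases) (μ : P.X ⟶ H.Q) (x : P.X.left) : Prop :=
  ∀ f : Stk H.Q (μ.left x), P.poisson.bracket x (stkMap μ x f) =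
    ∑ a, stkMap μ x (infAct (μ.left x) (dLie T.j (b.e a)) f) • infAct x (b.x a)

theorem contractTwist_tmul (ξ χ : Lie T.G) (η : Lie T.D) :
    T.contractTwist (ξ ⊗ₜ[k] χ) η = T.form η (dLie T.i χ) • ξ := by
  simp [contractTwist]

theorem biTensor_tmul {V W A : Type u} [AddCommMonoid V] [Module k V] [AddCommMonoid W] [Module k W]
    [CommRing A] [Algebra k A] (a : V →ₗ[k] Derivation k A A) (b : W →ₗ[k] Derivation k A A)
    (v : V) (w : W) : biTensor a b (v ⊗ₜ[k] w) = tensorDer (a v) (b w) := by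
  simp [biTensor]

/-- The bracket formula at `x` implies the moment map condition at `x` for all complements: the
terms of the twist `t` in the form `⟨θ^𝔥, ξ⟩` and in the bracket `π^𝔥` cancel. -/
theorem BracketFormula.eq_twisted {b : T.DualBases} {μ : P.X ⟶ H.Q} (hμ : IsEquivariant H P μ)
    {x : P.X.left} (hx : BracketFormula H b μ x) {𝔥 : Submodule k (Lie T.D)}
    {t : Lie T.G ⊗[k] Lie T.G} (ht : T.IsTwist 𝔥 t) {ξ : Lie T.G} {ω : Ω[(Stk H.Q (μ.left x))⁄k]}
    (hω : H.IsComplementForm 𝔥 (μ.left x) ξ ω) :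
    infAct x ξ = (P.twistedBracket t x).liftKaehlerDifferential (pullForm (stkMap μ x) ω) := by
  let Λ := evalForm (infAct (G := T.D) (μ.left x)) ω
  have h1 : (P.poisson.bracket x).liftKaehlerDifferential (pullForm (stkMap μ x) ω) =
      ∑ a, stkMap μ x (Λ (dLie T.j (b.e a))) • infAct x (b.x a) :=
    liftKaehlerDifferential_pullForm _ _ _ _ hx ω
  have h2 : ∀ t : Lie T.G ⊗[k] Lie T.G,
      (biTensor (infAct x) (infAct x) t).liftKaehlerDifferential (pullForm (stkMap μ x) ω) =
      ∑ a, stkMap μ x (Λ (dLie T.i (T.contractTwist t (dLie T.j (b.e a))))) • infAct x (b.x a) := by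
    intro t
    induction t with
    | zero =>
      have h3 : (0 : BiDer k (Stk P.X x)).liftKaehlerDifferential = 0 :=
        Derivation.liftKaehlerDifferential_unique _ _ (by ext f; simp)
      simp only [map_zero, h3, LinearMap.zero_apply, contractTwist, zero_smul,
        Finset.sum_const_zero]
    | tmul ξ χ =>
      have h3 : (tensorDer (infAct x ξ) (infAct x χ)).liftKaehlerDifferential
          (pullForm (stkMap μ x) ω) = ∑ _a : Fin 1,
            stkMap μ x (Λ (dLie T.i ξ)) • infAct x χ :=
        liftKaehlerDifferential_pullForm _ _ (fun _ => infAct (μ.left x) (dLie T.i ξ))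
          (fun _ => infAct x χ) (fun f => by
            ext h
            simp [tensorDer_apply, infAct_mu H P hμ]) ω
      rw [biTensor_tmul, h3, Fin.sum_univ_one]
      conv_lhs => rw [← b.sum_x χ]
      simp only [map_sum, Finset.smul_sum, contractTwist_tmul, map_smul, smul_assoc]
      refine Finset.sum_congr rfl fun a _ => ?_
      rw [smul_comm]
    | add t t' h h' =>
      simp only [map_add, liftKaehlerDifferential_add, LinearMap.add_apply, h, h', contractTwist,
        add_smul, Finset.sum_add_distrib]
  have h3 : ∀ a, Λ (dLie T.j (b.e a)) =
      algebraMap k _ (T.form (dLie T.j (b.e a)) (dLie T.i ξ)) +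
        Λ (dLie T.i (T.contractTwist t (dLie T.j (b.e a)))) := by
    intro a
    have h4 := hω _ (ht _ ⟨b.e a, rfl⟩)
    have h5 : T.form (dLie T.j (b.e a) - dLie T.i (T.contractTwist t (dLie T.j (b.e a))))
        (dLie T.i ξ) = T.form (dLie T.j (b.e a)) (dLie T.i ξ) := by
      conv_rhs => rw [← sub_add_cancel (dLie T.j (b.e a))
        (dLie T.i (T.contractTwist t (dLie T.j (b.e a))))]
      rw [map_add, LinearMap.add_apply, form_dLie_i, add_zero]
    rw [h5] at h4
    rw [← h4]
    conv_lhs => rw [← sub_add_cancel (dLie T.j (b.e a))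
        (dLie T.i (T.contractTwist t (dLie T.j (b.e a))))]
    rw [map_add]
    rfl
  rw [PoissonVariety.twistedBracket, liftKaehlerDifferential_sub, LinearMap.sub_apply, h1, h2]
  simp only [h3, map_add, add_smul, Finset.sum_add_distrib, add_sub_cancel_right]
  conv_lhs => rw [← b.sum_x ξ, map_sum]
  refine Finset.sum_congr rfl fun a _ => ?_
  rw [map_smul, AlgHom.commutes, algebraMap_smul]

/-- A linear form on `𝔤^*` that takes the values of `x_a` on the dual basis is the pairing with
`x_a`. -/
theorem DualBases.eq_algebraMap_form (b : T.DualBases) {A : Type u} [CommRing A] [Algebra k A]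
    (L : Lie T.Gs →ₗ[k] A) {a : Fin b.n} (hL : ∀ c, L (b.e c) = if c = a then 1 else 0)
    (η : Lie T.Gs) : L η = algebraMap k A (T.form (dLie T.j η) (dLie T.i (b.x a))) := by
  conv_lhs => rw [← b.sum_e η]
  simp only [map_sum, map_smul]
  simp [hL, Algebra.algebraMap_eq_smul_one]

/-- The complement `𝔤^*` has twist zero. -/
theorem isTwist_zero : T.IsTwist T.lieGs 0 := by
  intro η hη
  have h : T.contractTwist 0 η = 0 := by simp [contractTwist]
  have h1 : η - dLie T.i (T.contractTwist 0 η) = η := by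
    conv_rhs => rw [← sub_add_cancel η (dLie T.i (T.contractTwist 0 η))]
    rw [h, map_zero, add_zero]
  rw [h1]
  exact hη

/-- On the image of `G^*`, the complement `𝔤^*` is admissible. -/
theorem Quotient.isAdmissible_lieGs (b : T.DualBases) (u : T.Gs.left) :
    H.IsAdmissible T.lieGs (H.f.left u) := by
  obtain ⟨ω, hω, hω'⟩ := (H.isFrame_infAct b u).exists_dual
  let κ := IsLocalRing.ResidueField (Stk H.Q (H.f.left u))
  let E (a) : T.lieGs := ⟨dLie T.j (b.e a), ⟨b.e a, rfl⟩⟩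
  have hE : ∀ a (g : Stk H.Q (H.f.left u)), H.tangentAction T.lieGs (H.f.left u) (E a) g =
      algebraMap _ κ (infAct (H.f.left u) (dLie T.j (b.e a)) g) := fun a g => rfl
  have hsum : ∀ d : Derivation k (Stk H.Q (H.f.left u)) κ, ∀ g, d g =
      ∑ a, d.liftKaehlerDifferential (ω a) •
        algebraMap _ κ (infAct (H.f.left u) (dLie T.j (b.e a)) g) := by
    intro d g
    rw [← d.liftKaehlerDifferential_comp_D, hω' (KaehlerDifferential.D k _ g), map_sum]
    refine Finset.sum_congr rfl fun a _ => ?_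
    rw [map_smul, Derivation.liftKaehlerDifferential_comp_D, smul_eq_mul, mul_comm,
      Algebra.smul_def]
  have hlift : ∀ a c, (H.tangentAction T.lieGs (H.f.left u) (E a)).liftKaehlerDifferential (ω c) =
      if a = c then 1 else 0 := by
    intro a c
    have h1 : (H.tangentAction T.lieGs (H.f.left u) (E a)).liftKaehlerDifferential =
        (Algebra.linearMap _ κ).comp
          (infAct (H.f.left u) (dLie T.j (b.e a))).liftKaehlerDifferential :=
      Derivation.liftKaehlerDifferential_unique _ _ (by ext g; simp [hE])
    rw [h1, LinearMap.comp_apply, hω]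
    split_ifs <;> simp
  have hspan : ∀ t : κ ⊗[k] T.lieGs, ∃ c : Fin b.n → κ, t = ∑ a, c a ⊗ₜ[k] E a := by
    intro t
    induction t with
    | zero => exact ⟨0, by simp⟩
    | tmul c η =>
      obtain ⟨_, ⟨η, rfl⟩⟩ := η
      refine ⟨fun a => T.form (dLie T.j η) (dLie T.i (b.x a)) • c, ?_⟩
      simp only [TensorProduct.smul_tmul, ← TensorProduct.tmul_sum]
      congr 1
      apply Subtype.ext
      have h1 := congrArg (dLie T.j) (b.sum_e η)
      rw [map_sum] at h1
      simp only [map_smul] at h1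
      refine h1.symm.trans ?_
      simp [E]
    | add t t' h h' =>
      obtain ⟨c, rfl⟩ := h
      obtain ⟨c', rfl⟩ := h'
      exact ⟨c + c', by simp [TensorProduct.add_tmul, Finset.sum_add_distrib]⟩
  constructor
  · intro t t' htt
    obtain ⟨c, rfl⟩ := hspan t
    obtain ⟨c', rfl⟩ := hspan t'
    have h1 : ∀ c : Fin b.n → κ, ∀ a, (LinearMap.liftBaseChange κ
        (H.tangentAction T.lieGs (H.f.left u))
          (∑ a, c a ⊗ₜ[k] E a)).liftKaehlerDifferential (ω a) = c a := by
      intro c a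
      have h2 : (LinearMap.liftBaseChange κ (H.tangentAction T.lieGs (H.f.left u))
          (∑ a, c a ⊗ₜ[k] E a)).liftKaehlerDifferential =
          ∑ a, c a • (H.tangentAction T.lieGs (H.f.left u) (E a)).liftKaehlerDifferential :=
        Derivation.liftKaehlerDifferential_unique _ _ (by
          ext g
          simp [derivation_sum_apply])
      rw [h2]
      simp [hlift]
    congr 1
    ext a
    rw [← h1 c, htt, h1]
  · intro d
    refine ⟨∑ a, d.liftKaehlerDifferential (ω a) ⊗ₜ E a, ?_⟩
    ext g
    rw [hsum d g, map_sum]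
    simp [derivation_sum_apply, hE]

/-- The moment map condition for `𝔤^*` implies the bracket formula over the image of `G^*`. -/
theorem IsAKSMomentMap.bracketFormula (b : T.DualBases) {μ : P.X ⟶ H.Q}
    (h : IsAKSMomentMap H P μ) (x : P.X.left) (hx : μ.left x ∈ Set.range H.f.left) :
    BracketFormula H b μ x := by
  have hfr : IsFrame fun a => infAct (μ.left x) (dLie T.j (b.e a)) := by
    obtain ⟨u, hu⟩ := hx
    rw [← hu]
    exact H.isFrame_infAct b u
  obtain ⟨ω, hω, hω'⟩ := hfr.exists_dual
  have key : ∀ a, infAct x (b.x a) =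
      (P.poisson.bracket x).liftKaehlerDifferential (pullForm (stkMap μ x) (ω a)) := by
    intro a
    have h1 := h T.lieGs ⟨T.lagrangian_Gs, T.isCompl⟩ 0 isTwist_zero
      ⟨Set.range H.f.left, H.f.left.isOpenMap.isOpen_range⟩ (by
        rintro _ ⟨u, rfl⟩
        exact H.isAdmissible_lieGs b u) x hx (b.x a) (ω a) (by
        rintro _ ⟨η, rfl⟩
        exact b.eq_algebraMap_form ((evalForm (infAct (G := T.D) (μ.left x)) (ω a)).comp (dLie T.j))
          (fun c => hω c a) η)
    rw [h1, PoissonVariety.twistedBracket, map_zero, sub_zero]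
  intro f
  rw [← Derivation.liftKaehlerDifferential_comp_D, ← pullForm_D,
    hω' (KaehlerDifferential.D k _ f), map_sum, map_sum]
  refine Finset.sum_congr rfl fun a _ => ?_
  rw [Derivation.liftKaehlerDifferential_comp_D, pullForm_smul, map_smul, key]

end GroupTriple

/-! ### Lifting vector fields and brackets along étale morphisms -/

section Lifting
variable {k : Type u} [Field k]

/-- Derivations extend uniquely along formally étale homomorphisms. -/
theorem existsUnique_derivation_of_formallyEtale {A B M : Type u} [CommRing A] [Algebra k A]
    [CommRing B] [Algebra k B] [AddCommGroup M] [Module B M] [Module k M] [IsScalarTower k B M]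
    (ψ : A →ₐ[k] B) (hψ : ψ.toRingHom.FormallyEtale) (v : A →ₗ[k] M) (hv : IsDerAlong ψ v) :
    ∃! w : Derivation k B M, ∀ a, w (ψ a) = v a := by
  let _ : Algebra A B := ψ.toRingHom.toAlgebra
  have _ : IsScalarTower k A B := IsScalarTower.of_algebraMap_eq' ψ.comp_algebraMap.symm
  let _ : Module A M := Module.compHom M ψ.toRingHom
  have _ : IsScalarTower A B M := ⟨fun a b m => by
    rw [Algebra.smul_def, mul_smul]; rfl⟩
  have _ : IsScalarTower k A M := ⟨fun c a m => by
    change ψ (c • a) • m = c • (ψ a • m)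
    rw [map_smul, smul_assoc]⟩
  have _ : Algebra.FormallyEtale A B := hψ
  let d : Derivation k A M := Derivation.mk' v fun a b => hv a b
  let e := KaehlerDifferential.tensorKaehlerEquivOfFormallyEtale k A B
  let w : Derivation k B M :=
    ((d.liftKaehlerDifferential.liftBaseChange B).comp e.symm.toLinearMap).compDer
      (KaehlerDifferential.D k B)
  have hw : ∀ a, w (algebraMap A B a) = v a := by
    intro a
    have h1 : e.symm (KaehlerDifferential.D k B (algebraMap A B a)) =
        1 ⊗ₜ KaehlerDifferential.D k A a :=
      KaehlerDifferential.tensorKaehlerEquivOfFormallyEtale_symm_D_algebraMap k A B a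
    change d.liftKaehlerDifferential.liftBaseChange B
      (e.symm (KaehlerDifferential.D k B (algebraMap A B a))) = v a
    rw [h1, LinearMap.liftBaseChange_tmul, Derivation.liftKaehlerDifferential_comp_D, one_smul]
    rfl
  refine ⟨w, hw, fun w' hw' => ?_⟩
  have h2 : w'.liftKaehlerDifferential.comp e.toLinearMap =
      w.liftKaehlerDifferential.comp e.toLinearMap := by
    apply TensorProduct.AlgebraTensorModule.curry_injective
    ext a
    have h3 : e (1 ⊗ₜ KaehlerDifferential.D k A a) =
        KaehlerDifferential.D k B (algebraMap A B a) := by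
      simp [e]
    have h4 : w' (algebraMap A B a) = w (algebraMap A B a) := (hw' a).trans (hw a).symm
    simpa [h3] using h4
  ext b
  have h5 := congr($h2 (e.symm (KaehlerDifferential.D k B b)))
  simpa using h5

variable {X Y : Sch k} (φ : Y ⟶ X) [Etale φ.left]

theorem derivation_ext_of_etale {y : Y.left} {M : Type u} [AddCommGroup M] [Module (Stk Y y) M]
    [Module k M] [IsScalarTower k (Stk Y y) M] {v w : Derivation k (Stk Y y) M}
    (h : ∀ a, v (stkMap φ y a) = w (stkMap φ y a)) : v = w := by
  have h1 : IsDerAlong (stkMap φ y) (w.toLinearMap.comp (stkMap φ y).toLinearMap) := by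
    intro a b
    simp
  exact (existsUnique_derivation_of_formallyEtale (stkMap φ y) (formallyEtale_stkMap φ y) _
    h1).unique h fun _ => rfl

theorem existsUnique_fieldRelated (w : GermField X) : ∃! v : GermField Y, FieldRelated φ v w := by
  have h : ∀ y, ∃! v : Derivation k (Stk Y y) (Stk Y y), ∀ a,
      v (stkMap φ y a) = (stkMap φ y).toLinearMap.comp (w (φ.left y)).toLinearMap a := fun y =>
    existsUnique_derivation_of_formallyEtale (stkMap φ y) (formallyEtale_stkMap φ y) _
      fun a b => by simp
  choose v hv hu using h
  exact ⟨v, hv, fun v' hv' => funext fun y => hu y _ (hv' y)⟩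

theorem existsUnique_fieldRelated_family {I : Type u} (w : I → GermField X) :
    ∃! v : I → GermField Y, ∀ ξ, FieldRelated φ (v ξ) (w ξ) := by
  choose v hv hu using fun ξ => existsUnique_fieldRelated φ (w ξ)
  exact ⟨v, hv, fun v' hv' => funext fun ξ => hu ξ _ (hv' ξ)⟩

theorem existsUnique_bracketRelated (γ : GermBracket X) :
    ∃! β : GermBracket Y, BracketRelated φ β γ := by
  have h : ∀ y, ∃! β : BiDer k (Stk Y y), ∀ f h, β (stkMap φ y f) (stkMap φ y h) =
      stkMap φ y (γ (φ.left y) f h) := by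
    intro y
    have h1 : ∀ f, ∃! v : Derivation k (Stk Y y) (Stk Y y), ∀ a,
        v (stkMap φ y a) = (stkMap φ y).toLinearMap.comp (γ (φ.left y) f).toLinearMap a := fun f =>
      existsUnique_derivation_of_formallyEtale (stkMap φ y) (formallyEtale_stkMap φ y) _
        fun a b => by simp
    choose v hv hu using h1
    have hv' : ∀ f h, v f (stkMap φ y h) = stkMap φ y (γ (φ.left y) f h) := hv
    let L : Stk X (φ.left y) →ₗ[k] Derivation k (Stk Y y) (Stk Y y) :=
      { toFun := v
        map_add' := fun f f' => derivation_ext_of_etale φ fun a => by simp [hv']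
        map_smul' := fun c f => derivation_ext_of_etale φ fun a => by simp [hv'] }
    obtain ⟨β, hβ, hβu⟩ := existsUnique_derivation_of_formallyEtale (stkMap φ y)
      (formallyEtale_stkMap φ y) L
      fun f f' => derivation_ext_of_etale φ fun a => by simp [L, hv']
    refine ⟨β, fun f h => ?_, fun β' hβ' => hβu _ fun f => ?_⟩
    · rw [hβ]; exact hv' f h
    · exact derivation_ext_of_etale φ fun a => (hβ' f a).trans (hv' f a).symm
  choose β hβ hu using h
  exact ⟨β, hβ, fun β' hβ' => funext fun y => hu y _ (hβ' y)⟩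

/-- The biderivation `(f, h) ↦ {h, f}`. -/
def BiDer.flip {A : Type u} [CommRing A] [Algebra k A] (β : BiDer k A) : BiDer k A :=
  Derivation.mk'
    { toFun := fun f => Derivation.mk'
        { toFun := fun h => β h f
          map_add' := fun h h' => by simp
          map_smul' := fun c h => by simp }
        (fun h h' => by simp)
      map_add' := fun f f' => by ext h; simp
      map_smul' := fun c f => by ext h; simp }
    (fun f f' => by ext h; simp)

theorem BiDer.flip_apply {A : Type u} [CommRing A] [Algebra k A] (β : BiDer k A) (f h : A) :
    β.flip f h = β h f := rfl

/-- Biderivations are determined by the brackets of functions pulled back along an étale morphism.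
-/
theorem biDer_ext_of_etale {y : Y.left} {β γ : BiDer k (Stk Y y)}
    (h : ∀ a b, β (stkMap φ y a) (stkMap φ y b) = γ (stkMap φ y a) (stkMap φ y b)) : β = γ :=
  derivation_ext_of_etale φ fun a => derivation_ext_of_etale φ fun b => h a b

theorem skew_of_alternating {A : Type u} [CommRing A] [Algebra k A] {β : BiDer k A}
    (h : ∀ f, β f f = 0) (f g : A) : β f g = -β g f := by
  have := h (f + g)
  simp only [map_add, Derivation.add_apply, h, zero_add, add_zero] at this
  exact eq_neg_of_add_eq_zero_right this

/-- The biderivation `β(f, h) + β(h, f)` vanishes since it does so on functions pulled back from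
`X`. This gives `2 β(f, f) = 0`, and `2` is invertible. -/
theorem alternating_of_etale (hk : (2 : k) ≠ 0) {β : GermBracket Y} {γ : GermBracket X}
    (h : BracketRelated φ β γ) (hγ : ∀ x f, γ x f f = 0) (y : Y.left) (f : Stk Y y) :
    β y f f = 0 := by
  have h1 : β y + (β y).flip = 0 := biDer_ext_of_etale φ fun a b => by
    have h2 := skew_of_alternating (hγ (φ.left y)) a b
    simp only [Derivation.add_apply, BiDer.flip_apply, Derivation.zero_apply, h y a b, h y b a, h2,
      map_neg, neg_add_cancel]
  have h2 : (2 : k) • β y f f = 0 := by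
    rw [two_smul]
    exact congr($h1 f f)
  exact (smul_eq_zero_iff_right hk).mp h2

/-- The Jacobi identity lifts along étale morphisms, since the Jacobi sum of an alternating
biderivation is a derivation in each of its arguments. -/
theorem jacobi_of_etale {β : GermBracket Y} {γ : GermBracket X} (hφ : BracketRelated φ β γ)
    (hβ : ∀ y f, β y f f = 0)
    (hγ : ∀ x f g h, γ x f (γ x g h) + γ x g (γ x h f) + γ x h (γ x f g) = 0) (y : Y.left)
    (f g h : Stk Y y) :
    β y f (β y g h) + β y g (β y h f) + β y h (β y f g) = 0 := by
  let J (f g h : Stk Y y) : Stk Y y := β y f (β y g h) + β y g (β y h f) + β y h (β y f g)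
  have hskew := skew_of_alternating (hβ y)
  -- The Jacobi sum is a derivation in its last argument, and it is invariant under cyclic
  -- permutations, so that the arguments can be replaced by arbitrary germs one after the other.
  have hJ : ∀ f g h, J f g h = (⁅β y f, β y g⁆ - β y (β y f g)) h := by
    intro f g h
    simp only [J, Derivation.sub_apply, Derivation.commutator_apply]
    rw [hskew h f, hskew h (β y f g), map_neg]
    ring
  have hcyc : ∀ f g h, J f g h = J g h f := by
    intro f g h
    simp only [J]
    ring
  have hext : ∀ f g, (∀ c, J f g (stkMap φ y c) = 0) → ∀ h, J f g h = 0 := by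
    intro f g hc h
    have h1 : ⁅β y f, β y g⁆ - β y (β y f g) = 0 :=
      derivation_ext_of_etale φ fun c => by rw [← hJ]; exact hc c
    rw [hJ, h1]
    rfl
  have h0 : ∀ a b c, J (stkMap φ y a) (stkMap φ y b) (stkMap φ y c) = 0 := by
    intro a b c
    simp only [J, hφ y, ← map_add, hγ, map_zero]
  have h1 : ∀ a b h, J (stkMap φ y a) (stkMap φ y b) h = 0 := fun a b => hext _ _ (h0 a b)
  have h2 : ∀ a g h, J (stkMap φ y a) g h = 0 := by
    intro a g h
    rw [hcyc, hcyc]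
    exact hext _ _ (fun b => by rw [hcyc]; exact h1 a b h) g
  rw [show β y f (β y g h) + β y g (β y h f) + β y h (β y f g) = J f g h from rfl, hcyc]
  exact hext _ _ (fun a => by rw [hcyc, hcyc]; exact h2 a g h) f

end Lifting

/-! ### Regularity of lifted brackets -/

section Regular

/-- A family of germs on `V` is regular if it is locally given by a section. -/
def IsRegularFamily {Y : Scheme.{u}} {V : Y.Opens} (s : ∀ y : V, Y.presheaf.stalk y.1) : Prop :=
  ∀ y : V, ∃ (W : Y.Opens) (_ : y.1 ∈ W) (hW : W ≤ V) (g : Γ(Y, W)),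
    ∀ (z : Y) (hz : z ∈ W), s ⟨z, hW hz⟩ = Y.presheaf.germ W z hz g

variable {Y : Scheme.{u}} {V : Y.Opens}

theorem isRegularFamily_zero : IsRegularFamily (fun y : V => (0 : Y.presheaf.stalk y.1)) :=
  fun y => ⟨V, y.2, le_rfl, 0, fun _ _ => (map_zero _).symm⟩

theorem IsRegularFamily.add {s s' : ∀ y : V, Y.presheaf.stalk y.1} (h : IsRegularFamily s)
    (h' : IsRegularFamily s') : IsRegularFamily (fun y => s y + s' y) := by
  intro y
  obtain ⟨W, hy, hW, g, hg⟩ := h y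
  obtain ⟨W', hy', hW', g', hg'⟩ := h' y
  refine ⟨W ⊓ W', ⟨hy, hy'⟩, inf_le_left.trans hW,
    Y.presheaf.map (homOfLE inf_le_left).op g + Y.presheaf.map (homOfLE inf_le_right).op g', ?_⟩
  intro z hz
  rw [map_add, TopCat.Presheaf.germ_res_apply, TopCat.Presheaf.germ_res_apply]
  exact congrArg₂ (· + ·) (hg z hz.1) (hg' z hz.2)

theorem IsRegularFamily.mul {s : ∀ y : V, Y.presheaf.stalk y.1} (h : IsRegularFamily s)
    (f : Γ(Y, V)) : IsRegularFamily (fun y => Y.presheaf.germ V y.1 y.2 f * s y) := by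
  intro y
  obtain ⟨W, hy, hW, g, hg⟩ := h y
  refine ⟨W, hy, hW, Y.presheaf.map (homOfLE hW).op f * g, ?_⟩
  intro z hz
  rw [map_mul, TopCat.Presheaf.germ_res_apply]
  exact congrArg (_ * ·) (hg z hz)

/-- For a ring `S` of sections that is formally unramified over a ring `R`, a derivation of `S` with
values in families of germs is regular if it is so on `R`, since it is a derivation over `R`
modulo regular families. -/
theorem isRegularFamily_of_formallyUnramified {R : Type u} [CommRing R] (ψ : R →+* Γ(Y, V))
    (hψ : ψ.FormallyUnramified) (d : Γ(Y, V) → ∀ y : V, Y.presheaf.stalk y.1)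
    (hadd : ∀ f f', d (f + f') = d f + d f')
    (hmul : ∀ f f', d (f * f') = fun y => Y.presheaf.germ V y.1 y.2 f * d f' y +
      Y.presheaf.germ V y.1 y.2 f' * d f y)
    (hreg : ∀ r, IsRegularFamily (d (ψ r))) (f : Γ(Y, V)) : IsRegularFamily (d f) := by
  let _ : Algebra R Γ(Y, V) := ψ.toAlgebra
  have _ : Algebra.FormallyUnramified R Γ(Y, V) := hψ
  let _ : ∀ y : V, Module Γ(Y, V) (Y.presheaf.stalk y.1) := fun y =>
    Module.compHom _ (Y.presheaf.germ V y.1 y.2).hom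
  let N : Submodule Γ(Y, V) (∀ y : V, Y.presheaf.stalk y.1) :=
    { carrier := {s | IsRegularFamily s}
      add_mem' := fun h h' => h.add h'
      zero_mem' := isRegularFamily_zero
      smul_mem' := fun c s h => h.mul c }
  let _ : Module R ((∀ y : V, Y.presheaf.stalk y.1) ⧸ N) := Module.compHom _ ψ
  have _ : IsScalarTower R Γ(Y, V) ((∀ y : V, Y.presheaf.stalk y.1) ⧸ N) := ⟨fun a b m => by
    rw [Algebra.smul_def, mul_smul]; rfl⟩
  have hmul' : ∀ f f', N.mkQ (d (f * f')) = f • N.mkQ (d f') + f' • N.mkQ (d f) := by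
    intro f f'
    rw [hmul, ← map_smul, ← map_smul, ← map_add]
    rfl
  let D : Derivation R Γ(Y, V) ((∀ y : V, Y.presheaf.stalk y.1) ⧸ N) := Derivation.mk'
    { toFun := fun f => N.mkQ (d f)
      map_add' := fun f f' => by rw [hadd, map_add]
      map_smul' := fun r f => by
        have h0 : N.mkQ (d (ψ r)) = 0 := (Submodule.Quotient.mk_eq_zero N).mpr (hreg r)
        rw [Algebra.smul_def, hmul']
        change _ + f • N.mkQ (d (ψ r)) = _
        rw [h0, smul_zero, add_zero]
        rfl }
    hmul'
  have hD : D = 0 := by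
    ext f
    rw [← D.liftKaehlerDifferential_comp_D,
      Subsingleton.elim (KaehlerDifferential.D R Γ(Y, V) f) 0, map_zero]
    rfl
  have h2 : N.mkQ (d f) = 0 := congr($hD f)
  exact (Submodule.Quotient.mk_eq_zero N).mp h2

end Regular

section Poisson
variable {k : Type u} [Field k] {X Y : Sch k} (φ : Y ⟶ X)

theorem stkMap_germ {U : X.left.Opens} {V : Y.left.Opens} (hV : V ≤ φ.left ⁻¹ᵁ U) (y : Y.left)
    (hy : y ∈ V) (r : Γ(X.left, U)) :
    stkMap φ y (X.left.presheaf.germ U (φ.left y) (hV hy) r) =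
      Y.left.presheaf.germ V y hy (φ.left.appLE U V hV r) := by
  have h1 : stkMap φ y (X.left.presheaf.germ U (φ.left y) (hV hy) r) =
      Y.left.presheaf.germ (φ.left ⁻¹ᵁ U) y (hV hy) (φ.left.app U r) :=
    Scheme.Hom.germ_stalkMap_apply φ.left U y (hV hy) r
  rw [h1, Scheme.Hom.appLE, CommRingCat.comp_apply]
  exact (TopCat.Presheaf.germ_res_apply _ _ _ _ _).symm

/-- A bracket on `Y` that lifts the Poisson bracket of `X` takes sections to sections. -/
theorem regular_of_etale [Etale φ.left] {β : GermBracket Y} (π : PoissonStructure X)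
    (h : BracketRelated φ β π.bracket) (U : Y.left.Opens) (f g : Γ(Y.left, U)) (y : Y.left)
    (hy : y ∈ U) :
    ∃ (V : Y.left.Opens) (_ : y ∈ V) (hVU : V ≤ U) (s : Γ(Y.left, V)),
      ∀ (z : Y.left) (hz : z ∈ V),
        β z (Y.left.presheaf.germ U z (hVU hz) f) (Y.left.presheaf.germ U z (hVU hz) g) =
          Y.left.presheaf.germ V z hz s := by
  obtain ⟨W, hW, hyW, -⟩ := exists_isAffineOpen_mem_and_subset (X := X.left) (x := φ.left y)
    (U := ⊤) trivial
  obtain ⟨V, hV, hyV, hVU⟩ := exists_isAffineOpen_mem_and_subset (X := Y.left) (x := y)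
    (U := U ⊓ φ.left ⁻¹ᵁ W) ⟨hy, hyW⟩
  have hVU' : V ≤ U := fun z hz => (hVU hz).1
  have hVW : V ≤ φ.left ⁻¹ᵁ W := fun z hz => (hVU hz).2
  have hunr := φ.left.formallyUnramified_appLE hW hV hVW
  let ger (f : Γ(Y.left, V)) (z : V) : Stk Y z.1 := Y.left.presheaf.germ V z.1 z.2 f
  let d (f g : Γ(Y.left, V)) (z : V) : Stk Y z.1 := β z.1 (ger f z) (ger g z)
  -- The arguments of the bracket are extended from functions on `W` to functions on `V` one after
  -- the other.
  have h1 : ∀ r r', IsRegularFamily (d (φ.left.appLE W V hVW r) (φ.left.appLE W V hVW r')) := by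
    intro r r' z
    obtain ⟨V₀, hz, hV₀, g, hg⟩ := π.regular W r r' (φ.left z.1) (hVW z.2)
    refine ⟨V ⊓ φ.left ⁻¹ᵁ V₀, ⟨z.2, hz⟩, inf_le_left, φ.left.appLE V₀ _ inf_le_right g, ?_⟩
    intro z' hz'
    simp only [d, ger, ← stkMap_germ φ hVW z' hz'.1, h z']
    rw [← stkMap_germ φ inf_le_right z' hz', hg _ hz'.2]
  have h2 : ∀ f r', IsRegularFamily (d f (φ.left.appLE W V hVW r')) := by
    intro f r'
    refine isRegularFamily_of_formallyUnramified _ hunr (fun f => d f (φ.left.appLE W V hVW r'))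
      ?_ ?_ (fun r => h1 r r') f
    · intro f f'
      ext z
      simp [d, ger]
    · intro f f'
      ext z
      simp [d, ger]
  have h3 : ∀ f g, IsRegularFamily (d f g) := by
    intro f g
    refine isRegularFamily_of_formallyUnramified _ hunr (fun g => d f g)
      ?_ ?_ (fun r => h2 f r) g
    · intro f f'
      ext z
      simp [d, ger]
    · intro f f'
      ext z
      simp [d, ger]
  obtain ⟨V', hyV', hV', s, hs⟩ := h3 (Y.left.presheaf.map (homOfLE hVU').op f)
    (Y.left.presheaf.map (homOfLE hVU').op g) ⟨y, hyV⟩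
  refine ⟨V', hyV', hV'.trans hVU', s, fun z hz => ?_⟩
  rw [← hs z hz]
  simp only [d, ger, TopCat.Presheaf.germ_res_apply]

/-- In characteristic other than `2`, Poisson structures lift uniquely along étale morphisms. -/
theorem existsUnique_poissonStructure [Etale φ.left] (hk : (2 : k) ≠ 0) (γ : PoissonStructure X) :
    ∃! π : PoissonStructure Y, BracketRelated φ π.bracket γ.bracket := by
  obtain ⟨β, hβ, hu⟩ := existsUnique_bracketRelated φ γ.bracket
  have halt := alternating_of_etale φ hk hβ γ.alternating
  refine ⟨⟨β, halt, jacobi_of_etale φ hβ halt γ.jacobi, regular_of_etale φ γ hβ⟩, hβ, ?_⟩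
  rintro ⟨β', _, _, _⟩ h
  have : β' = β := hu _ h
  subst this
  rfl

end Poisson

/-! ### The bracket formula on the preimage of `G^*` -/

section Composition
variable {k : Type u} [Field k] {X Y Z : Sch k}

theorem stkMap_comp (φ : Y ⟶ X) (ψ : X ⟶ Z) (y : Y.left) (f : Stk Z (ψ.left (φ.left y))) :
    stkMap (φ ≫ ψ) y f = stkMap φ y (stkMap ψ (φ.left y) f) := by
  have h := Scheme.Hom.stalkMap_comp φ.left ψ.left y
  exact congr($(h).hom f)

theorem FieldRelated.comp {φ : Y ⟶ X} {ψ : X ⟶ Z} {v : GermField Y} {w : GermField X}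
    {u : GermField Z} (h : FieldRelated φ v w) (h' : FieldRelated ψ w u) :
    FieldRelated (φ ≫ ψ) v u := by
  intro y f
  have h1 := stkMap_comp φ ψ y f
  have h2 := stkMap_comp φ ψ y (u _ f)
  exact (congrArg (v y) h1).trans ((h y _).trans ((congrArg _ (h' _ f)).trans h2.symm))

/-- Derivations along a homomorphism are determined by their restriction along an étale
morphism. -/
theorem isDerAlong_ext_of_etale (φ : Y ⟶ X) [Etale φ.left] {y : Y.left} {R M : Type u} [CommRing R]
    [Algebra k R] [AddCommGroup M] [Module R M] [Module k M] [IsScalarTower k R M]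
    {ρ : Stk Y y →ₐ[k] R} {v w : Stk Y y →ₗ[k] M} (hv : IsDerAlong ρ v) (hw : IsDerAlong ρ w)
    (h : ∀ a, v (stkMap φ y a) = w (stkMap φ y a)) : v = w := by
  let _ : Module (Stk Y y) M := Module.compHom M ρ.toRingHom
  have _ : IsScalarTower k (Stk Y y) M := ⟨fun c a m => by
    change ρ (c • a) • m = c • (ρ a • m)
    rw [map_smul, smul_assoc]⟩
  let v' : Derivation k (Stk Y y) M := Derivation.mk' v fun a b => hv a b
  let w' : Derivation k (Stk Y y) M := Derivation.mk' w fun a b => hw a b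
  have h1 : v' = w' := derivation_ext_of_etale φ h
  ext a
  exact congr($h1 a)

end Composition

namespace GroupTriple
variable {k : Type u} [Field k] {T : GroupTriple k} (H : T.Quotient)

/-- The formula `{α^* f, -} = ∑ α^*(xᵃ f) c_a` for a bracket `β` and derivations `c` at a point `y`
of `Y`, for a morphism `α : Y ⟶ D/G`. -/
def LocalFormula (b : T.DualBases) {Y : Sch k} (α : Y ⟶ H.Q) (y : Y.left) (β : BiDer k (Stk Y y))
    (c : Fin b.n → Derivation k (Stk Y y) (Stk Y y)) : Prop :=
  ∀ f : Stk H.Q (α.left y), β (stkMap α y f) =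
    ∑ a, stkMap α y (infAct (α.left y) (dLie T.j (b.e a)) f) • c a

theorem derivation_sum_smul_apply {A : Type u} [CommRing A] [Algebra k A] {n : ℕ} (f : Fin n → A)
    (v : Fin n → Derivation k A A) (h : A) : (∑ a, f a • v a) h = ∑ a, f a * v a h := by
  rw [derivation_sum_apply]
  rfl

/-- The formula lifts and descends along étale morphisms. -/
theorem localFormula_comp_iff (b : T.DualBases) {X Y : Sch k} (φ : Y ⟶ X) [Etale φ.left]
    (μ : X ⟶ H.Q) (y : Y.left) {β : BiDer k (Stk Y y)} {γ : BiDer k (Stk X (φ.left y))}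
    {c : Fin b.n → Derivation k (Stk Y y) (Stk Y y)}
    {c' : Fin b.n → Derivation k (Stk X (φ.left y)) (Stk X (φ.left y))}
    (hβ : ∀ f h, β (stkMap φ y f) (stkMap φ y h) = stkMap φ y (γ f h))
    (hc : ∀ a f, c a (stkMap φ y f) = stkMap φ y (c' a f)) :
    LocalFormula H b (φ ≫ μ) y β c ↔ LocalFormula H b μ (φ.left y) γ c' := by
  have key : ∀ (f : Stk H.Q (μ.left (φ.left y))) h,
      (∑ a, stkMap φ y (stkMap μ (φ.left y)
        (infAct (μ.left (φ.left y)) (dLie T.j (b.e a)) f)) • c a) (stkMap φ y h) =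
      stkMap φ y ((∑ a, stkMap μ (φ.left y)
        (infAct (μ.left (φ.left y)) (dLie T.j (b.e a)) f) • c' a) h) := by
    intro f h
    rw [derivation_sum_smul_apply, derivation_sum_smul_apply, map_sum]
    simp only [map_mul, hc]
  have hcomp : LocalFormula H b (φ ≫ μ) y β c ↔ ∀ f : Stk H.Q (μ.left (φ.left y)),
      β (stkMap φ y (stkMap μ (φ.left y) f)) = ∑ a, stkMap φ y (stkMap μ (φ.left y)
        (infAct (μ.left (φ.left y)) (dLie T.j (b.e a)) f)) • c a := by
    refine forall_congr' fun f => ?_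
    have h1 := stkMap_comp φ μ y f
    have h2 : ∀ a, stkMap (φ ≫ μ) y (infAct ((φ ≫ μ).left y) (dLie T.j (b.e a)) f) = _ := fun a =>
      stkMap_comp φ μ y (infAct (μ.left (φ.left y)) (dLie T.j (b.e a)) f)
    simp only [h2]
    exact (congrArg β h1).congr_left
  rw [hcomp]
  constructor
  · intro h f
    ext g
    apply stkMap_injective φ y
    rw [← hβ, h, key]
  · intro h f
    refine derivation_ext_of_etale φ fun g => ?_
    rw [hβ, key, ← h]

variable (P : T.PoissonVariety) (μ : P.X ⟶ H.Q)

/-- The fibre square of `μ⁻¹(G^*)`. -/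
theorem preimage_condition : preimageFst H P μ ≫ μ = preimageSnd H P μ ≫ H.f :=
  Over.OverMorphism.ext pullback.condition

instance etale_preimageFst : Etale (preimageFst H P μ).left :=
  inferInstanceAs (Etale (pullback.fst μ.left H.f.left))

/-- The bracket formula with values in `G^*` and right-invariant vector fields of `G^*`. -/
def LuFormula (b : T.DualBases) {Y : Sch k} (ν : Y ⟶ T.Gs) (y : Y.left) (β : BiDer k (Stk Y y))
    (c : Fin b.n → Derivation k (Stk Y y) (Stk Y y)) : Prop :=
  ∀ f : Stk T.Gs (ν.left y), β (stkMap ν y f) =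
    ∑ a, stkMap ν y (rightInv (ν.left y) (b.e a) f) • c a

/-- As `f : G^* ⟶ D/G` is étale, it suffices to consider functions that are pulled back from `D/G`,
and on these the action of `𝔤^*` on `D/G` is given by right-invariant vector fields of `G^*`. -/
theorem localFormula_comp_f_iff (b : T.DualBases) {Y : Sch k} (ν : Y ⟶ T.Gs) (y : Y.left)
    (β : BiDer k (Stk Y y)) (c : Fin b.n → Derivation k (Stk Y y) (Stk Y y)) :
    LocalFormula H b (ν ≫ H.f) y β c ↔ LuFormula b ν y β c := by
  have hcomp : LocalFormula H b (ν ≫ H.f) y β c ↔ ∀ f : Stk H.Q (H.f.left (ν.left y)),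
      β (stkMap ν y (stkMap H.f (ν.left y) f)) = ∑ a, stkMap ν y
        (rightInv (ν.left y) (b.e a) (stkMap H.f (ν.left y) f)) • c a := by
    refine forall_congr' fun f => ?_
    have h1 := stkMap_comp ν H.f y f
    have h2 : ∀ a, stkMap (ν ≫ H.f) y (infAct ((ν ≫ H.f).left y) (dLie T.j (b.e a)) f) = _ :=
      fun a => (stkMap_comp ν H.f y (infAct (H.f.left (ν.left y)) (dLie T.j (b.e a)) f)).trans
        (congrArg (stkMap ν y) (H.rightInv_stkMap_f (ν.left y) (b.e a) f).symm)
    simp only [h2]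
    exact (congrArg β h1).congr_left
  rw [hcomp]
  refine ⟨fun h => ?_, fun h f => h _⟩
  let v : Stk T.Gs (ν.left y) →ₗ[k] Derivation k (Stk Y y) (Stk Y y) :=
    β.toLinearMap.comp (stkMap ν y).toLinearMap
  let w : Stk T.Gs (ν.left y) →ₗ[k] Derivation k (Stk Y y) (Stk Y y) :=
    { toFun := fun f => ∑ a, stkMap ν y (rightInv (ν.left y) (b.e a) f) • c a
      map_add' := fun f f' => by simp only [map_add, add_smul, Finset.sum_add_distrib]
      map_smul' := fun r f => by
        rw [RingHom.id_apply, Finset.smul_sum]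
        refine Finset.sum_congr rfl fun a _ => ?_
        rw [Derivation.map_smul, map_smul (stkMap ν y), smul_assoc] }
  have hv : IsDerAlong (stkMap ν y) v := fun f f' => by simp [v]
  have hw : IsDerAlong (stkMap ν y) w := fun f f' => by
    simp only [w, LinearMap.coe_mk, AddHom.coe_mk, Derivation.leibniz, map_add, smul_eq_mul,
      map_mul, add_smul, Finset.sum_add_distrib, mul_smul, Finset.smul_sum]
  have := isDerAlong_ext_of_etale H.f hv hw h
  exact fun f => congr($this f)

theorem sum_form_smul {b : T.DualBases} {V : Type u} [AddCommGroup V] [Module k V]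
    (L : Lie T.G →ₗ[k] V) (ξ : Lie T.G) :
    ∑ a, T.form (dLie T.j (b.e a)) (dLie T.i ξ) • L (b.x a) = L ξ := by
  conv_rhs => rw [← b.sum_x ξ, map_sum]
  simp only [map_smul]

variable {μ}

theorem IsRestrictedAction.add {a : Lie T.G → GermField (preimage H P μ)}
    (h : IsRestrictedAction H P μ a) (y : (preimage H P μ).left) (ξ χ : Lie T.G) :
    a (ξ + χ) y = a ξ y + a χ y :=
  derivation_ext_of_etale (preimageFst H P μ) fun f => by
    rw [h, Derivation.add_apply, h, h]
    beta_reduce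
    rw [map_add, Derivation.add_apply, map_add]

theorem IsRestrictedAction.smul {a : Lie T.G → GermField (preimage H P μ)}
    (h : IsRestrictedAction H P μ a) (y : (preimage H P μ).left) (r : k) (ξ : Lie T.G) :
    a (r • ξ) y = r • a ξ y :=
  derivation_ext_of_etale (preimageFst H P μ) fun f => by
    rw [h, Derivation.smul_apply, h]
    beta_reduce
    rw [map_smul, Derivation.smul_apply, map_smul]

/-- The infinitesimal action on the preimage of `G^*` makes the map to `G^*` equivariant. -/
theorem fieldRelated_preimageSnd (hμ : IsEquivariant H P μ) {δ : Lie T.G → GermField T.Gs}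
    {a : Lie T.G → GermField (preimage H P μ)} (hδ : H.IsDressingAction δ)
    (ha : IsRestrictedAction H P μ a) (ξ : Lie T.G) :
    FieldRelated (preimageSnd H P μ) (a ξ) (δ ξ) := by
  have h1 : FieldRelated (preimageFst H P μ ≫ μ) (a ξ) (fun s => infAct s (dLie T.i ξ)) :=
    (ha ξ).comp fun x f => infAct_mu H P hμ x ξ f
  rw [preimage_condition] at h1
  intro y
  let v : Stk T.Gs ((preimageSnd H P μ).left y) →ₗ[k] Stk (preimage H P μ) y :=
    (a ξ y).toLinearMap.comp (stkMap (preimageSnd H P μ) y).toLinearMap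
  let w : Stk T.Gs ((preimageSnd H P μ).left y) →ₗ[k] Stk (preimage H P μ) y :=
    (stkMap (preimageSnd H P μ) y).toLinearMap.comp (δ ξ _).toLinearMap
  have hv : IsDerAlong (stkMap (preimageSnd H P μ) y) v := fun f f' => by simp [v]
  have hw : IsDerAlong (stkMap (preimageSnd H P μ) y) w := fun f f' => by simp [w]
  have h2 := isDerAlong_ext_of_etale H.f hv hw fun f => by
    have h3 := h1 y f
    have h4 := stkMap_comp (preimageSnd H P μ) H.f y f
    have h5 := stkMap_comp (preimageSnd H P μ) H.f y
      (infAct (H.f.left ((preimageSnd H P μ).left y)) (dLie T.i ξ) f)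
    refine (congrArg (a ξ y) h4).symm.trans (h3.trans (h5.trans ?_))
    exact congrArg (stkMap (preimageSnd H P μ) y) (hδ ξ _ f).symm
  exact fun f => congr($h2 f)

/-- Lu's condition, with the Maurer–Cartan form expressed in terms of the frame of right-invariant
vector fields. The equivariance of the map to `G^*` is automatic. -/
theorem isLuMomentMap_iff (b : T.DualBases) (hμ : IsEquivariant H P μ)
    {δ : Lie T.G → GermField T.Gs} {a : Lie T.G → GermField (preimage H P μ)}
    {π : PoissonStructure (preimage H P μ)} (hδ : H.IsDressingAction δ)
    (ha : IsRestrictedAction H P μ a) :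
    IsLuMomentMap δ a π (preimageSnd H P μ) ↔
      ∀ y, LuFormula b (preimageSnd H P μ) y (π.bracket y) fun c => a (b.x c) y := by
  constructor
  · rintro ⟨-, h⟩ y
    obtain ⟨ω, hω, hω'⟩ := (isFrame_rightInv b ((preimageSnd H P μ).left y)).exists_dual
    have key : ∀ c, a (b.x c) y =
        (π.bracket y).liftKaehlerDifferential (pullForm (stkMap (preimageSnd H P μ) y) (ω c)) := by
      intro c
      refine h y (b.x c) (ω c) fun η => ?_
      exact b.eq_algebraMap_form (evalForm (rightInv ((preimageSnd H P μ).left y)) (ω c))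
        (fun c' => hω c' c) η
    intro f
    rw [← Derivation.liftKaehlerDifferential_comp_D, ← pullForm_D,
      hω' (KaehlerDifferential.D k _ f), map_sum, map_sum]
    refine Finset.sum_congr rfl fun c _ => ?_
    rw [Derivation.liftKaehlerDifferential_comp_D, pullForm_smul, map_smul, ← key]
  · intro h
    refine ⟨fieldRelated_preimageSnd H P hμ hδ ha, fun y ξ ω hω => ?_⟩
    let L : Lie T.G →ₗ[k] Derivation k (Stk (preimage H P μ) y) (Stk (preimage H P μ) y) :=
      { toFun := fun ξ => a ξ y
        map_add' := ha.add H P y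
        map_smul' := ha.smul H P y }
    rw [liftKaehlerDifferential_pullForm _ _ _ _ (h y) ω]
    refine (sum_form_smul (b := b) L ξ).symm.trans (Finset.sum_congr rfl fun c _ => ?_)
    rw [hω, AlgHom.commutes, algebraMap_smul]
    rfl

end GroupTriple

/-! ### Vector fields on the product of a group and a space with action -/

section Joint
variable {k : Type u} [Field k]

/-- The morphism `N × X ⟶ X` of an action. -/
abbrev actMor {k : Type u} [Field k] (N X : Sch k) [GrpObj N] [ModObj N X] : N ⊗ X ⟶ X :=
  fst N X • snd N X

/-- Derivations of a local ring of `Z` are determined by their restrictions along morphisms that are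
jointly monomorphic. -/
theorem isDerAlong_ext_of_jointly_mono {X Y Z : Sch k} (α : Z ⟶ Y) (β : Z ⟶ X)
    (hαβ : ∀ (W : Sch k) (u v : W ⟶ Z), u ≫ α = v ≫ α → u ≫ β = v ≫ β → u = v) {z : Z.left}
    {R : Type u} [CommRing R] [Algebra k R] {ρ : Stk Z z →ₐ[k] R} {v w : Stk Z z →ₗ[k] R}
    (hv : IsDerAlong ρ v) (hw : IsDerAlong ρ w) (h1 : ∀ f, v (stkMap α z f) = w (stkMap α z f))
    (h2 : ∀ f, v (stkMap β z f) = w (stkMap β z f)) : v = w := by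
  have key : ∀ {X : Sch k} (α : Z ⟶ X), (∀ f, v (stkMap α z f) = w (stkMap α z f)) →
      (specMap (tszHom ρ v hv) ≫ pt Z z) ≫ α = (specMap (tszHom ρ w hw) ≫ pt Z z) ≫ α := by
    intro X α h
    have h3 : (tszHom ρ v hv).comp (stkMap α z) = (tszHom ρ w hw).comp (stkMap α z) := by
      apply AlgHom.ext
      intro f
      apply TrivSqZeroExt.ext <;> simp [h]
    rw [Category.assoc, Category.assoc, ← stkMap_pt, ← Category.assoc, ← Category.assoc,
      specMap_comp, specMap_comp, h3]
  exact tszHom_injective (specMap_pt_injective _ _ (hαβ _ _ _ (key α h1) (key β h2)))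

theorem derivation_ext_of_jointly_mono {X Y Z : Sch k} (α : Z ⟶ Y)
    (β : Z ⟶ X)
    (hαβ : ∀ (W : Sch k) (u v : W ⟶ Z), u ≫ α = v ≫ α → u ≫ β = v ≫ β → u = v) {z : Z.left}
    {D D' : Derivation k (Stk Z z) (Stk Z z)} (h1 : ∀ f, D (stkMap α z f) = D' (stkMap α z f))
    (h2 : ∀ f, D (stkMap β z f) = D' (stkMap β z f)) : D = D' := by
  have h := isDerAlong_ext_of_jointly_mono α β hαβ (ρ := AlgHom.id k _) (v := D.toLinearMap)
    (w := D'.toLinearMap) (fun f h => D.leibniz f h) (fun f h => D'.leibniz f h) h1 h2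
  exact Derivation.ext fun g => LinearMap.congr_fun h g

theorem jointly_mono_fst_snd (Y X W : Sch k) (u v : W ⟶ Y ⊗ X) (h1 : u ≫ fst Y X = v ≫ fst Y X)
    (h2 : u ≫ snd Y X = v ≫ snd Y X) : u = v := by
  ext1
  · exact h1
  · exact h2

/-- A point `(g, x)` is determined by `g` and `g x`. -/
theorem jointly_mono_fst_act (N X W : Sch k) [GrpObj N] [ModObj N X] (u v : W ⟶ N ⊗ X)
    (h1 : u ≫ fst N X = v ≫ fst N X)
    (h2 : u ≫ (actMor N X) = v ≫ (actMor N X)) : u = v := by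
  ext1
  · exact h1
  · rw [ModObj.comp_smul, ModObj.comp_smul, h1] at h2
    simpa using congrArg ((v ≫ fst N X)⁻¹ • ·) h2

theorem dLie_id {G : Sch k} [GrpObj G] (ξ : Lie G) : dLie (𝟙 G) ξ = ξ := by
  apply Subtype.ext
  apply LinearMap.ext
  intro f
  have h : stkHomAlg (𝟙 G) = AlgHom.id k _ := by
    apply specMap_pt_injective G (unitPt G)
    rw [specMap_stkHomAlg, Category.comp_id, specMap_id, Category.id_comp]
  exact congrArg ξ.1 congr($h f)

/-- The velocity of a function `ψ^* f` depends only on the composition of the family with `ψ`. -/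
theorem velocity_congr {N X Y : Sch k} [GrpObj N] (ψ : Y ⟶ X) {y : Y.left}
    {m m' : specO k (Stk Y y) ⊗ N ⟶ Y} (hm : lift (𝟙 _) 1 ≫ m = pt Y y)
    (hm' : lift (𝟙 _) 1 ≫ m' = pt Y y) (h : m ≫ ψ = m' ≫ ψ) (ξ : Lie N) (f : Stk X (ψ.left y)) :
    velocity m hm ξ (stkMap ψ y f) = velocity m' hm' ξ (stkMap ψ y f) := by
  have h1 := velocityFun_spec m hm ξ
  have h2 := velocityFun_spec m' hm' ξ
  have h3 : specMap ((expDer (velocityFun m hm ξ)).comp (stkMap ψ y)) ≫ pt X _ =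
      specMap ((expDer (velocityFun m' hm' ξ)).comp (stkMap ψ y)) ≫ pt X _ := by
    rw [← specMap_comp, ← specMap_comp, Category.assoc, Category.assoc, stkMap_pt,
      ← Category.assoc, ← Category.assoc, h1, h2, orbitPt, orbitPt, Category.assoc, Category.assoc,
      h]
  have h4 := congr(($(specMap_pt_injective _ _ h3) f).snd)
  rwa [AlgHom.comp_apply, AlgHom.comp_apply, snd_expDer, snd_expDer] at h4

/-- The case `ι = 𝟙` of `velocity_naturality`. -/
theorem velocity_naturality_id {N X Y : Sch k} [GrpObj N] (ψ : Y ⟶ X) (y : Y.left)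
    {m : specO k (Stk X (ψ.left y)) ⊗ N ⟶ X} {m' : specO k (Stk Y y) ⊗ N ⟶ Y}
    (hm : lift (𝟙 _) 1 ≫ m = pt X _) (hm' : lift (𝟙 _) 1 ≫ m' = pt Y y)
    (h : m' ≫ ψ = (specMap (stkMap ψ y) ⊗ₘ 𝟙 N) ≫ m) (ξ : Lie N) (f : Stk X (ψ.left y)) :
    velocity m' hm' ξ (stkMap ψ y f) = stkMap ψ y (velocity m hm ξ f) := by
  rw [velocity_naturality (𝟙 N) ψ y hm hm' h, dLie_id]

/-- Functions `ψ^* f` are constant along a family whose composition with `ψ` is constant. -/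
theorem velocity_eq_zero {N X Y : Sch k} [GrpObj N] (ψ : Y ⟶ X) (y : Y.left)
    {m' : specO k (Stk Y y) ⊗ N ⟶ Y} (hm' : lift (𝟙 _) 1 ≫ m' = pt Y y)
    (h : m' ≫ ψ = fst _ _ ≫ pt Y y ≫ ψ) (ξ : Lie N) (f : Stk X (ψ.left y)) :
    velocity m' hm' ξ (stkMap ψ y f) = 0 := by
  have hm : lift (𝟙 _) (1 : specO k (Stk X (ψ.left y)) ⟶ N) ≫ (fst _ _ ≫ pt X (ψ.left y)) =
      pt X (ψ.left y) := by
    rw [lift_fst_assoc, Category.id_comp]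
  rw [velocity_naturality_id ψ y hm hm' (by
    rw [h, tensorHom_fst_assoc, stkMap_pt]), velocity_trivial, Derivation.zero_apply, map_zero]

theorem lift_pt {N X : Sch k} (z : (N ⊗ X).left) :
    lift (pt (N ⊗ X) z ≫ fst N X) (pt (N ⊗ X) z ≫ snd N X) = pt (N ⊗ X) z := by
  rw [← comp_lift, lift_fst_snd, Category.comp_id]

end Joint

section ProductFields
variable {k : Type u} [Field k] {N X : Sch k} [GrpObj N] (z : (N ⊗ X).left)

/-- The vector field of `(n, x) ↦ (exp(t ξ) n, x)`. -/
def prodR : Lie N →ₗ[k] Derivation k (Stk (N ⊗ X) z) (Stk (N ⊗ X) z) :=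
  velocity (lift (snd _ _ * (fst _ _ ≫ pt (N ⊗ X) z ≫ fst N X))
    (fst _ _ ≫ pt (N ⊗ X) z ≫ snd N X)) (by
    rw [comp_lift, MonObj.comp_mul, lift_snd, lift_fst_assoc, lift_fst_assoc, Category.id_comp,
      Category.id_comp, one_mul, lift_pt])

/-- The vector field of `(n, x) ↦ (n exp(t ξ), x)`. -/
def prodL : Lie N →ₗ[k] Derivation k (Stk (N ⊗ X) z) (Stk (N ⊗ X) z) :=
  velocity (lift ((fst _ _ ≫ pt (N ⊗ X) z ≫ fst N X) * snd _ _)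
    (fst _ _ ≫ pt (N ⊗ X) z ≫ snd N X)) (by
    rw [comp_lift, MonObj.comp_mul, lift_snd, lift_fst_assoc, lift_fst_assoc, Category.id_comp,
      Category.id_comp, mul_one, lift_pt])

theorem prodR_fst (ξ : Lie N) (f : Stk N ((fst N X).left z)) :
    prodR z ξ (stkMap (fst N X) z f) = stkMap (fst N X) z (rightInv _ ξ f) := by
  refine velocity_naturality_id (fst N X) z _ _ ?_ ξ f
  rw [lift_fst, MonObj.comp_mul, tensorHom_snd, tensorHom_fst_assoc, stkMap_pt, Category.comp_id]

theorem prodR_snd (ξ : Lie N) (f : Stk X ((snd N X).left z)) :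
    prodR z ξ (stkMap (snd N X) z f) = 0 :=
  velocity_eq_zero (snd N X) z _ (lift_snd _ _) ξ f

theorem prodL_fst (ξ : Lie N) (f : Stk N ((fst N X).left z)) :
    prodL z ξ (stkMap (fst N X) z f) = stkMap (fst N X) z (leftInv _ ξ f) := by
  refine velocity_naturality_id (fst N X) z _ _ ?_ ξ f
  rw [lift_fst, MonObj.comp_mul, tensorHom_snd, tensorHom_fst_assoc, stkMap_pt, Category.comp_id]

theorem prodL_snd (ξ : Lie N) (f : Stk X ((snd N X).left z)) :
    prodL z ξ (stkMap (snd N X) z f) = 0 :=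
  velocity_eq_zero (snd N X) z _ (lift_snd _ _) ξ f

end ProductFields

section ProductAction
variable {k : Type u} [Field k] {N X : Sch k} [GrpObj N] [ModObj N X] (z : (N ⊗ X).left)

/-- The vector field of `(n, x) ↦ (n, exp(t ξ) x)`. -/
def prodN : Lie N →ₗ[k] Derivation k (Stk (N ⊗ X) z) (Stk (N ⊗ X) z) :=
  velocity (lift (fst _ _ ≫ pt (N ⊗ X) z ≫ fst N X)
    ((snd _ _ : specO k (Stk (N ⊗ X) z) ⊗ N ⟶ N) • (fst _ _ ≫ pt (N ⊗ X) z ≫ snd N X))) (by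
    rw [comp_lift, ModObj.comp_smul, lift_snd, lift_fst_assoc, lift_fst_assoc, Category.id_comp,
      Category.id_comp, one_smul, lift_pt])

/-- The field `prodR` is mapped to the infinitesimal action, as `(exp(t ξ) n) x = exp(t ξ) (n x)`.
-/
theorem prodR_act (ξ : Lie N) (f : Stk X ((actMor N X).left z)) :
    prodR z ξ (stkMap (actMor N X) z f) =
      stkMap (actMor N X) z (infAct _ ξ f) := by
  refine velocity_naturality_id (actMor N X) z _ _ ?_ ξ f
  rw [ModObj.comp_smul, ModObj.comp_smul, lift_fst, lift_snd, tensorHom_snd, tensorHom_fst_assoc,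
    stkMap_pt, Category.comp_id, mul_smul, ModObj.comp_smul, ModObj.comp_smul]

theorem prodN_fst (ξ : Lie N) (f : Stk N ((fst N X).left z)) :
    prodN z ξ (stkMap (fst N X) z f) = 0 :=
  velocity_eq_zero (fst N X) z _ (lift_fst _ _) ξ f

theorem prodN_snd (ξ : Lie N) (f : Stk X ((snd N X).left z)) :
    prodN z ξ (stkMap (snd N X) z f) = stkMap (snd N X) z (infAct _ ξ f) := by
  refine velocity_naturality_id (snd N X) z _ _ ?_ ξ f
  rw [lift_snd, ModObj.comp_smul, tensorHom_snd, tensorHom_fst_assoc, stkMap_pt, Category.comp_id]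

/-- The fields `prodL` and `prodN` have the same image under the action, as
`(n exp(t ξ)) x = n (exp(t ξ) x)`. -/
theorem prodL_act (ξ : Lie N) (f : Stk X ((actMor N X).left z)) :
    prodL z ξ (stkMap (actMor N X) z f) = prodN z ξ (stkMap (actMor N X) z f) := by
  refine velocity_congr (actMor N X) _ _ ?_ ξ f
  rw [ModObj.comp_smul, ModObj.comp_smul, lift_fst, lift_snd, lift_fst, lift_snd, mul_smul]

end ProductAction

/-! ### Invariance of the bracket formula under the action of `G` -/

section Invariant
variable {k : Type u} [Field k] {N N' : Sch k} [GrpObj N] [GrpObj N'] (ι : N' ⟶ N) [IsMonHom ι]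

theorem rightInv_stkMap (y : N'.left) (ξ : Lie N') (f : Stk N (ι.left y)) :
    rightInv y ξ (stkMap ι y f) = stkMap ι y (rightInv (ι.left y) (dLie ι ξ) f) := by
  refine velocity_naturality ι ι y _ _ ?_ ξ f
  rw [GroupTriple.comp_mul_hom, MonObj.comp_mul, Category.assoc, tensorHom_fst_assoc, stkMap_pt,
    tensorHom_snd]

theorem leftInv_stkMap (y : N'.left) (ξ : Lie N') (f : Stk N (ι.left y)) :
    leftInv y ξ (stkMap ι y f) = stkMap ι y (leftInv (ι.left y) (dLie ι ξ) f) := by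
  refine velocity_naturality ι ι y _ _ ?_ ξ f
  rw [GroupTriple.comp_mul_hom, MonObj.comp_mul, Category.assoc, tensorHom_fst_assoc, stkMap_pt,
    tensorHom_snd]

end Invariant

namespace GroupTriple
variable {k : Type u} [Field k] {T : GroupTriple k} (H : T.Quotient) (P : T.PoissonVariety)
  {μ : P.X ⟶ H.Q}

section Transfer
variable (μ)

/-- The map `(g, x) ↦ (g, μ(x))` from `G × X` to `D × D/G`. It intertwines the actions of `G` and
`D`, and all functions of `D` and `D/G` that occur in the computation are pulled back along it. -/
def kappa : T.G ⊗ P.X ⟶ T.D ⊗ H.Q := T.i ⊗ₘ μ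

theorem kappa_fst : kappa H P μ ≫ fst T.D H.Q = fst T.G P.X ≫ T.i := tensorHom_fst _ _

theorem kappa_snd : kappa H P μ ≫ snd T.D H.Q = snd T.G P.X ≫ μ := tensorHom_snd _ _

theorem kappa_act (hμ : IsEquivariant H P μ) :
    kappa H P μ ≫ actMor T.D H.Q = actMor T.G P.X ≫ μ := by
  rw [ModObj.comp_smul, kappa_fst, kappa_snd, hμ]

end Transfer

/-- The combination `F ↦ ∑ K(D_a F) c_a` of derivations along a homomorphism `K`. -/
def pushSum {S R : Type u} [CommRing S] [Algebra k S] [CommRing R] [Algebra k R] (K : S →ₐ[k] R)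
    {n : ℕ} (v : Fin n → Derivation k S S) (c : Fin n → R) : S →ₗ[k] R :=
  ∑ a, (LinearMap.mulRight k (c a)).comp (K.toLinearMap.comp (v a).toLinearMap)

theorem pushSum_apply {S R : Type u} [CommRing S] [Algebra k S] [CommRing R] [Algebra k R]
    (K : S →ₐ[k] R) {n : ℕ} (v : Fin n → Derivation k S S) (c : Fin n → R) (F : S) :
    pushSum K v c F = ∑ a, K (v a F) * c a := by
  simp [pushSum]

theorem isDerAlong_pushSum {S R : Type u} [CommRing S] [Algebra k S] [CommRing R] [Algebra k R]
    (K : S →ₐ[k] R) {n : ℕ} (v : Fin n → Derivation k S S) (c : Fin n → R) :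
    IsDerAlong K (pushSum K v c) := by
  intro f h
  simp only [pushSum_apply, Derivation.leibniz, map_add, smul_eq_mul, map_mul, add_mul,
    Finset.sum_add_distrib, mul_assoc, Finset.mul_sum]

theorem isDerAlong_bracket_left {S R : Type u} [CommRing S] [Algebra k S] [CommRing R]
    [Algebra k R] (K : S →ₐ[k] R) (β : BiDer k R) (g : R) :
    IsDerAlong K ((β.flip g).toLinearMap.comp K.toLinearMap) := by
  intro f h
  simp

variable (b : T.DualBases) {β : GermBracket T.G} {β' : GermBracket (T.G ⊗ P.X)}

/-- The bracket formula at `g x`, as a formula for the bracket of `G × X`. -/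
theorem bracket_act (hμ : IsEquivariant H P μ)
    (hact : BracketRelated (actMor T.G P.X) β' P.poisson.bracket) (z : (T.G ⊗ P.X).left)
    (h : BracketFormula H b μ ((actMor T.G P.X).left z))
    (f : Stk H.Q ((actMor T.D H.Q).left ((kappa H P μ).left z)))
    (g : Stk P.X ((actMor T.G P.X).left z)) :
    β' z (stkMap (kappa H P μ) z (stkMap (actMor T.D H.Q) _ f)) (stkMap (actMor T.G P.X) z g) =
      ∑ a, stkMap (kappa H P μ) z (stkMap (actMor T.D H.Q) _ (infAct _ (dLie T.j (b.e a)) f)) *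
        stkMap (actMor T.G P.X) z (infAct _ (b.x a) g) := by
  have h2 : ∀ (f : Stk H.Q ((actMor T.G P.X ≫ μ).left z)),
      β' z (stkMap (actMor T.G P.X ≫ μ) z f) (stkMap (actMor T.G P.X) z g) =
        ∑ a, stkMap (actMor T.G P.X ≫ μ) z (infAct _ (dLie T.j (b.e a)) f) *
          stkMap (actMor T.G P.X) z (infAct _ (b.x a) g) := by
    intro f
    have h3 := stkMap_comp (actMor T.G P.X) μ z
    refine (congrArg (fun f' => β' z f' (stkMap (actMor T.G P.X) z g)) (h3 f)).trans ?_
    refine (hact z _ g).trans ?_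
    rw [h f, derivation_sum_smul_apply, map_sum]
    refine Finset.sum_congr rfl fun a _ => ?_
    rw [map_mul]
    exact congrArg (· * _) (h3 _).symm
  rw [← kappa_act H P μ hμ] at h2
  have h3 := stkMap_comp (kappa H P μ) (actMor T.D H.Q) z
  have h4 := h2 f
  refine (congrArg (fun f' => β' z f' (stkMap (actMor T.G P.X) z g)) (h3 f).symm).trans
    (h4.trans (Finset.sum_congr rfl fun a _ => ?_))
  exact congrArg (· * _) (h3 _)

/-- The tensor `r = ∑ xᵃ ⊗ x_a` given by dual bases. -/
def DualBases.r : Lie T.D ⊗[k] Lie T.D := ∑ a, dLie T.j (b.e a) ⊗ₜ[k] dLie T.i (b.x a)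

theorem DualBases.biTensor_r {A : Type u} [CommRing A] [Algebra k A]
    (v w : Lie T.D →ₗ[k] Derivation k A A) (f h : A) :
    biTensor v w b.r f h = ∑ a, v (dLie T.j (b.e a)) f * w (dLie T.i (b.x a)) h := by
  rw [DualBases.r, map_sum]
  simp only [biTensor_tmul, derivation_sum_apply, tensorDer_apply]

/-- The bracket of `G`, with its second argument on `G` only: the factors `x_a` of `r = ∑ xᵃ ⊗ x_a`
are tangent to `G`. -/
theorem bracket_restrict
    (hβ : BracketRelated T.i β (fun d =>
      biTensor (rightInv d) (rightInv d) b.r - biTensor (leftInv d) (leftInv d) b.r))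
    (y : T.G.left) (f : Stk T.D (T.i.left y)) (g : Stk T.D (T.i.left y)) :
    β y (stkMap T.i y f) (stkMap T.i y g) =
      ∑ a, stkMap T.i y (rightInv _ (dLie T.j (b.e a)) f) * rightInv _ (b.x a) (stkMap T.i y g) -
      ∑ a, stkMap T.i y (leftInv _ (dLie T.j (b.e a)) f) * leftInv _ (b.x a) (stkMap T.i y g) := by
  rw [hβ, Derivation.sub_apply, Derivation.sub_apply, b.biTensor_r, b.biTensor_r, map_sub,
    map_sum, map_sum]
  simp only [map_mul, rightInv_stkMap, leftInv_stkMap]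

/-- Brackets of functions on `D` with functions on `G`, as functions on `G × X`. -/
theorem bracket_fst
    (hβ : BracketRelated T.i β (fun d =>
      biTensor (rightInv d) (rightInv d) b.r - biTensor (leftInv d) (leftInv d) b.r))
    (hprod : IsProductBracket β' β P.poisson.bracket) (z : (T.G ⊗ P.X).left)
    (f : Stk T.D ((fst T.D H.Q).left ((kappa H P μ).left z))) (g : Stk T.G ((fst T.G P.X).left z)) :
    β' z (stkMap (kappa H P μ) z (stkMap (fst T.D H.Q) _ f)) (stkMap (fst T.G P.X) z g) =
      ∑ a, stkMap (kappa H P μ) z (stkMap (fst T.D H.Q) _ (rightInv _ (dLie T.j (b.e a)) f)) *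
        stkMap (fst T.G P.X) z (rightInv _ (b.x a) g) -
      ∑ a, stkMap (kappa H P μ) z (stkMap (fst T.D H.Q) _ (leftInv _ (dLie T.j (b.e a)) f)) *
        stkMap (fst T.G P.X) z (leftInv _ (b.x a) g) := by
  have h2 : ∀ (f : Stk T.D ((fst T.G P.X ≫ T.i).left z)),
      β' z (stkMap (fst T.G P.X ≫ T.i) z f) (stkMap (fst T.G P.X) z g) =
      ∑ a, stkMap (fst T.G P.X ≫ T.i) z (rightInv _ (dLie T.j (b.e a)) f) *
        stkMap (fst T.G P.X) z (rightInv _ (b.x a) g) -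
      ∑ a, stkMap (fst T.G P.X ≫ T.i) z (leftInv _ (dLie T.j (b.e a)) f) *
        stkMap (fst T.G P.X) z (leftInv _ (b.x a) g) := by
    intro f
    have h3 := stkMap_comp (fst T.G P.X) T.i z
    obtain ⟨g, rfl⟩ : ∃ g', stkMap T.i ((fst T.G P.X).left z) g' = g :=
      T.i.left.stalkMap_surjective _ g
    refine (congrArg (fun f' => β' z f' _) (h3 f)).trans ?_
    refine (hprod.1 z _ _).trans ?_
    refine (congrArg (stkMap (fst T.G P.X) z) (bracket_restrict b hβ _ f g)).trans ?_
    rw [map_sub, map_sum, map_sum]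
    refine congrArg₂ (· - ·) (Finset.sum_congr rfl fun a _ => ?_)
      (Finset.sum_congr rfl fun a _ => ?_)
    · rw [map_mul]
      exact congrArg (· * _) (h3 _).symm
    · rw [map_mul]
      exact congrArg (· * _) (h3 _).symm
  rw [← kappa_fst H P μ] at h2
  have h3 := stkMap_comp (kappa H P μ) (fst T.D H.Q) z
  refine (congrArg (fun f' => β' z f' _) (h3 f).symm).trans ((h2 f).trans ?_)
  refine congrArg₂ (· - ·) (Finset.sum_congr rfl fun a _ => ?_)
      (Finset.sum_congr rfl fun a _ => ?_)
  · exact congrArg (· * _) (h3 _)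
  · exact congrArg (· * _) (h3 _)

/-- Functions on `D` commute with functions on `X` for the product bracket. -/
theorem bracket_fst_snd (hprod : IsProductBracket β' β P.poisson.bracket) (z : (T.G ⊗ P.X).left)
    (f : Stk T.D ((fst T.D H.Q).left ((kappa H P μ).left z))) (g : Stk P.X ((snd T.G P.X).left z)) :
    β' z (stkMap (kappa H P μ) z (stkMap (fst T.D H.Q) _ f)) (stkMap (snd T.G P.X) z g) = 0 := by
  have h2 : ∀ (f : Stk T.D ((fst T.G P.X ≫ T.i).left z)),
      β' z (stkMap (fst T.G P.X ≫ T.i) z f) (stkMap (snd T.G P.X) z g) = 0 := by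
    intro f
    exact (congrArg (fun f' => β' z f' _) (stkMap_comp (fst T.G P.X) T.i z f)).trans
      (hprod.2.2 z _ _).1
  rw [← kappa_fst H P μ] at h2
  exact (congrArg (fun f' => β' z f' _) (stkMap_comp (kappa H P μ) (fst T.D H.Q) z f).symm).trans
    (h2 f)

/-- Functions on `D/G` commute with functions on `G` for the product bracket. -/
theorem bracket_snd_fst (hprod : IsProductBracket β' β P.poisson.bracket) (z : (T.G ⊗ P.X).left)
    (f : Stk H.Q ((snd T.D H.Q).left ((kappa H P μ).left z))) (g : Stk T.G ((fst T.G P.X).left z)) :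
    β' z (stkMap (kappa H P μ) z (stkMap (snd T.D H.Q) _ f)) (stkMap (fst T.G P.X) z g) = 0 := by
  have h2 : ∀ (f : Stk H.Q ((snd T.G P.X ≫ μ).left z)),
      β' z (stkMap (snd T.G P.X ≫ μ) z f) (stkMap (fst T.G P.X) z g) = 0 := by
    intro f
    exact (congrArg (fun f' => β' z f' _) (stkMap_comp (snd T.G P.X) μ z f)).trans
      (hprod.2.2 z _ _).2
  rw [← kappa_snd H P μ] at h2
  exact (congrArg (fun f' => β' z f' _) (stkMap_comp (kappa H P μ) (snd T.D H.Q) z f).symm).trans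
    (h2 f)

end GroupTriple

namespace GroupTriple
variable {k : Type u} [Field k] {T : GroupTriple k} (H : T.Quotient) (P : T.PoissonVariety)
  {μ : P.X ⟶ H.Q} (b : T.DualBases) {β : GermBracket T.G} {β' : GermBracket (T.G ⊗ P.X)}

/-- The value of `pushSum` at `F`, in terms of given values of the derivations at `F`. -/
theorem pushSum_congr {S R : Type u} [CommRing S] [Algebra k S] [CommRing R] [Algebra k R]
    (K : S →ₐ[k] R) {n : ℕ} {v : Fin n → Derivation k S S} {c : Fin n → R} {F : S}
    {s : Fin n → S} (h : ∀ a, v a F = s a) : pushSum K v c F = ∑ a, K (s a) * c a := by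
  simp only [pushSum_apply, h]

theorem pushSum_eq_zero {S R : Type u} [CommRing S] [Algebra k S] [CommRing R] [Algebra k R]
    (K : S →ₐ[k] R) {n : ℕ} {v : Fin n → Derivation k S S} {c : Fin n → R} {F : S}
    (h : ∀ a, v a F = 0) : pushSum K v c F = 0 := by
  simp only [pushSum_apply, h, map_zero, zero_mul, Finset.sum_const_zero]

/-- Brackets of functions on `D × D/G` with functions on `G`: both sides are derivations of the
first argument, and they agree on functions of either factor. -/
theorem bracket_fst_right
    (hβ : BracketRelated T.i β (fun d =>
      biTensor (rightInv d) (rightInv d) b.r - biTensor (leftInv d) (leftInv d) b.r))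
    (hprod : IsProductBracket β' β P.poisson.bracket) (z : (T.G ⊗ P.X).left)
    (F : Stk (T.D ⊗ H.Q) ((kappa H P μ).left z)) (g : Stk T.G ((fst T.G P.X).left z)) :
    β' z (stkMap (kappa H P μ) z F) (stkMap (fst T.G P.X) z g) =
      ∑ a, stkMap (kappa H P μ) z (prodR _ (dLie T.j (b.e a)) F) *
        stkMap (fst T.G P.X) z (rightInv _ (b.x a) g) -
      ∑ a, stkMap (kappa H P μ) z (prodL _ (dLie T.j (b.e a)) F) *
        stkMap (fst T.G P.X) z (leftInv _ (b.x a) g) := by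
  have h := isDerAlong_ext_of_jointly_mono (fst T.D H.Q) (snd T.D H.Q)
    (jointly_mono_fst_snd T.D H.Q)
    (isDerAlong_bracket_left (stkMap (kappa H P μ) z) (β' z) (stkMap (fst T.G P.X) z g))
    ((isDerAlong_pushSum (stkMap (kappa H P μ) z) (fun a => prodR _ (dLie T.j (b.e a)))
      fun a => stkMap (fst T.G P.X) z (rightInv _ (b.x a) g)).sub
      (isDerAlong_pushSum (stkMap (kappa H P μ) z) (fun a => prodL _ (dLie T.j (b.e a)))
      fun a => stkMap (fst T.G P.X) z (leftInv _ (b.x a) g))) ?_ ?_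
  · have h1 := LinearMap.congr_fun h F
    rwa [LinearMap.sub_apply, pushSum_apply, pushSum_apply] at h1
  · intro f
    rw [LinearMap.sub_apply, pushSum_congr _ fun a => prodR_fst _ _ _,
      pushSum_congr _ fun a => prodL_fst _ _ _]
    exact bracket_fst H P b hβ hprod z f g
  · intro f
    rw [LinearMap.sub_apply, pushSum_eq_zero _ fun a => prodR_snd _ _ _,
      pushSum_eq_zero _ fun a => prodL_snd _ _ _, sub_zero]
    exact bracket_snd_fst H P hprod z f g

/-- Brackets of the functions `(d, s) ↦ f(d s)` with arbitrary functions on `G × X`: both sides are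
derivations, and they agree on the functions of `g` and, by the bracket formula at `g x`, on the
functions of `g x`. -/
theorem bracket_act_left (hμ : IsEquivariant H P μ)
    (hβ : BracketRelated T.i β (fun d =>
      biTensor (rightInv d) (rightInv d) b.r - biTensor (leftInv d) (leftInv d) b.r))
    (hprod : IsProductBracket β' β P.poisson.bracket)
    (hact : BracketRelated (actMor T.G P.X) β' P.poisson.bracket) (z : (T.G ⊗ P.X).left)
    (h : BracketFormula H b μ ((actMor T.G P.X).left z))
    (f : Stk H.Q ((actMor T.D H.Q).left ((kappa H P μ).left z))) :
    β' z (stkMap (kappa H P μ) z (stkMap (actMor T.D H.Q) _ f)) =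
      ∑ a, stkMap (kappa H P μ) z (stkMap (actMor T.D H.Q) _ (infAct _ (dLie T.j (b.e a)) f)) •
        prodR z (b.x a) -
      ∑ a, stkMap (kappa H P μ) z (prodL _ (dLie T.j (b.e a)) (stkMap (actMor T.D H.Q) _ f)) •
        (prodL z (b.x a) - prodN z (b.x a)) := by
  refine derivation_ext_of_jointly_mono (fst T.G P.X) (actMor T.G P.X)
    (fun W u v => jointly_mono_fst_act T.G P.X W u v) ?_ ?_
  · intro g
    refine (bracket_fst_right H P b hβ hprod z _ g).trans ?_
    rw [Derivation.sub_apply, derivation_sum_smul_apply, derivation_sum_smul_apply]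
    simp only [Derivation.sub_apply, prodR_fst, prodL_fst, prodN_fst, sub_zero, prodR_act]
  · intro g
    refine (bracket_act H P b hμ hact z h f g).trans ?_
    rw [Derivation.sub_apply, derivation_sum_smul_apply, derivation_sum_smul_apply]
    simp only [Derivation.sub_apply, prodR_act, prodL_act, sub_self, mul_zero,
      Finset.sum_const_zero, sub_zero]

/-- Brackets of functions on `D × D/G` with functions on `X`: both sides are derivations of the
first argument, and they agree on the functions of `d`, where they vanish, and of `d s`. -/
theorem bracket_snd_right (hμ : IsEquivariant H P μ)
    (hβ : BracketRelated T.i β (fun d =>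
      biTensor (rightInv d) (rightInv d) b.r - biTensor (leftInv d) (leftInv d) b.r))
    (hprod : IsProductBracket β' β P.poisson.bracket)
    (hact : BracketRelated (actMor T.G P.X) β' P.poisson.bracket) (z : (T.G ⊗ P.X).left)
    (h : BracketFormula H b μ ((actMor T.G P.X).left z))
    (F : Stk (T.D ⊗ H.Q) ((kappa H P μ).left z)) (g : Stk P.X ((snd T.G P.X).left z)) :
    β' z (stkMap (kappa H P μ) z F) (stkMap (snd T.G P.X) z g) =
      ∑ a, stkMap (kappa H P μ) z (prodN _ (dLie T.j (b.e a)) F) *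
        stkMap (snd T.G P.X) z (infAct _ (b.x a) g) := by
  have h := isDerAlong_ext_of_jointly_mono (fst T.D H.Q) (actMor T.D H.Q)
    (fun W u v => jointly_mono_fst_act T.D H.Q W u v)
    (isDerAlong_bracket_left (stkMap (kappa H P μ) z) (β' z) (stkMap (snd T.G P.X) z g))
    (isDerAlong_pushSum (stkMap (kappa H P μ) z) (fun a => prodN _ (dLie T.j (b.e a)))
      fun a => stkMap (snd T.G P.X) z (infAct _ (b.x a) g)) ?_ ?_
  · have h1 := LinearMap.congr_fun h F
    rwa [pushSum_apply] at h1
  · intro f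
    rw [pushSum_eq_zero _ fun a => prodN_fst _ _ _]
    exact bracket_fst_snd H P hprod z f g
  · intro f
    rw [pushSum_congr _ fun a => (prodL_act _ _ _).symm]
    refine (congrArg (fun D : Derivation k _ _ => D (stkMap (snd T.G P.X) z g))
      (bracket_act_left H P b hμ hβ hprod hact z h f)).trans ?_
    rw [Derivation.sub_apply, derivation_sum_smul_apply, derivation_sum_smul_apply]
    simp only [Derivation.sub_apply, prodR_snd, prodL_snd, prodN_snd, mul_zero,
      Finset.sum_const_zero, zero_sub, mul_neg, Finset.sum_neg_distrib, neg_neg]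

/-- The bracket formula at `g x` implies the bracket formula at `x`: it is `bracket_snd_right` for
the functions `(d, s) ↦ f(s)`, and the projection `G × X ⟶ X` is flat, hence injective on germs. -/
theorem BracketFormula.of_act (hμ : IsEquivariant H P μ)
    (hβ : BracketRelated T.i β (fun d =>
      biTensor (rightInv d) (rightInv d) b.r - biTensor (leftInv d) (leftInv d) b.r))
    (hprod : IsProductBracket β' β P.poisson.bracket)
    (hact : BracketRelated (actMor T.G P.X) β' P.poisson.bracket) (z : (T.G ⊗ P.X).left)
    (h : BracketFormula H b μ ((actMor T.G P.X).left z)) :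
    BracketFormula H b μ ((snd T.G P.X).left z) := by
  have hflat : Flat (snd T.G P.X).left := by
    have := T.algG.smooth
    change Flat (pullback.snd T.G.hom P.X.hom)
    infer_instance
  intro f
  ext g
  apply stkMap_injective (snd T.G P.X) z
  have h2 : ∀ f : Stk H.Q ((kappa H P μ ≫ snd T.D H.Q).left z),
      β' z (stkMap (kappa H P μ ≫ snd T.D H.Q) z f) (stkMap (snd T.G P.X) z g) =
      ∑ a, stkMap (kappa H P μ ≫ snd T.D H.Q) z (infAct _ (dLie T.j (b.e a)) f) *
        stkMap (snd T.G P.X) z (infAct _ (b.x a) g) := by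
    intro f
    have h3 := stkMap_comp (kappa H P μ) (snd T.D H.Q) z
    refine (congrArg (fun f' => β' z f' _) (h3 f)).trans ?_
    refine (bracket_snd_right H P b hμ hβ hprod hact z h _ g).trans ?_
    refine Finset.sum_congr rfl fun a _ => congrArg (· * _) ?_
    exact (congrArg _ (prodN_snd _ _ _)).trans (h3 _).symm
  rw [kappa_snd] at h2
  have h3 := stkMap_comp (snd T.G P.X) μ z
  refine (hprod.2.1 z _ _).symm.trans ((congrArg (fun f' => β' z f' _) (h3 f).symm).trans
    ((h2 f).trans ?_))
  rw [derivation_sum_smul_apply, map_sum]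
  refine Finset.sum_congr rfl fun a _ => ?_
  rw [map_mul]
  exact congrArg (· * _) (h3 _)

end GroupTriple

/-! ### Translating points of `X` into the preimage of `G^*` -/

section Points
variable {k : Type u} [Field k]

/-- Points of two spaces with the same image are the images of a point of a common space over
both. -/
theorem exists_common_point {X Y Z : Sch k} (α : X ⟶ Z) (β : Y ⟶ Z) (x : X.left) (y : Y.left)
    (h : α.left x = β.left y) :
    ∃ (W : Sch k) (u : W ⟶ X) (v : W ⟶ Y) (w : W.left), u ≫ α = v ≫ β ∧ u.left w = x ∧
      v.left w = y := by
  obtain ⟨w, hx, hy⟩ := Scheme.Pullback.exists_preimage_pullback x y h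
  refine ⟨Over.mk (pullback.fst α.left β.left ≫ X.hom), Over.homMk (pullback.fst _ _),
    Over.homMk (pullback.snd _ _) ?_, w, Over.OverMorphism.ext pullback.condition, hx, hy⟩
  change _ = pullback.fst α.left β.left ≫ X.hom
  rw [← Over.w α, ← Over.w β, pullback.condition_assoc]

/-- A point is the image of a space with one point, the spectrum of its residue field. -/
theorem exists_one_point_map (X : Sch k) (x : X.left) :
    ∃ (W : Sch k) (u : W ⟶ X), Nonempty W.left ∧ ∀ w, u.left w = x :=
  ⟨Over.mk (X.left.fromSpecResidueField x ≫ X.hom), Over.homMk (X.left.fromSpecResidueField x),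
    ⟨IsLocalRing.closedPoint (X.left.residueField x)⟩, fun w =>
      Scheme.fromSpecResidueField_apply x w⟩

theorem flat_hom (X : Sch k) : Flat X.hom := by
  have : Subsingleton (Spec (CommRingCat.of k)) := inferInstanceAs (Subsingleton (PrimeSpectrum k))
  infer_instance

end Points

namespace GroupTriple
variable {k : Type u} [Field k] {T : GroupTriple k} (H : T.Quotient)

/-- If `D/G` is irreducible, every family `d` of points of `D`, parametrized by `W`, has at some
point of `W`, and after an extension of the residue field, a left translate `d₁ d` such that both
`d₁` and `d₁ d` have image in `f(G^*)`. -/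
theorem Quotient.exists_translate [IrreducibleSpace H.Q.left] {W : Sch k} [Nonempty W.left]
    (d : W ⟶ T.D) :
    ∃ (Z : Sch k) (z : Z.left) (w : Z ⟶ W) (d₁ : Z ⟶ T.D),
      (d₁ ≫ H.q).left z ∈ Set.range H.f.left ∧
      ((d₁ * (w ≫ d)) ≫ H.q).left z ∈ Set.range H.f.left := by
  -- The automorphism `(w, d₁) ↦ (w, d₁ d(w))` shows that `(w, d₁) ↦ d₁ d(w) G` is flat.
  let τ : W ⊗ T.D ⟶ W ⊗ T.D := lift (fst W T.D) (snd W T.D * (fst W T.D ≫ d))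
  let σ : W ⊗ T.D ⟶ W ⊗ T.D := lift (fst W T.D) (snd W T.D * (fst W T.D ≫ d)⁻¹)
  have h1 : τ ≫ σ = 𝟙 _ := by
    simp [τ, σ, MonObj.comp_mul, GrpObj.comp_inv]
  have h2 : σ ≫ τ = 𝟙 _ := by
    simp [τ, σ, MonObj.comp_mul]
  have hτ : IsIso τ := ⟨σ, h1, h2⟩
  have hW := flat_hom W
  have hsnd : Flat (snd W T.D).left := inferInstanceAs (Flat (pullback.snd W.hom T.D.hom))
  have hφ : Flat ((τ ≫ snd W T.D) ≫ H.q).left := by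
    have : IsIso τ.left := inferInstanceAs (IsIso ((Over.forget _).map τ))
    rw [Over.comp_left, Over.comp_left]
    infer_instance
  obtain ⟨w⟩ := ‹Nonempty W.left›
  let z₀ : (W ⊗ T.D).left := (lift (𝟙 W) 1 : W ⟶ W ⊗ T.D).left w
  have hopen : IsOpen (Set.range H.f.left) := H.f.left.isOpenMap.isOpen_range
  have hne : ((1 : W ⟶ T.D) ≫ H.q).left w ∈ Set.range H.f.left := by
    refine ⟨(1 : W ⟶ T.Gs).left w, ?_⟩
    have h3 : (1 : W ⟶ T.Gs) ≫ H.f = (1 : W ⟶ T.D) ≫ H.q := by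
      rw [Quotient.f, ← Category.assoc, MonObj.one_comp]
    rw [← h3]
    rfl
  have hgen : genericPoint H.Q.left ∈ Set.range H.f.left :=
    (genericPoint_spec H.Q.left).mem_open_set_iff hopen |>.2 ⟨_, trivial, hne⟩
  -- Flat morphisms lift generalizations: a generalization `z` of `z₀` maps to the generic point,
  -- and both of the open conditions hold at `z`.
  obtain ⟨z, hz, hz'⟩ := Flat.generalizingMap ((τ ≫ snd W T.D) ≫ H.q).left
    ((genericPoint_spec H.Q.left).specializes (y := ((τ ≫ snd W T.D) ≫ H.q).left z₀) trivial)
  refine ⟨W ⊗ T.D, z, fst W T.D, snd W T.D, ?_, ?_⟩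
  · have h3 : IsOpen ((snd W T.D ≫ H.q).left ⁻¹' Set.range H.f.left) :=
      hopen.preimage (snd W T.D ≫ H.q).left.continuous
    refine hz.mem_open h3 ?_
    have h4 : lift (𝟙 W) 1 ≫ snd W T.D ≫ H.q = 1 ≫ H.q := by rw [lift_snd_assoc]
    rw [← h4] at hne
    exact hne
  · have h3 : τ ≫ snd W T.D = snd W T.D * (fst W T.D ≫ d) := lift_snd _ _
    rw [h3] at hz'
    rw [hz']
    exact hgen

variable (P : T.PoissonVariety) {μ : P.X ⟶ H.Q}

/-- If `D/G` is irreducible, every `G`-orbit in `X` meets `μ⁻¹(G^*)`: if `μ(x) = d G` with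
`d₁ G = u G` and `d₁ d G = u' G` for points `u` and `u'` of `G^*`, then `d₁ = u g` with `g ∈ G`, and
`μ(g x) = g d G = u⁻¹ u' G`. -/
theorem exists_act_mem_range [IrreducibleSpace H.Q.left] (hμ : IsEquivariant H P μ)
    (x : P.X.left) : ∃ z : (T.G ⊗ P.X).left, (snd T.G P.X).left z = x ∧
      (actMor T.G P.X).left z ∈ Set.range (preimageFst H P μ).left := by
  obtain ⟨d₀, hd₀⟩ := H.q.left.surjective (μ.left x)
  obtain ⟨W₁, d', x', w₁, h₁, -, hx⟩ := exists_common_point H.q μ d₀ x hd₀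
  -- Over a space with one point, all points lie over `x`.
  obtain ⟨W, e, _, he⟩ := exists_one_point_map W₁ w₁
  obtain ⟨Z₁, z₁, c₁, d₁, ⟨a, ha⟩, ⟨a', ha'⟩⟩ := H.exists_translate (e ≫ d')
  obtain ⟨Z₂, c₂, u, z₂, h₂, hz₂, -⟩ := exists_common_point (d₁ ≫ H.q) H.f z₁ a ha.symm
  obtain ⟨Z₃, c₃, u', z₃, h₃, -, -⟩ :=
    exists_common_point (c₂ ≫ (d₁ * (c₁ ≫ e ≫ d')) ≫ H.q) H.f z₂ a' (by
      rw [ha', ← hz₂]; rfl)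
  let y : Z₃ ⟶ P.X := c₃ ≫ c₂ ≫ c₁ ≫ e ≫ x'
  obtain ⟨g, hg⟩ := (H.eq_iff Z₃ (c₃ ≫ u ≫ T.j) (c₃ ≫ c₂ ≫ d₁)).1 (by
    simpa [Quotient.f] using congrArg (c₃ ≫ ·) h₂.symm)
  have h₄ : (g • y) ≫ μ = ((c₃ ≫ u)⁻¹ * u') ≫ H.f := by
    have h₅ : (c₃ ≫ u ≫ T.j) • ((g ≫ T.i) • (y ≫ μ)) = u' ≫ H.f := by
      rw [← h₃, MonObj.comp_mul_assoc, MonObj.comp_mul_assoc, hg, H.map_mul, mul_smul]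
      simp only [y, Category.assoc, h₁]
    rw [hμ, Quotient.f, ← Category.assoc, MonObj.mul_comp, H.map_mul, Category.assoc u',
      ← Quotient.f, ← h₅, GrpObj.inv_comp, eq_inv_smul_iff, Category.assoc c₃ u]
  refine ⟨(lift g y).left z₃, ?_, ?_⟩
  · have h₅ : lift g y ≫ snd T.G P.X = y := lift_snd _ _
    have h₆ : (lift g y ≫ snd T.G P.X).left z₃ = x := by
      rw [h₅, ← hx, ← he (c₁.left (c₂.left (c₃.left z₃)))]
      rfl
    exact h₆
  · have h₅ : lift g y ≫ actMor T.G P.X = g • y := by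
      rw [ModObj.comp_smul, lift_fst, lift_snd]
    have h₆ : μ.left ((lift g y ≫ actMor T.G P.X).left z₃) =
        H.f.left (((c₃ ≫ u)⁻¹ * u').left z₃) := by
      rw [h₅]
      exact congr(($h₄).left z₃)
    obtain ⟨p, hp, -⟩ := Scheme.Pullback.exists_preimage_pullback _ _ h₆
    exact ⟨p, hp⟩

end GroupTriple

/-! ### The comparison of moment maps -/

namespace GroupTriple
variable {k : Type u} [Field k] {T : GroupTriple k} (H : T.Quotient) (P : T.PoissonVariety)
  {μ : P.X ⟶ H.Q}

/-- The bracket formula over `G^*` is Lu's moment map condition for `μ⁻¹(G^*)`. -/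
theorem isLuMomentMap_iff_bracketFormula (b : T.DualBases) (hμ : IsEquivariant H P μ)
    {δ : Lie T.G → GermField T.Gs} {a : Lie T.G → GermField (preimage H P μ)}
    {π : PoissonStructure (preimage H P μ)} (hδ : H.IsDressingAction δ)
    (ha : IsRestrictedAction H P μ a) (hπ : IsRestrictedPoisson H P μ π) :
    IsLuMomentMap δ a π (preimageSnd H P μ) ↔
      ∀ y, BracketFormula H b μ ((preimageFst H P μ).left y) := by
  rw [isLuMomentMap_iff H P b hμ hδ ha]
  refine forall_congr' fun y => ?_
  have h := localFormula_comp_iff H b (preimageFst H P μ) μ y (β := π.bracket y)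
    (γ := P.poisson.bracket _) (c := fun c => a (b.x c) y) (c' := fun c => infAct _ (b.x c))
    (hπ y) (fun c => ha (b.x c) y)
  rw [preimage_condition, localFormula_comp_f_iff] at h
  exact h

theorem left_preimageFst_mem_range (y : (preimage H P μ).left) :
    μ.left ((preimageFst H P μ).left y) ∈ Set.range H.f.left := by
  refine ⟨(preimageSnd H P μ).left y, ?_⟩
  exact congr(($(preimage_condition H P μ)).left y).symm

/-- The bracket formula at all points implies the moment map condition for all complements. -/
theorem BracketFormula.isAKSMomentMap (b : T.DualBases) (hμ : IsEquivariant H P μ)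
    (h : ∀ x, BracketFormula H b μ x) : IsAKSMomentMap H P μ :=
  fun _ _ _ ht _ _ x _ _ _ hω => (h x).eq_twisted H P hμ ht hω

end GroupTriple

end MomentMap

end

theorem mainTheorem10 {k : Type u} [Field k] (hk : (2 : k) ≠ 0) (T : GroupTriple k)
    (H : T.Quotient) (P : T.PoissonVariety) (μ : P.X ⟶ H.Q)
    (hμ : GroupTriple.IsEquivariant H P μ) :
    (∃! δ, H.IsDressingAction δ) ∧
    (∃! a, GroupTriple.IsRestrictedAction H P μ a) ∧
    (∃! π, GroupTriple.IsRestrictedPoisson H P μ π) ∧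
    ∀ δ a π, H.IsDressingAction δ → GroupTriple.IsRestrictedAction H P μ a →
      GroupTriple.IsRestrictedPoisson H P μ π →
      (GroupTriple.IsAKSMomentMap H P μ →
        GroupTriple.IsLuMomentMap δ a π (GroupTriple.preimageSnd H P μ)) ∧
      (IrreducibleSpace H.Q.left →
        GroupTriple.IsLuMomentMap δ a π (GroupTriple.preimageSnd H P μ) →
        GroupTriple.IsAKSMomentMap H P μ) := by
  refine ⟨existsUnique_fieldRelated_family H.f _,
    existsUnique_fieldRelated_family (GroupTriple.preimageFst H P μ) _,
    existsUnique_poissonStructure (GroupTriple.preimageFst H P μ) hk P.poisson,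
    fun δ a π hδ ha hπ => ?_⟩
  obtain ⟨β, β', ⟨r, hr, hβ⟩, hprod, hact⟩ := P.action_poisson
  obtain ⟨b, rfl⟩ := GroupTriple.exists_dualBases T hr
  rw [GroupTriple.isLuMomentMap_iff_bracketFormula H P b hμ hδ ha hπ]
  refine ⟨fun h y => h.bracketFormula H P b _ (GroupTriple.left_preimageFst_mem_range H P y),
    fun hQ h => GroupTriple.BracketFormula.isAKSMomentMap H P b hμ fun x => ?_⟩
  obtain ⟨z, rfl, y, hy⟩ := GroupTriple.exists_act_mem_range H P hμ x
  refine GroupTriple.BracketFormula.of_act H P b hμ hβ hprod hact z ?_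
  rw [← hy]
  exact h y
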